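/- Let $T>0$, $\beta\in(1/4,1/2)$ and $2\le p<\frac1{1-2\beta}$, and write $\mathbb R_+=(0,\infty)$. Let $\psi\in C^\beta([0,T])$ with $\psi(0)=0$, $b\in L^\infty([0,T],L^2(\mathbb R_+))$, $\tilde\gamma\in L^\infty([0,T]\times\mathbb R_+)$, and $s_0\in W^{1,p}(\mathbb R_+)$ with $s_0(0)=0$. Let $G(t,x)=\frac1{\sqrt{4\pi t}}e^{-x^2/(4t)}$ be the heat kernel and, for $t>0$, let $$\overline G(t,\cdot)*_Df\,(x)=\int_0^\infty\big(G(t,x-y)-G(t,x+y)\big)f(y)\,dy ,$$ with $\overline G(0,\cdot)*_Df=f$. All identities below are between functions of $x\in\mathbb R_+$, almost everywhere. (a) The problem $\partial_t\tilde s=\partial_x^2\tilde s+b\,\partial_x\tilde s+\tilde\gamma\,\tilde s$, $\tilde s(0,\cdot)=s_0$, $\tilde s(t,0)=\psi(t)$ has a unique mild solution in $L^\infty([0,T],W^{1,p}(\mathbb R_+))$, i.e. there is a unique $\tilde s$ in this space such that, for every $t\in[0,T]$, $$\tilde s(t,\cdot)=-2\int_0^t\partial_xG(t-\tau,\cdot)\psi(\tau)\,d\tau+\overline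 G(t,\cdot)*_Ds_0+\int_0^t\overline G(t-\tau,\cdot)*_D\big(b(\tau,\cdot)\partial_x\tilde s(\tau,\cdot)+\tilde\gamma(\tau,\cdot)\tilde s(\tau,\cdot)\big)\,d\tau .$$ (b) This solution decomposes as $\tilde s(t,\cdot)=\tilde u(t,\cdot)+\tilde v(t,\cdot)$ for every $t\in[0,T]$, where $\tilde u$ is the unique mild solution in $L^\infty([0,T],W^{1,p}(\mathbb R_+))$ of the heat equation $\partial_t\tilde u=\partial_x^2\tilde u$ with $\tilde u(0,\cdot)=0$, $\tilde u(t,0)=\psi(t)$, i.e. for every $t\in[0,T]$ $$\tilde u(t,\cdot)=-2\int_0^t\partial_xG(t-\tau,\cdot)\psi(\tau)\,d\tau ,$$ and $\tilde v$ is the unique mild solution in $L^\infty([0,T],W^{1,p}(\mathbb R_+))$ of $\partial_t\tilde v=\partial_x^2\tilde v+b\,\partial_x\tilde v+\tilde\gamma\,\tilde v+b\,\partial_x\tilde u+\tilde\gamma\,\tilde u$ with $\tilde v(0,\cdot)=s_0$, $\tilde v(t,0)=0$, i.e. for every $t\in[0,T]$ $$\tilde v(t,\cdot)=\overline G(t,\cdot)*_Ds_0+\int_0^t\overline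 G(t-\tau,\cdot)*_D\big(b\,\partial_x\tilde v+\tilde\gamma\,\tilde v\big)(\tau,\cdot)\,d\tau+\int_0^t\overline G(t-\tau,\cdot)*_D\big(b\,\partial_x\tilde u+\tilde\gamma\,\tilde u\big)(\tau,\cdot)\,d\tau .$$ Uniqueness means that two solutions coincide, as elements of $W^{1,p}(\mathbb R_+)$, at every $t\in[0,T]$. -/

import Mathlib

open MeasureTheory Set
open scoped ENNReal NNReal ContDiff

noncomputable section

namespace HalfLine

/-- Lebesgue measure on the half-line `(0, ∞)`. -/
abbrev μ : Measure ℝ := volume.restrict (Ioi 0)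

/-- Lebesgue measure on the time interval `[0, T]`. -/
abbrev timeμ (T : ℝ) : Measure ℝ := volume.restrict (Icc 0 T)

/-- `g` is the weak derivative of `f` on the open half-line `(0, ∞)`. -/
def IsWeakDeriv (f g : ℝ → ℝ) : Prop :=
  ∀ φ : ℝ → ℝ, ContDiff ℝ ∞ φ → HasCompactSupport φ → tsupport φ ⊆ Ioi 0 →
    ∫ x in Ioi 0, f x * deriv φ x = - ∫ x in Ioi 0, g x * φ x

theorem integrable_Lp_mul {p : ℝ≥0∞} [Fact (1 ≤ p)] (f : Lp ℝ p μ) {φ : ℝ → ℝ}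
    (hφ : Continuous φ) (hc : HasCompactSupport φ) : Integrable (fun x => f x * φ x) μ := by
  have h := ((Lp.memLp f).locallyIntegrable Fact.out).integrable_smul_left_of_hasCompactSupport
    hφ hc
  refine h.congr (Filter.Eventually.of_forall fun x => ?_)
  simp [mul_comm]

/-- The Sobolev space `W^{1,p}(0, ∞)`, as a subspace of `L^p × L^p`: the pairs `(f, g)` of `L^p` functions such that `g` is the
weak derivative of `f` (so `g` is determined by `f`), with the norm
`(‖f‖_p ^ p + ‖g‖_p ^ p)^(1/p)`. -/
def sobolevSubmodule (p : ℝ≥0∞) [Fact (1 ≤ p)] : Submodule ℝ (WithLp p (Lp ℝ p μ × Lp ℝ p μ)) where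
  carrier := {w | IsWeakDeriv w.fst w.snd}
  zero_mem' := by
    intro φ _ _ _
    have h := Lp.coeFn_zero ℝ p μ
    have h1 : ∫ x in Ioi 0, (0 : Lp ℝ p μ) x * deriv φ x = 0 :=
      integral_eq_zero_of_ae (by filter_upwards [h] with x hx; rw [hx]; simp)
    have h2 : ∫ x in Ioi 0, (0 : Lp ℝ p μ) x * φ x = 0 :=
      integral_eq_zero_of_ae (by filter_upwards [h] with x hx; rw [hx]; simp)
    change ∫ x in Ioi 0, (0 : Lp ℝ p μ) x * deriv φ x = - ∫ x in Ioi 0, (0 : Lp ℝ p μ) x * φ x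
    rw [h1, h2, neg_zero]
  add_mem' := by
    intro v w hv hw φ hφ hc hs
    have hd : Continuous (deriv φ) := hφ.continuous_deriv (by simp)
    have key : ∀ (f g : Lp ℝ p μ) (χ : ℝ → ℝ), Continuous χ → HasCompactSupport χ →
        ∫ x in Ioi 0, (f + g) x * χ x = (∫ x in Ioi 0, f x * χ x) + ∫ x in Ioi 0, g x * χ x := by
      intro f g χ h1 h2
      rw [← integral_add (integrable_Lp_mul f h1 h2) (integrable_Lp_mul g h1 h2)]
      refine integral_congr_ae ?_
      filter_upwards [Lp.coeFn_add f g] with x hx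
      rw [hx]; simp [add_mul]
    change ∫ x in Ioi 0, (v.fst + w.fst) x * deriv φ x = - ∫ x in Ioi 0, (v.snd + w.snd) x * φ x
    rw [key _ _ _ hd hc.deriv, key _ _ _ hφ.continuous hc, hv φ hφ hc hs, hw φ hφ hc hs, neg_add]
  smul_mem' := by
    intro c w hw φ hφ hc hs
    have key : ∀ (f : Lp ℝ p μ) (χ : ℝ → ℝ),
        ∫ x in Ioi 0, (c • f) x * χ x = c * ∫ x in Ioi 0, f x * χ x := by
      intro f χ
      rw [← integral_const_mul]
      refine integral_congr_ae ?_
      filter_upwards [Lp.coeFn_smul c f] with x hx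
      rw [hx]; simp [mul_assoc]
    change ∫ x in Ioi 0, (c • w.fst) x * deriv φ x = - ∫ x in Ioi 0, (c • w.snd) x * φ x
    rw [key, key, hw φ hφ hc hs, mul_neg]

/-- The normed space `W^{1,p}(0, ∞)`. -/
abbrev W1p (p : ℝ≥0∞) [Fact (1 ≤ p)] : Type := sobolevSubmodule p

namespace W1p

variable {p : ℝ≥0∞} [Fact (1 ≤ p)]

/-- The `L^p` function underlying an element of `W^{1,p}(0, ∞)`. -/
def toLp (w : W1p p) : Lp ℝ p μ := w.1.fst

/-- The weak derivative of an element of `W^{1,p}(0, ∞)`. -/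
def weakDeriv (w : W1p p) : Lp ℝ p μ := w.1.snd

/-- The continuous representative of `w` on `[0, ∞)` takes the value `a` at `0`. -/
def HasBoundaryValue (w : W1p p) (a : ℝ) : Prop :=
  ∃ g : ℝ → ℝ, ContinuousOn g (Ici 0) ∧ g =ᵐ[μ] w.toLp ∧ g 0 = a

end W1p

/-- The heat kernel `G(t, x) = (4πt)^(-1/2) exp(-x² / (4t))`, for `t > 0`. -/
def G (t x : ℝ) : ℝ := 1 / √(4 * Real.pi * t) * Real.exp (-x ^ 2 / (4 * t))

/-- The Dirichlet heat operator
`(Ḡ(t,·) *_D f)(x) = ∫_0^∞ (G(t, x - y) - G(t, x + y)) f(y) dy` for `t > 0`; at `t = 0`, where the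
heat kernel is the Dirac mass, it is the identity. -/
def dirichletHeat (t : ℝ) (f : ℝ → ℝ) (x : ℝ) : ℝ :=
  if t = 0 then f x else ∫ y in Ioi 0, (G t (x - y) - G t (x + y)) * f y

/-- The boundary potential `-2 ∫_0^t ∂ₓG(t - τ, x) ψ(τ) dτ`. -/
def boundaryPotential (ψ : ℝ → ℝ) (t x : ℝ) : ℝ :=
  -2 * ∫ τ in (0 : ℝ)..t, deriv (fun z => G (t - τ) z) x * ψ τ

/-- The Duhamel term `∫_0^t (Ḡ(t - τ,·) *_D F(τ,·))(x) dτ`. -/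
def duhamel (F : ℝ → ℝ → ℝ) (t x : ℝ) : ℝ :=
  ∫ τ in (0 : ℝ)..t, dirichletHeat (t - τ) (F τ) x

variable {p : ℝ≥0∞} [Fact (1 ≤ p)]

/-- The lower order terms `b(τ,·) ∂ₓw(τ,·) + γ(τ,·) w(τ,·)`. -/
def lowerOrder (b : ℝ → Lp ℝ 2 μ) (γ : ℝ × ℝ → ℝ) (w : ℝ → W1p p) (τ y : ℝ) : ℝ :=
  b τ y * (w τ).weakDeriv y + γ (τ, y) * (w τ).toLp y

/-- `u` is an `L^∞([0,T], W^{1,p})` mild solution of the heat equation `∂ₜu = ∂ₓ²u` with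
`u(0, x) = 0` and `u(t, 0) = ψ(t)`. Paths are functions on `ℝ` of which only the values on `[0, T]`
matter. -/
structure IsMildSolutionHeat (T : ℝ) (ψ : ℝ → ℝ) (u : ℝ → W1p p) : Prop where
  memLp : MemLp u ∞ (timeμ T)
  eqn : ∀ t ∈ Icc 0 T, (u t).toLp =ᵐ[μ] fun x => boundaryPotential ψ t x

/-- `s` is an `L^∞([0,T], W^{1,p})` mild solution of `∂ₜs = ∂ₓ²s + b ∂ₓs + γ s` with
`s(0, x) = s₀(x)` and `s(t, 0) = ψ(t)`. -/
structure IsMildSolution (T : ℝ) (ψ : ℝ → ℝ) (b : ℝ → Lp ℝ 2 μ) (γ : ℝ × ℝ → ℝ) (s₀ : W1p p)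
    (s : ℝ → W1p p) : Prop where
  memLp : MemLp s ∞ (timeμ T)
  eqn : ∀ t ∈ Icc 0 T, (s t).toLp =ᵐ[μ] fun x =>
    boundaryPotential ψ t x + dirichletHeat t s₀.toLp x + duhamel (lowerOrder b γ s) t x

/-- `v` is an `L^∞([0,T], W^{1,p})` mild solution of
`∂ₜv = ∂ₓ²v + b ∂ₓv + γ v + b ∂ₓu + γ u` with `v(0, x) = v₀(x)` and `v(t, 0) = 0`. -/
structure IsMildSolutionZeroBdry (T : ℝ) (b : ℝ → Lp ℝ 2 μ) (γ : ℝ × ℝ → ℝ) (v₀ : W1p p)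
    (u v : ℝ → W1p p) : Prop where
  memLp : MemLp v ∞ (timeμ T)
  eqn : ∀ t ∈ Icc 0 T, (v t).toLp =ᵐ[μ] fun x =>
    dirichletHeat t v₀.toLp x + duhamel (lowerOrder b γ v) t x + duhamel (lowerOrder b γ u) t x

end HalfLine

end

/-! All three problems are linear Volterra equations `s = r + V s` in `L^∞([0,T], W^{1,p})`. Here
`(V s)(t) = ∫_0^t V(t,τ) s(τ) dτ`, and `V(t,τ) w` is the Dirichlet heat flow at time `t - τ` of
`b(τ) ∂ₓw + γ(τ) w`. If `‖V(t,τ)‖ ≤ ρ(t - τ)` with `ρ` integrable, then `V` contracts by `1/2` in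
the norm weighted by `e^{-lt}`, `l` large. The Neumann series therefore converges, and the solution
is unique at every `t`. What remains is to bound the kernel and the free terms.

Kernel. The heat kernel and its space derivatives are bounded by powers of `c = t^{-1/2}` times
`e^{-c|x-y|}`. Schur's test then gives the rate `1 + t^{-1/2}` for `γ w`. The product `b ∂ₓw` of an
`L²` and an `L^p` function need not be in `L^p`. Cauchy–Schwarz takes out `‖b‖₂`, and Schur's test
in `L^{p/2}` (this is where `2 ≤ p` enters) handles `|∂ₓw|²`; the gain of `t^{1/4}` gives the rate
`t^{-1/4} + t^{-3/4}`, still integrable (`eLpNorm_expConv_mul_le`, `Coeffs.isVolterraKernel`).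

Initial datum. As `s₀(0) = 0`, the derivative of the Dirichlet flow of `s₀` is the Neumann flow of
`s₀'`, so the flow is bounded in `W^{1,p}` up to `t = 0` (`norm_heatW_le_of_primitive`).

Boundary potential. The bound for `∂ₓG(s,·)` in `W^{1,p}` is of order `s^{-3/2+1/(2p)}` near `0`,
which is not integrable. Replacing `ψ(τ)` by `ψ(τ) - ψ(t)` improves it to `s^{δ-1}` with `δ = β -
1/2 + 1/(2p)`, and `δ > 0` is exactly `p < 1/(1-2β)`. The remainder `ψ(t) ∫_0^t ∂ₓG` is explicit, a
Gaussian tail at `x/√t`. Its norm is of order `t^{δ}`, since `|ψ(t)| ≤ C t^β` by `ψ(0) = 0`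
(`exists_boundary_path`).

The decomposition is linearity: `u` is the potential, and `v = s - u` solves the equation with free
term `Ḡ *_D s₀ + V u`. Since a weak derivative is determined by its function, the a.e. identities of
the statement are the same as identities in `W^{1,p}`. Evaluation at a point `x > 0` is continuous
there, which turns Bochner integrals into the pointwise integrals of the definitions. -/

noncomputable section

/-! ### Linear Volterra equations with integrable operator kernels -/

section Volterra

open Filter Topology

variable {E : Type*} [NormedAddCommGroup E] [NormedSpace ℝ E]

/-- A family of operators `V t τ` is a Volterra kernel on `[0, T]` with rate `ρ` if it is measurable
along measurable paths and `‖V t τ‖ ≤ ρ (t - τ)` with `ρ` integrable on `(0, T]`. -/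
structure IsVolterraKernel (T : ℝ) (ρ : ℝ → ℝ) (V : ℝ → ℝ → E →L[ℝ] E) : Prop where
  meas : ∀ w : ℝ → E, StronglyMeasurable w →
    StronglyMeasurable fun q : ℝ × ℝ => V q.1 q.2 (w q.2)
  bound : ∀ t τ, 0 ≤ τ → τ < t → t ≤ T → ‖V t τ‖ ≤ ρ (t - τ)
  integrable : IntegrableOn ρ (Ioc 0 T)

/-- The Volterra integral `∫_0^t V t τ (w τ) dτ`. -/
def volterra (V : ℝ → ℝ → E →L[ℝ] E) (w : ℝ → E) (t : ℝ) : E :=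
  ∫ τ in (0 : ℝ)..t, V t τ (w τ)

/-- Dominated convergence: `e^{-ns}` tends to `0` at every `s > 0`. This chooses the weight that
makes the Volterra operator a contraction on all of `[0, T]`, with no splitting into short
intervals. -/
theorem exists_exp_weight_integral_le {T : ℝ} {ρ : ℝ → ℝ} (hρ : IntegrableOn ρ (Ioc 0 T)) :
    ∃ l : ℝ, 0 ≤ l ∧ ∫ s in Ioc 0 T, Real.exp (-l * s) * ‖ρ s‖ ≤ 1 / 2 := by
  have h : Tendsto (fun n : ℕ => ∫ s in Ioc 0 T, Real.exp (-(n : ℝ) * s) * ‖ρ s‖) atTop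
      (𝓝 (∫ s in Ioc 0 T, (0 : ℝ))) := by
    refine tendsto_integral_of_dominated_convergence (fun s => ‖ρ s‖) ?_ hρ.norm ?_ ?_
    · intro n
      exact (by fun_prop : Continuous fun s : ℝ => Real.exp (-(n : ℝ) * s)).aestronglyMeasurable.mul
        hρ.norm.aestronglyMeasurable
    · intro n
      filter_upwards [ae_restrict_mem measurableSet_Ioc] with s hs
      rw [norm_mul, norm_norm, Real.norm_eq_abs, Real.abs_exp]
      refine mul_le_of_le_one_left (norm_nonneg _) (Real.exp_le_one_iff.2 ?_)
      have := mul_nonneg (Nat.cast_nonneg (α := ℝ) n) hs.1.le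
      linarith
    · filter_upwards [ae_restrict_mem measurableSet_Ioc] with s hs
      rw [← zero_mul ‖ρ s‖]
      refine Tendsto.mul_const _ (Real.tendsto_exp_atBot.comp ?_)
      have : Tendsto (fun n : ℕ => (n : ℝ) * s) atTop atTop :=
        tendsto_natCast_atTop_atTop.atTop_mul_const hs.1
      refine (tendsto_neg_atTop_atBot.comp this).congr fun n => ?_
      simp
  rw [integral_zero] at h
  obtain ⟨n, hn⟩ := (h.eventually (eventually_le_nhds (by norm_num : (0 : ℝ) < 1 / 2))).exists
  exact ⟨n, Nat.cast_nonneg n, hn⟩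

theorem _root_.MeasureTheory.MemLp.exists_ae_norm_le {α F : Type*} [MeasurableSpace α]
    [NormedAddCommGroup F] {ν : Measure α} {f : α → F} (hf : MemLp f ∞ ν) :
    ∃ N : ℝ, ∀ᵐ x ∂ν, ‖f x‖ ≤ N := by
  refine ⟨(eLpNorm f ∞ ν).toReal, ?_⟩
  have h : ∀ᵐ x ∂ν, ‖f x‖ₑ ≤ eLpNorm f ∞ ν := ae_le_eLpNormEssSup
  filter_upwards [h] with x hx
  have := ENNReal.toReal_mono hf.2.ne hx
  rwa [toReal_enorm] at this

namespace IsVolterraKernel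

variable {T : ℝ} {ρ : ℝ → ℝ} {V : ℝ → ℝ → E →L[ℝ] E}

theorem aestronglyMeasurable (hV : IsVolterraKernel T ρ V) {w : ℝ → E}
    (hw : AEStronglyMeasurable w (volume.restrict (Icc 0 T))) {t : ℝ} (ht : t ∈ Icc 0 T) :
    AEStronglyMeasurable (fun τ => V t τ (w τ)) (volume.restrict (Ioc 0 t)) := by
  have h1 : StronglyMeasurable fun τ => V t τ (hw.mk w τ) :=
    (hV.meas _ hw.stronglyMeasurable_mk).comp_measurable measurable_prodMk_left
  refine h1.aestronglyMeasurable.congr ?_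
  have h2 := ae_restrict_of_ae_restrict_of_subset
    (Ioc_subset_Icc_self.trans (Icc_subset_Icc_right ht.2)) hw.ae_eq_mk
  filter_upwards [h2] with τ hτ
  rw [hτ]

theorem norm_apply_le (hV : IsVolterraKernel T ρ V) {t τ : ℝ} (ht : t ∈ Icc 0 T)
    (hτ : τ ∈ Ioo 0 t) (e : E) : ‖V t τ e‖ ≤ ‖ρ (t - τ)‖ * ‖e‖ :=
  ((V t τ).le_opNorm e).trans (mul_le_mul_of_nonneg_right
    ((hV.bound t τ hτ.1.le hτ.2 ht.2).trans (Real.le_norm_self _)) (norm_nonneg e))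

theorem integrableOn_rate (hV : IsVolterraKernel T ρ V) {t : ℝ} (ht : t ∈ Icc 0 T) :
    IntegrableOn (fun τ => ρ (t - τ)) (Ioc 0 t) := by
  have h : IntervalIntegrable ρ volume 0 t :=
    (intervalIntegrable_iff_integrableOn_Ioc_of_le ht.1).2
      (hV.integrable.mono_set (Ioc_subset_Ioc_right ht.2))
  have h2 := (h.comp_sub_left t).symm
  simp only [sub_self, sub_zero] at h2
  exact (intervalIntegrable_iff_integrableOn_Ioc_of_le ht.1).1 h2

/-- Discards the endpoint `τ = t`, where no bound on the kernel is assumed. -/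
theorem ae_mem_Ioo (t : ℝ) : ∀ᵐ τ ∂(volume.restrict (Ioc 0 t)), τ ∈ Ioo 0 t := by
  rw [← restrict_Ioo_eq_restrict_Ioc]
  exact ae_restrict_mem measurableSet_Ioo

theorem integrableOn (hV : IsVolterraKernel T ρ V) {w : ℝ → E} {N : ℝ}
    (hw : AEStronglyMeasurable w (volume.restrict (Icc 0 T)))
    (hN : ∀ᵐ τ ∂(volume.restrict (Icc 0 T)), ‖w τ‖ ≤ N) {t : ℝ} (ht : t ∈ Icc 0 T) :
    IntegrableOn (fun τ => V t τ (w τ)) (Ioc 0 t) := by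
  refine ((hV.integrableOn_rate ht).norm.mul_const N).mono' (hV.aestronglyMeasurable hw ht) ?_
  filter_upwards [ae_mem_Ioo t, ae_restrict_of_ae_restrict_of_subset
    (Ioc_subset_Icc_self.trans (Icc_subset_Icc_right ht.2)) hN] with τ hτ hb
  exact (hV.norm_apply_le ht hτ _).trans (mul_le_mul_of_nonneg_left hb (norm_nonneg _))

theorem intervalIntegrable (hV : IsVolterraKernel T ρ V) {w : ℝ → E}
    (hw : MemLp w ∞ (volume.restrict (Icc 0 T))) {t : ℝ} (ht : t ∈ Icc 0 T) :
    IntervalIntegrable (fun τ => V t τ (w τ)) volume 0 t :=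
  (intervalIntegrable_iff_integrableOn_Ioc_of_le ht.1).2
    (hV.integrableOn hw.1 hw.exists_ae_norm_le.choose_spec ht)

theorem stronglyMeasurable_volterra (hV : IsVolterraKernel T ρ V) {w : ℝ → E}
    (hw : AEStronglyMeasurable w (volume.restrict (Icc 0 T))) :
    AEStronglyMeasurable (volterra V w) (volume.restrict (Icc 0 T)) := by
  -- As an integral over the whole line of a function cut off to the triangle `0 < τ ≤ t`, the
  -- Volterra integral inherits measurability from joint measurability.
  have h1 : StronglyMeasurable fun q : ℝ × ℝ =>
      {q : ℝ × ℝ | 0 < q.2 ∧ q.2 ≤ q.1}.indicator (fun q => V q.1 q.2 (hw.mk w q.2)) q :=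
    (hV.meas _ hw.stronglyMeasurable_mk).indicator
      ((measurableSet_lt measurable_const measurable_snd).inter
        (measurableSet_le measurable_snd measurable_fst))
  refine (h1.integral_prod_right' (ν := volume)).aestronglyMeasurable.congr ?_
  filter_upwards [ae_restrict_mem measurableSet_Icc] with t ht
  rw [volterra, intervalIntegral.integral_of_le ht.1, ← integral_indicator measurableSet_Ioc]
  have h2 := ae_restrict_of_ae_restrict_of_subset
    (Ioc_subset_Icc_self.trans (Icc_subset_Icc_right ht.2)) hw.ae_eq_mk
  refine integral_congr_ae ?_
  filter_upwards [(ae_restrict_iff' measurableSet_Ioc).1 h2] with τ hτ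
  by_cases h : τ ∈ Ioc 0 t
  · rw [indicator_of_mem h, indicator_of_mem (show (t, τ) ∈ {q : ℝ × ℝ | 0 < q.2 ∧ q.2 ≤ q.1} from h),
      hτ h]
  · rw [indicator_of_notMem h,
      indicator_of_notMem (show (t, τ) ∉ {q : ℝ × ℝ | 0 < q.2 ∧ q.2 ≤ q.1} from h)]

/-- Contraction in the weighted norm, from `e^{lτ} = e^{lt} e^{-l(t-τ)}`. The input bound is needed
only almost everywhere while the output holds at every `t`; this gives uniqueness at every time. -/
theorem norm_volterra_le (hV : IsVolterraKernel T ρ V) {w : ℝ → E} {l N : ℝ}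
    (hl : ∫ s in Ioc 0 T, Real.exp (-l * s) * ‖ρ s‖ ≤ 1 / 2) (hl0 : 0 ≤ l) (hN0 : 0 ≤ N)
    (hN : ∀ᵐ τ ∂(volume.restrict (Icc 0 T)), ‖w τ‖ ≤ N * Real.exp (l * τ))
    {t : ℝ} (ht : t ∈ Icc 0 T) : ‖volterra V w t‖ ≤ N / 2 * Real.exp (l * t) := by
  have hint : IntervalIntegrable (fun s => Real.exp (-l * s) * ‖ρ s‖) volume 0 t := by
    rw [intervalIntegrable_iff_integrableOn_Ioc_of_le ht.1]
    have : IntegrableOn (fun s => Real.exp (-l * s) * ‖ρ s‖) (Ioc 0 T) := by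
      refine hV.integrable.norm.mono' ((by fun_prop :
        Continuous fun s : ℝ => Real.exp (-l * s)).aestronglyMeasurable.mul
        hV.integrable.norm.aestronglyMeasurable) ?_
      filter_upwards [ae_restrict_mem measurableSet_Ioc] with s hs
      rw [norm_mul, norm_norm, Real.norm_eq_abs, Real.abs_exp]
      refine mul_le_of_le_one_left (norm_nonneg _) (Real.exp_le_one_iff.2 ?_)
      have := mul_nonneg hl0 hs.1.le
      linarith
    exact this.mono_set (Ioc_subset_Ioc_right ht.2)
  have hint' := (hint.comp_sub_left t).symm
  simp only [sub_self, sub_zero] at hint'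
  have h1 : ‖volterra V w t‖ ≤ ∫ τ in (0 : ℝ)..t,
      N * Real.exp (l * t) * (Real.exp (-l * (t - τ)) * ‖ρ (t - τ)‖) := by
    refine intervalIntegral.norm_integral_le_of_norm_le ht.1 ?_ (hint'.const_mul _)
    rw [← ae_restrict_iff' measurableSet_Ioc]
    filter_upwards [ae_mem_Ioo t, ae_restrict_of_ae_restrict_of_subset
      (Ioc_subset_Icc_self.trans (Icc_subset_Icc_right ht.2)) hN] with τ hτ hb
    refine (hV.norm_apply_le ht hτ _).trans
      ((mul_le_mul_of_nonneg_left hb (norm_nonneg _)).trans_eq ?_)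
    have : Real.exp (l * τ) = Real.exp (l * t) * Real.exp (-l * (t - τ)) := by
      rw [← Real.exp_add]; ring_nf
    rw [this]; ring
  rw [intervalIntegral.integral_const_mul,
    intervalIntegral.integral_comp_sub_left (fun s => Real.exp (-l * s) * ‖ρ s‖) t, sub_self,
    sub_zero, intervalIntegral.integral_of_le ht.1] at h1
  have h2 : ∫ s in Ioc 0 t, Real.exp (-l * s) * ‖ρ s‖ ≤ 1 / 2 := by
    refine (setIntegral_mono_set ?_ ?_ (Ioc_subset_Ioc_right ht.2).eventuallyLE).trans hl
    · refine hV.integrable.norm.mono' ((by fun_prop :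
        Continuous fun s : ℝ => Real.exp (-l * s)).aestronglyMeasurable.mul
        hV.integrable.norm.aestronglyMeasurable) ?_
      filter_upwards [ae_restrict_mem measurableSet_Ioc] with s hs
      rw [norm_mul, norm_norm, Real.norm_eq_abs, Real.abs_exp]
      refine mul_le_of_le_one_left (norm_nonneg _) (Real.exp_le_one_iff.2 ?_)
      have := mul_nonneg hl0 hs.1.le
      linarith
    · exact Eventually.of_forall fun s => by positivity
  refine h1.trans ((mul_le_mul_of_nonneg_left h2 (by positivity)).trans_eq ?_)
  ring

/-- Iterating the contraction bounds `‖d t‖` by a multiple of `2^{-n}` for every `n`. -/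
theorem eq_zero_of_eq_volterra (hV : IsVolterraKernel T ρ V) {d : ℝ → E} {N : ℝ}
    (hN : ∀ᵐ τ ∂(volume.restrict (Icc 0 T)), ‖d τ‖ ≤ N)
    (h : ∀ t ∈ Icc 0 T, d t = volterra V d t) {t : ℝ} (ht : t ∈ Icc 0 T) : d t = 0 := by
  obtain ⟨l, hl0, hl⟩ := exists_exp_weight_integral_le hV.integrable
  have key : ∀ n : ℕ, ∀ᵐ τ ∂(volume.restrict (Icc 0 T)),
      ‖d τ‖ ≤ |N| * (1 / 2) ^ n * Real.exp (l * τ) := by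
    intro n
    induction n with
    | zero =>
      filter_upwards [hN, ae_restrict_mem measurableSet_Icc] with τ h1 h2
      have : 1 ≤ Real.exp (l * τ) := Real.one_le_exp (mul_nonneg hl0 h2.1)
      rw [pow_zero, mul_one]
      exact (h1.trans (le_abs_self N)).trans (le_mul_of_one_le_right (abs_nonneg N) this)
    | succ n ih =>
      filter_upwards [ae_restrict_mem measurableSet_Icc] with τ hτ
      rw [h τ hτ]
      refine (hV.norm_volterra_le hl hl0 (by positivity) ih hτ).trans_eq ?_
      ring
  have h3 : ∀ n : ℕ, ‖d t‖ ≤ |N| * (1 / 2) ^ n / 2 * Real.exp (l * t) := by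
    intro n
    rw [h t ht]
    exact hV.norm_volterra_le hl hl0 (by positivity) (key n) ht
  have h4 : Tendsto (fun n : ℕ => |N| * (1 / 2 : ℝ) ^ n / 2 * Real.exp (l * t)) atTop (𝓝 0) := by
    have := ((tendsto_pow_atTop_nhds_zero_of_lt_one (by norm_num : (0 : ℝ) ≤ 1 / 2)
      (by norm_num)).const_mul |N|).div_const 2 |>.mul_const (Real.exp (l * t))
    simpa using this
  exact norm_le_zero_iff.1 (ge_of_tendsto' h4 h3)

/-- The solution is the Neumann series of iterates of `r`, summed separately at each `t`. The bound
on `r` is required everywhere on `[0, T]` so that the equation holds at each `t` and not just almost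
everywhere. -/
theorem exists_solution [CompleteSpace E] (hV : IsVolterraKernel T ρ V) {r : ℝ → E} {N : ℝ}
    (hr : AEStronglyMeasurable r (volume.restrict (Icc 0 T))) (hN : ∀ t ∈ Icc 0 T, ‖r t‖ ≤ N) :
    ∃ s : ℝ → E, MemLp s ∞ (volume.restrict (Icc 0 T)) ∧
      ∀ t ∈ Icc 0 T, s t = r t + volterra V s t := by
  obtain ⟨l, hl0, hl⟩ := exists_exp_weight_integral_le hV.integrable
  let w : ℕ → ℝ → E := fun n => (volterra V)^[n] r
  have hw0 : w 0 = r := rfl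
  have hws : ∀ n, w (n + 1) = volterra V (w n) := fun n => Function.iterate_succ_apply' _ _ _
  have hmeas : ∀ n, AEStronglyMeasurable (w n) (volume.restrict (Icc 0 T)) := by
    intro n
    induction n with
    | zero => exact hr
    | succ n ih => rw [hws]; exact hV.stronglyMeasurable_volterra ih
  have hb : ∀ n, ∀ t ∈ Icc 0 T, ‖w n t‖ ≤ |N| * (1 / 2) ^ n * Real.exp (l * t) := by
    intro n
    induction n with
    | zero =>
      intro t ht
      have : 1 ≤ Real.exp (l * t) := Real.one_le_exp (mul_nonneg hl0 ht.1)
      rw [pow_zero, mul_one]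
      exact ((hN t ht).trans (le_abs_self N)).trans (le_mul_of_one_le_right (abs_nonneg N) this)
    | succ n ih =>
      intro t ht
      rw [hws]
      refine (hV.norm_volterra_le (N := |N| * (1 / 2) ^ n) hl hl0 (by positivity) ?_ ht).trans_eq
        (by ring)
      filter_upwards [ae_restrict_mem measurableSet_Icc] with τ hτ using ih τ hτ
  have hb' : ∀ n, ∀ t ∈ Icc 0 T, ‖w n t‖ ≤ |N| * Real.exp (l * T) * (1 / 2) ^ n := by
    intro n t ht
    refine (hb n t ht).trans ?_
    have : Real.exp (l * t) ≤ Real.exp (l * T) :=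
      Real.exp_le_exp.2 (mul_le_mul_of_nonneg_left ht.2 hl0)
    calc |N| * (1 / 2) ^ n * Real.exp (l * t) ≤ |N| * (1 / 2) ^ n * Real.exp (l * T) := by gcongr
      _ = _ := by ring
  have hgeo : Summable fun n : ℕ => |N| * Real.exp (l * T) * (1 / 2 : ℝ) ^ n :=
    summable_geometric_two.mul_left _
  have hsum : ∀ t ∈ Icc 0 T, HasSum (fun n => w n t) (∑' n, w n t) := fun t ht =>
    (Summable.of_norm_bounded hgeo fun n => hb' n t ht).hasSum
  refine ⟨fun t => ∑' n, w n t, ?_, ?_⟩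
  · refine memLp_top_of_bound (C := ∑' n : ℕ, |N| * Real.exp (l * T) * (1 / 2 : ℝ) ^ n) ?_ ?_
    · refine aestronglyMeasurable_of_tendsto_ae atTop
        (f := fun n t => ∑ i ∈ Finset.range n, w i t) ?_ ?_
      · intro n
        exact Finset.aestronglyMeasurable_fun_sum _ fun i _ => hmeas i
      · filter_upwards [ae_restrict_mem measurableSet_Icc] with t ht
        exact (hsum t ht).tendsto_sum_nat
    · filter_upwards [ae_restrict_mem measurableSet_Icc] with t ht
      exact tsum_of_norm_bounded hgeo.hasSum fun n => hb' n t ht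
  · intro t ht
    -- The Volterra integral is taken term by term: `‖ρ(t - τ)‖` times a geometric series dominates.
    have h1 : HasSum (fun n => ∫ τ in (0 : ℝ)..t, V t τ (w n τ))
        (∫ τ in (0 : ℝ)..t, V t τ (∑' n, w n τ)) := by
      refine intervalIntegral.hasSum_integral_of_dominated_convergence
        (fun n τ => ‖ρ (t - τ)‖ * (|N| * Real.exp (l * T) * (1 / 2 : ℝ) ^ n)) ?_ ?_ ?_ ?_ ?_
      · intro n
        rw [uIoc_of_le ht.1]
        exact hV.aestronglyMeasurable (hmeas n) ht
      · intro n
        rw [uIoc_of_le ht.1, ← ae_restrict_iff' measurableSet_Ioc]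
        filter_upwards [ae_mem_Ioo t] with τ hτ
        exact (hV.norm_apply_le ht hτ _).trans (mul_le_mul_of_nonneg_left
          (hb' n τ ⟨hτ.1.le, hτ.2.le.trans ht.2⟩) (norm_nonneg _))
      · exact Eventually.of_forall fun τ _ => hgeo.mul_left _
      · simp_rw [tsum_mul_left]
        refine IntervalIntegrable.mul_const ?_ _
        rw [intervalIntegrable_iff_integrableOn_Ioc_of_le ht.1]
        exact (hV.integrableOn_rate ht).norm
      · rw [uIoc_of_le ht.1]
        refine Eventually.of_forall fun τ hτ => ?_
        exact (hsum τ ⟨hτ.1.le, hτ.2.trans ht.2⟩).mapL (V t τ)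
    have h2 : HasSum (fun n => w (n + 1) t) (volterra V (fun t => ∑' n, w n t) t) := by
      simp_rw [hws]; exact h1
    beta_reduce
    rw [← h2.tsum_eq, (hsum t ht).summable.tsum_eq_zero_add, hw0]

theorem volterra_sub (hV : IsVolterraKernel T ρ V) {w w' : ℝ → E}
    (hw : MemLp w ∞ (volume.restrict (Icc 0 T))) (hw' : MemLp w' ∞ (volume.restrict (Icc 0 T)))
    {t : ℝ} (ht : t ∈ Icc 0 T) :
    volterra V (fun τ => w τ - w' τ) t = volterra V w t - volterra V w' t := by
  simp only [volterra, map_sub]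
  exact intervalIntegral.integral_sub (hV.intervalIntegrable hw ht) (hV.intervalIntegrable hw' ht)

theorem eqOn_of_eq_add_volterra (hV : IsVolterraKernel T ρ V) {w w' r : ℝ → E}
    (hw : MemLp w ∞ (volume.restrict (Icc 0 T))) (hw' : MemLp w' ∞ (volume.restrict (Icc 0 T)))
    (h : ∀ t ∈ Icc 0 T, w t = r t + volterra V w t)
    (h' : ∀ t ∈ Icc 0 T, w' t = r t + volterra V w' t) : EqOn w w' (Icc 0 T) := by
  intro t ht
  obtain ⟨N, hN⟩ : ∃ N : ℝ, ∀ᵐ τ ∂(volume.restrict (Icc 0 T)), ‖w τ - w' τ‖ ≤ N :=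
    (hw.sub hw').exists_ae_norm_le
  refine sub_eq_zero.1 (hV.eq_zero_of_eq_volterra hN (fun t ht => ?_) ht)
  rw [hV.volterra_sub hw hw' ht, h t ht, h' t ht, add_sub_add_left_eq_sub]

end IsVolterraKernel

end Volterra

/-! ### The space W^{1,p}(0,∞) and weak derivatives -/

namespace HalfLine

open Filter Topology

variable {p : ℝ≥0∞} [Fact (1 ≤ p)]

/-- The functional `f ↦ ∫ f χ` on `L^p(0, ∞)` for a continuous compactly supported `χ`. -/
theorem exists_clm_integral_mul {χ : ℝ → ℝ} (hχ : Continuous χ) (hc : HasCompactSupport χ) :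
    ∃ L : Lp ℝ p μ →L[ℝ] ℝ, ∀ f : Lp ℝ p μ, L f = ∫ x in Ioi 0, f x * χ x := by
  have : ENNReal.HolderConjugate p p.conjExponent := .conjExponent Fact.out
  have : Fact (1 ≤ p.conjExponent) := ⟨ENNReal.HolderConjugate.one_le p.conjExponent p⟩
  have hm : MemLp χ p.conjExponent μ := hχ.memLp_of_hasCompactSupport hc
  refine ⟨((ContinuousLinearMap.mul ℝ ℝ).lpPairing μ p p.conjExponent).flip hm.toLp, fun f => ?_⟩
  rw [ContinuousLinearMap.flip_apply, ContinuousLinearMap.lpPairing_eq_integral]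
  refine integral_congr_ae ?_
  filter_upwards [hm.coeFn_toLp] with x hx
  rw [hx, ContinuousLinearMap.mul_apply']

/-- Each test function imposes a closed condition on `L^p × L^p`, since pairing with it is a
continuous functional. -/
instance : CompleteSpace (W1p p) := by
  refine IsClosed.completeSpace_coe (hs := ?_)
  have h : ((sobolevSubmodule p : Submodule ℝ _) : Set (WithLp p (Lp ℝ p μ × Lp ℝ p μ))) =
      ⋂ (φ : ℝ → ℝ) (_ : ContDiff ℝ ∞ φ) (_ : HasCompactSupport φ) (_ : tsupport φ ⊆ Ioi 0),
        {w | ∫ x in Ioi 0, w.fst x * deriv φ x = - ∫ x in Ioi 0, w.snd x * φ x} := by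
    ext w
    simp only [mem_iInter]
    rfl
  rw [h]
  refine isClosed_iInter fun φ => isClosed_iInter fun hφ => isClosed_iInter fun hc =>
    isClosed_iInter fun _ => ?_
  obtain ⟨L₁, h₁⟩ := exists_clm_integral_mul (p := p) (hφ.continuous_deriv (by simp)) hc.deriv
  obtain ⟨L₂, h₂⟩ := exists_clm_integral_mul (p := p) hφ.continuous hc
  simp_rw [← h₁, ← h₂]
  exact isClosed_eq (L₁.continuous.comp (WithLp.fstL p ℝ (Lp ℝ p μ) (Lp ℝ p μ)).continuous)
    (L₂.continuous.comp (WithLp.sndL p ℝ (Lp ℝ p μ) (Lp ℝ p μ)).continuous).neg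

theorem IsWeakDeriv.ae_eq_zero {f g : Lp ℝ p μ} (h : IsWeakDeriv f g) (hf : f = 0) : g = 0 := by
  have h1 : ∀ᵐ x ∂μ, x ∈ Ioi (0 : ℝ) → g x = 0 := by
    refine isOpen_Ioi.ae_eq_zero_of_integral_contDiff_smul_eq_zero
      (((Lp.memLp g).locallyIntegrable Fact.out).locallyIntegrableOn _) fun φ hφ hc hs => ?_
    have h2 := h φ hφ hc hs
    have h3 : ∫ x in Ioi 0, f x * deriv φ x = 0 := by
      refine integral_eq_zero_of_ae ?_
      filter_upwards [Lp.coeFn_zero ℝ p μ] with x hx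
      rw [hf, hx]; simp
    rw [h3, eq_comm, neg_eq_zero] at h2
    simpa only [smul_eq_mul, mul_comm] using h2
  refine Lp.ext ?_
  filter_upwards [h1, ae_restrict_mem measurableSet_Ioi, Lp.coeFn_zero ℝ p μ] with x h2 h3 h4
  rw [h2 h3, h4]; rfl

namespace W1p

/-- `toLp` as a continuous linear map. -/
def toLpL : W1p p →L[ℝ] Lp ℝ p μ :=
  (WithLp.fstL p ℝ (Lp ℝ p μ) (Lp ℝ p μ)).comp (sobolevSubmodule p).subtypeL

/-- `weakDeriv` as a continuous linear map. -/
def weakDerivL : W1p p →L[ℝ] Lp ℝ p μ :=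
  (WithLp.sndL p ℝ (Lp ℝ p μ) (Lp ℝ p μ)).comp (sobolevSubmodule p).subtypeL

@[simp] theorem toLpL_apply (w : W1p p) : toLpL w = w.toLp := rfl

theorem isWeakDeriv (w : W1p p) : IsWeakDeriv w.toLp w.weakDeriv := w.2

theorem norm_toLp_le (w : W1p p) : ‖w.toLp‖ ≤ ‖w‖ := WithLp.norm_fst_le (x := w.1) _

theorem norm_weakDeriv_le (w : W1p p) : ‖w.weakDeriv‖ ≤ ‖w‖ := WithLp.norm_snd_le (x := w.1) _

theorem norm_le_add (w : W1p p) : ‖w‖ ≤ ‖w.toLp‖ + ‖w.weakDeriv‖ := by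
  have h : w.1 = WithLp.toLp p (w.toLp, 0) + WithLp.toLp p (0, w.weakDeriv) := by
    rw [← WithLp.toLp_add, Prod.mk_add_mk, add_zero, zero_add]
    rfl
  calc ‖w‖ = ‖w.1‖ := rfl
    _ ≤ _ := by exact (congrArg norm h).trans_le (norm_add_le (WithLp.toLp p (w.toLp, 0)) (WithLp.toLp p (0, w.weakDeriv)))
    _ = _ := by rw [WithLp.norm_toLp_fst, WithLp.norm_toLp_snd]

/-- A function determines its weak derivative. Through this, a.e. equality of functions in the mild
formulation becomes equality in `W^{1,p}`. -/
theorem toLp_injective : Function.Injective (toLp : W1p p → Lp ℝ p μ) := by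
  intro w w' h
  have h1 : (w - w').toLp = 0 := by
    rw [← toLpL_apply, map_sub, toLpL_apply, toLpL_apply, h, sub_self]
  have h2 := IsWeakDeriv.ae_eq_zero (w - w').isWeakDeriv h1
  have h3 := norm_le_add (w - w')
  rw [h1, h2, norm_zero, add_zero] at h3
  exact sub_eq_zero.1 (norm_le_zero_iff.1 h3)

/-- The element of `W^{1,p}(0, ∞)` with given representatives of the function and its weak
derivative. -/
def mk {f g : ℝ → ℝ} (hf : MemLp f p μ) (hg : MemLp g p μ) (h : IsWeakDeriv f g) : W1p p :=
  ⟨WithLp.toLp p (hf.toLp f, hg.toLp g), by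
    intro φ hφ hc hs
    have h1 : ∫ x in Ioi 0, (hf.toLp f) x * deriv φ x = ∫ x in Ioi 0, f x * deriv φ x :=
      integral_congr_ae (by filter_upwards [hf.coeFn_toLp] with x hx; rw [hx])
    have h2 : ∫ x in Ioi 0, (hg.toLp g) x * φ x = ∫ x in Ioi 0, g x * φ x :=
      integral_congr_ae (by filter_upwards [hg.coeFn_toLp] with x hx; rw [hx])
    change ∫ x in Ioi 0, (hf.toLp f) x * deriv φ x = - ∫ x in Ioi 0, (hg.toLp g) x * φ x
    rw [h1, h2, h φ hφ hc hs]⟩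

theorem toLp_mk {f g : ℝ → ℝ} (hf : MemLp f p μ) (hg : MemLp g p μ) (h : IsWeakDeriv f g) :
    (mk hf hg h).toLp = hf.toLp f := rfl

theorem weakDeriv_mk {f g : ℝ → ℝ} (hf : MemLp f p μ) (hg : MemLp g p μ) (h : IsWeakDeriv f g) :
    (mk hf hg h).weakDeriv = hg.toLp g := rfl

end W1p

/-- The product `F φ` extends by zero to a differentiable, compactly supported function on the line,
whatever `F` does near `0`, and the integral of its derivative vanishes. -/
theorem isWeakDeriv_of_hasDerivAt {F F' : ℝ → ℝ} (h : ∀ x, 0 < x → HasDerivAt F (F' x) x)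
    (hF' : LocallyIntegrable F' μ) : IsWeakDeriv F F' := by
  intro φ hφ hc hs
  have hF : ContinuousOn F (Ioi 0) := fun x hx => (h x hx).continuousAt.continuousWithinAt
  have hd : Continuous (deriv φ) := hφ.continuous_deriv (by simp)
  have hsub : ∀ x, x ∉ Ioi (0 : ℝ) → φ x = 0 ∧ deriv φ x = 0 := fun x hx =>
    ⟨image_eq_zero_of_notMem_tsupport fun h => hx (hs h),
      image_eq_zero_of_notMem_tsupport fun h => hx (hs (tsupport_deriv_subset h))⟩
  have hcont : Continuous fun x => F x * deriv φ x := by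
    have hsupp : tsupport (fun x => F x * deriv φ x) ⊆ Ioi 0 :=
      (tsupport_mul_subset_right.trans (tsupport_deriv_subset)).trans hs
    refine continuous_iff_continuousAt.2 fun x => ?_
    by_cases hx : x ∈ tsupport (fun x => F x * deriv φ x)
    · exact (h x (hsupp hx)).continuousAt.mul hd.continuousAt
    · refine (continuousAt_const (y := (0 : ℝ))).congr ?_
      filter_upwards [(isClosed_tsupport _).isOpen_compl.mem_nhds hx] with y hy
      exact (image_eq_zero_of_notMem_tsupport hy).symm
  have hi1 : Integrable fun x => F x * deriv φ x :=
    hcont.integrable_of_hasCompactSupport hc.deriv.mul_left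
  have hi2 : Integrable (fun x => F' x * φ x) μ := by
    refine (hF'.integrable_smul_left_of_hasCompactSupport hφ.continuous hc).congr
      (Eventually.of_forall fun x => ?_)
    simp [mul_comm]
  have hi2' : Integrable fun x => F' x * φ x := by
    rw [← integrableOn_iff_integrable_of_support_subset (s := Ioi 0)]
    · exact hi2
    · intro x hx
      by_contra hn
      exact hx (by simp [(hsub x hn).1])
  have hder : ∀ x, HasDerivAt (fun x => F x * φ x) (F' x * φ x + F x * deriv φ x) x := by
    intro x
    by_cases hx : x ∈ tsupport φ
    · exact (h x (hs hx)).mul (hφ.differentiable (by simp) x).hasDerivAt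
    · have h1 : φ =ᶠ[𝓝 x] 0 := by
        filter_upwards [(isClosed_tsupport _).isOpen_compl.mem_nhds hx] with y hy
        exact image_eq_zero_of_notMem_tsupport hy
      have h2 : deriv φ x = 0 :=
        image_eq_zero_of_notMem_tsupport fun h => hx (tsupport_deriv_subset h)
      rw [h1.eq_of_nhds, h2]
      simp only [Pi.zero_apply, mul_zero, add_zero]
      refine (hasDerivAt_const x (0 : ℝ)).congr_of_eventuallyEq ?_
      filter_upwards [h1] with y hy
      simp [hy]
  have hi3 : Integrable fun x => F x * φ x := by
    have hcont : Continuous fun x => F x * φ x :=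
      continuous_iff_continuousAt.2 fun x => (hder x).continuousAt
    exact hcont.integrable_of_hasCompactSupport hc.mul_left
  have h0 := integral_eq_zero_of_hasDerivAt_of_integrable hder (hi2'.add hi1) hi3
  rw [integral_add hi2' hi1] at h0
  have e1 : ∫ x in Ioi 0, F x * deriv φ x = ∫ x, F x * deriv φ x :=
    setIntegral_eq_integral_of_forall_compl_eq_zero fun x hx => by simp [(hsub x hx).2]
  have e2 : ∫ x in Ioi 0, F' x * φ x = ∫ x, F' x * φ x :=
    setIntegral_eq_integral_of_forall_compl_eq_zero fun x hx => by simp [(hsub x hx).1]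
  rw [e1, e2]
  linarith

/-- A locally integrable function on the half-line whose weak derivative vanishes is constant. -/
theorem exists_ae_eq_const_of_isWeakDeriv_zero {f : ℝ → ℝ} (hf : LocallyIntegrable f μ)
    (h : ∀ φ : ℝ → ℝ, ContDiff ℝ ∞ φ → HasCompactSupport φ → tsupport φ ⊆ Ioi 0 →
      ∫ x in Ioi 0, f x * deriv φ x = 0) : ∃ c : ℝ, f =ᵐ[μ] fun _ => c := by
  -- Any fixed test function `χ` of integral one supported in `(0, ∞)` would do; this one lives on
  -- `[1, 3]`. The constant will be `∫ f χ`.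
  let B : ContDiffBump (2 : ℝ) := ⟨1 / 2, 1, by norm_num, by norm_num⟩
  let χ : ℝ → ℝ := B.normed volume
  have hχ : ContDiff ℝ ∞ χ := B.contDiff_normed
  have hχc : HasCompactSupport χ := B.hasCompactSupport_normed
  have hχs : tsupport χ ⊆ Ioi 0 := by
    rw [B.tsupport_normed_eq]
    intro x hx
    have := abs_le.1 (by simpa [Real.dist_eq] using hx : |x - 2| ≤ 1)
    simp only [mem_Ioi]; linarith
  have hχ1 : ∫ x, χ x = 1 := B.integral_normed
  have hint : ∀ φ : ℝ → ℝ, Continuous φ → HasCompactSupport φ →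
      Integrable (fun x => f x * φ x) μ := fun φ hφ hc => by
    refine (hf.integrable_smul_left_of_hasCompactSupport hφ hc).congr
      (Eventually.of_forall fun x => ?_)
    simp [mul_comm]
  refine ⟨∫ x in Ioi 0, f x * χ x, ?_⟩
  set c := ∫ x in Ioi 0, f x * χ x with hcdef
  have key : ∀ᵐ x ∂μ, x ∈ Ioi (0 : ℝ) → f x - c = 0 := by
    refine isOpen_Ioi.ae_eq_zero_of_integral_contDiff_smul_eq_zero
      ((hf.sub (locallyIntegrable_const c)).locallyIntegrableOn _) fun φ hφ hc hs => ?_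
    set m := ∫ x, φ x with hm
    -- Subtracting the mean makes `η` the derivative of a test function `θ`. Hence `∫ f η = 0`, that
    -- is, `∫ f φ = c ∫ φ`.
    let η : ℝ → ℝ := fun x => φ x - m * χ x
    have hη : ContDiff ℝ ∞ η := hφ.sub (contDiff_const.mul hχ)
    have hηc : HasCompactSupport η := hc.sub hχc.mul_left
    have hηs : tsupport η ⊆ Ioi 0 :=
      (tsupport_sub φ fun x => m * χ x).trans (union_subset hs (tsupport_mul_subset_right.trans hχs))
    have hη0 : ∫ x, η x = 0 := by
      rw [integral_sub (hφ.continuous.integrable_of_hasCompactSupport hc)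
        ((hχ.continuous.integrable_of_hasCompactSupport hχc).const_mul m), integral_const_mul, hχ1]
      ring
    obtain ⟨ε, R, hε, hεR⟩ : ∃ ε R : ℝ, 0 < ε ∧ tsupport η ⊆ Icc ε R := by
      rcases (tsupport η).eq_empty_or_nonempty with he | hne
      · exact ⟨1, 1, one_pos, by simp [he]⟩
      · obtain ⟨ε, h1, h2⟩ := hηc.isCompact.exists_isLeast hne
        obtain ⟨R, h3, h4⟩ := hηc.isCompact.exists_isGreatest hne
        exact ⟨ε, R, hηs h1, fun x hx => ⟨h2 hx, h4 hx⟩⟩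
    have hηz : ∀ x, x ∉ Icc ε R → η x = 0 := fun x hx =>
      image_eq_zero_of_notMem_tsupport fun h => hx (hεR h)
    let θ : ℝ → ℝ := fun x => ∫ y in (0 : ℝ)..x, η y
    have hθd : ∀ x, HasDerivAt θ (η x) x := fun x =>
      intervalIntegral.integral_hasDerivAt_right (hη.continuous.intervalIntegrable _ _)
        (hη.continuous.stronglyMeasurableAtFilter _ _) hη.continuous.continuousAt
    have hθ' : deriv θ = η := funext fun x => (hθd x).deriv
    have hθ : ContDiff ℝ ∞ θ :=
      contDiff_infty_iff_deriv.2 ⟨fun x => (hθd x).differentiableAt, by rwa [hθ']⟩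
    have hθz : Function.support θ ⊆ Icc ε R := by
      intro x hx
      by_contra hn
      refine hx ?_
      rw [mem_Icc, not_and_or, not_le, not_le] at hn
      rcases hn with hn | hn
      · refine intervalIntegral.integral_zero_ae (Eventually.of_forall fun y hy => hηz y fun h => ?_)
        have := (uIoc_subset_uIcc hy)
        rw [mem_uIcc] at this
        rcases this with h1 | h1
        · linarith [h.1, h1.2]
        · linarith [h.1, h1.2]
      · by_cases hx0 : x ≤ 0
        · refine intervalIntegral.integral_zero_ae
            (Eventually.of_forall fun y hy => hηz y fun h => ?_)
          rw [uIoc_of_ge hx0] at hy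
          linarith [h.1, hy.2]
        · have h1 : θ x = ∫ y, η y := by
            simp only [θ]
            rw [intervalIntegral.integral_of_le (not_le.1 hx0).le]
            refine setIntegral_eq_integral_of_forall_compl_eq_zero fun y hy => hηz y fun h => hy ?_
            exact ⟨hε.trans_le h.1, h.2.trans hn.le⟩
          rw [h1, hη0]
    have hθts : tsupport θ ⊆ Icc ε R := closure_minimal hθz isClosed_Icc
    have h1 := h θ hθ (isCompact_Icc.of_isClosed_subset (isClosed_tsupport _) hθts)
      (hθts.trans fun x hx => hε.trans_le hx.1)
    rw [hθ'] at h1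
    have h2 : ∫ x in Ioi 0, f x * η x =
        (∫ x in Ioi 0, f x * φ x) - m * ∫ x in Ioi 0, f x * χ x := by
      rw [← integral_const_mul, ← integral_sub (hint φ hφ.continuous hc)
        ((hint χ hχ.continuous hχc).const_mul m)]
      refine integral_congr_ae (Eventually.of_forall fun x => ?_)
      simp only [η]; ring
    have h3 : ∫ x in Ioi 0, φ x = m := setIntegral_eq_integral_of_forall_compl_eq_zero fun x hx =>
      image_eq_zero_of_notMem_tsupport fun h => hx (hs h)
    have h4 : ∫ x in Ioi 0, φ x • (f x - c) =
        (∫ x in Ioi 0, f x * φ x) - c * ∫ x in Ioi 0, φ x := by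
      rw [← integral_const_mul, ← integral_sub (hint φ hφ.continuous hc)
        ((hφ.continuous.integrable_of_hasCompactSupport hc).integrableOn.const_mul c)]
      refine integral_congr_ae (Eventually.of_forall fun x => ?_)
      simp only [smul_eq_mul]; ring
    rw [h4, h3]
    rw [h1] at h2
    linarith
  filter_upwards [key, ae_restrict_mem measurableSet_Ioi] with x h1 h2
  linarith [h1 h2]

end HalfLine

/-! ### Continuous representatives and point evaluation -/

namespace HalfLine

open Filter Topology

variable {p : ℝ≥0∞} [Fact (1 ≤ p)]

/-- Where `|g| ≤ 1` the exponential dominates; elsewhere `|g| ≤ |g|^q`. -/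
theorem integrable_exp_mul_of_memLp {q : ℝ≥0∞} (hq : 1 ≤ q) (hq' : q ≠ ⊤) {g : ℝ → ℝ}
    (hg : MemLp g q μ) {c : ℝ} (hc : 0 < c) : Integrable (fun z => Real.exp (-c * z) * g z) μ := by
  have hexp : Integrable (fun z : ℝ => Real.exp (-c * z)) μ := exp_neg_integrableOn_Ioi 0 hc
  refine (hexp.add (hg.integrable_norm_rpow (by positivity) hq')).mono'
    (hexp.aestronglyMeasurable.mul hg.aestronglyMeasurable) ?_
  filter_upwards [ae_restrict_mem measurableSet_Ioi] with z hz
  have h1 : Real.exp (-c * z) ≤ 1 := Real.exp_le_one_iff.2 (by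
    have := mul_pos hc hz; linarith)
  have hq1 : 1 ≤ q.toReal := by
    rw [← ENNReal.toReal_one]; exact ENNReal.toReal_mono hq' hq
  rw [norm_mul, Real.norm_eq_abs (Real.exp _), Real.abs_exp, Pi.add_apply]
  rcases le_total ‖g z‖ 1 with h | h
  · exact (mul_le_of_le_one_right (Real.exp_pos _).le h).trans
      (le_add_of_nonneg_right (by positivity))
  · refine (mul_le_of_le_one_left (norm_nonneg _) h1).trans ?_
    exact (Real.self_le_rpow_of_one_le h hq1).trans (le_add_of_nonneg_left (Real.exp_pos _).le)

theorem integrableOn_of_memLp {q : ℝ≥0∞} (hq : 1 ≤ q) {g : ℝ → ℝ} (hg : MemLp g q μ)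
    (a b : ℝ) : IntegrableOn g (Ioc a b) μ := by
  have : IsFiniteMeasure (μ.restrict (Ioc a b)) := by
    rw [Measure.restrict_restrict measurableSet_Ioc]
    exact ⟨by
      rw [Measure.restrict_apply_univ]
      exact (measure_mono inter_subset_left).trans_lt measure_Ioc_lt_top⟩
  exact (hg.restrict (Ioc a b)).integrable hq

/-- The primitive `∫_0^x g` of a function on the half-line. -/
def primitive (g : ℝ → ℝ) (x : ℝ) : ℝ := ∫ z in (0 : ℝ)..x, (Ioi 0).indicator g z

theorem intervalIntegrable_indicator {q : ℝ≥0∞} (hq : 1 ≤ q) {g : ℝ → ℝ} (hg : MemLp g q μ)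
    (a b : ℝ) : IntervalIntegrable ((Ioi 0).indicator g) volume a b := by
  have h : ∀ a b, IntegrableOn ((Ioi 0).indicator g) (Ioc a b) := fun a b => by
    have := integrableOn_of_memLp hq hg a b
    rw [IntegrableOn, Measure.restrict_restrict measurableSet_Ioc] at this
    rw [IntegrableOn, integrable_indicator_iff measurableSet_Ioi, IntegrableOn,
      Measure.restrict_restrict measurableSet_Ioi, inter_comm]
    exact this
  exact ⟨h a b, h b a⟩

theorem continuous_primitive {q : ℝ≥0∞} (hq : 1 ≤ q) {g : ℝ → ℝ} (hg : MemLp g q μ) :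
    Continuous (primitive g) :=
  intervalIntegral.continuous_primitive (intervalIntegrable_indicator hq hg) 0

theorem primitive_zero (g : ℝ → ℝ) : primitive g 0 = 0 := intervalIntegral.integral_same

theorem primitive_eq_setIntegral (g : ℝ → ℝ) {x : ℝ} (hx : 0 ≤ x) :
    primitive g x = ∫ z in Ioi 0, if z ≤ x then g z else 0 := by
  have h : (fun z => if z ≤ x then g z else 0) = (Iic x).indicator g := by
    ext z; simp [indicator_apply]
  rw [primitive, intervalIntegral.integral_of_le hx, setIntegral_indicator measurableSet_Ioi, h,
    setIntegral_indicator measurableSet_Iic]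
  congr 2
  ext z
  constructor
  · rintro ⟨h1, h2⟩; exact ⟨h2, h1.2⟩
  · rintro ⟨h1, h2⟩; exact ⟨⟨h1, h2⟩, h1⟩

/-- Integration by parts of a primitive of an `L^q` function against an exponentially decaying
function. -/
theorem integral_primitive_mul {q : ℝ≥0∞} (hq : 1 ≤ q) (hq' : q ≠ ⊤) {g : ℝ → ℝ}
    (hg : MemLp g q μ) {θ θ' : ℝ → ℝ} (hθ : ∀ y, HasDerivAt θ (θ' y) y)
    (hθc : Continuous θ') {M c : ℝ} (hc : 0 < c)
    (hM : ∀ y, 0 < y → |θ' y| ≤ M * Real.exp (-c * y)) (hlim : Tendsto θ atTop (𝓝 0)) :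
    ∫ y in Ioi 0, primitive g y * θ' y = - ∫ z in Ioi 0, g z * θ z := by
  have hexp : Integrable (fun z : ℝ => Real.exp (-(c / 2) * z)) μ :=
    exp_neg_integrableOn_Ioi 0 (half_pos hc)
  have hg2 := integrable_exp_mul_of_memLp hq hq' hg (half_pos hc)
  have hmeas : AEStronglyMeasurable
      (fun w : ℝ × ℝ => if w.2 ≤ w.1 then g w.2 * θ' w.1 else 0) (μ.prod μ) := by
    have h1 : AEStronglyMeasurable (fun w : ℝ × ℝ => g w.2 * θ' w.1) (μ.prod μ) :=
      hg.1.comp_snd.mul (hθc.comp continuous_fst).aestronglyMeasurable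
    refine (h1.indicator (measurableSet_le measurable_snd measurable_fst)).congr
      (Eventually.of_forall fun w => ?_)
    simp [indicator_apply]
  -- Fubini on the region `z ≤ y`. There `e^{-cy} ≤ e^{-cy/2} e^{-cz/2}`, so half of the decay is
  -- spent on making `g` integrable.
  have hint : Integrable (Function.uncurry fun y z : ℝ => if z ≤ y then g z * θ' y else 0)
      (μ.prod μ) := by
    refine ((hexp.mul_prod hg2.norm).const_mul M).mono' hmeas ?_
    rw [Measure.prod_restrict]
    filter_upwards [ae_restrict_mem (measurableSet_Ioi.prod measurableSet_Ioi)] with w hw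
    obtain ⟨h1, h2⟩ : 0 < w.1 ∧ 0 < w.2 := hw
    have hM0 : 0 ≤ M := by
      have := (abs_nonneg _).trans (hM w.1 h1)
      exact nonneg_of_mul_nonneg_left this (Real.exp_pos _)
    rw [norm_mul (Real.exp _), Real.norm_eq_abs (Real.exp _), Real.abs_exp]
    simp only [Function.uncurry]
    split_ifs with h
    · rw [norm_mul, Real.norm_eq_abs (θ' _)]
      calc ‖g w.2‖ * |θ' w.1| ≤ ‖g w.2‖ * (M * Real.exp (-c * w.1)) := by
            gcongr; exact hM _ h1
        _ ≤ ‖g w.2‖ * (M * (Real.exp (-(c / 2) * w.1) * Real.exp (-(c / 2) * w.2))) := by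
            gcongr
            rw [← Real.exp_add]
            refine Real.exp_le_exp.2 ?_
            nlinarith
        _ = _ := by ring
    · rw [norm_zero]; positivity
  have hinner : ∀ z, 0 < z → ∫ y in Ioi 0, (if z ≤ y then g z * θ' y else 0) = -(g z * θ z) := by
    intro z hz
    have h1 : (fun y => if z ≤ y then g z * θ' y else 0) =
        (Ici z).indicator fun y => g z * θ' y := by ext y; simp [indicator_apply]
    rw [h1, setIntegral_indicator measurableSet_Ici,
      inter_eq_right.2 (Ici_subset_Ioi.2 hz),
      integral_Ici_eq_integral_Ioi, integral_const_mul,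
      integral_Ioi_of_hasDerivAt_of_tendsto (hθ z).continuousAt.continuousWithinAt
        (fun y _ => hθ y) ?_ hlim]
    · ring
    · refine ((exp_neg_integrableOn_Ioi z hc).const_mul M).mono'
        hθc.aestronglyMeasurable ?_
      filter_upwards [ae_restrict_mem measurableSet_Ioi] with y hy
      exact hM y (hz.trans hy)
  calc ∫ y in Ioi 0, primitive g y * θ' y
      = ∫ y in Ioi 0, ∫ z in Ioi 0, (if z ≤ y then g z * θ' y else 0) := by
        refine setIntegral_congr_fun measurableSet_Ioi fun y hy => ?_
        rw [primitive_eq_setIntegral g (le_of_lt hy), ← integral_mul_const]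
        simp only [ite_mul, zero_mul]
    _ = ∫ z in Ioi 0, ∫ y in Ioi 0, (if z ≤ y then g z * θ' y else 0) :=
        integral_integral_swap hint
    _ = ∫ z in Ioi 0, -(g z * θ z) := setIntegral_congr_fun measurableSet_Ioi fun z hz => hinner z hz
    _ = _ := integral_neg _

/-- The difference between `w` and the primitive of its weak derivative has zero weak derivative,
hence is constant. -/
theorem W1p.exists_ae_eq_const_add_primitive (hp : p ≠ ⊤) (w : W1p p) :
    ∃ c : ℝ, w.toLp =ᵐ[μ] fun x => c + primitive w.weakDeriv x := by
  have h1p : 1 ≤ p := Fact.out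
  have hS : Continuous (primitive w.weakDeriv) := continuous_primitive h1p (Lp.memLp _)
  have hloc := (Lp.memLp w.toLp).locallyIntegrable h1p
  obtain ⟨c, hc⟩ := exists_ae_eq_const_of_isWeakDeriv_zero
    (f := fun x => w.toLp x - primitive w.weakDeriv x) (hloc.sub hS.locallyIntegrable) (by
      intro φ hφ hc hs
      have hd : Continuous (deriv φ) := hφ.continuous_deriv (by simp)
      have hi1 := integrable_Lp_mul w.toLp hd hc.deriv
      have hi2 : Integrable (fun x => primitive w.weakDeriv x * deriv φ x) μ :=
        ((hS.mul hd).integrable_of_hasCompactSupport hc.deriv.mul_left).integrableOn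
      -- Compact support gives exponential decay at rate `1`, so the integration by parts for
      -- exponentially decaying functions applies to test functions.
      obtain ⟨M, hM⟩ : ∃ M, ∀ y, ‖Real.exp (1 * y) * deriv φ y‖ ≤ M :=
        ((by fun_prop : Continuous fun y : ℝ => Real.exp (1 * y)).mul hd).bounded_above_of_compact_support
          hc.deriv.mul_left
      have h2 := integral_primitive_mul h1p hp (Lp.memLp w.weakDeriv)
        (fun y => (hφ.differentiable (by simp) y).hasDerivAt) hd one_pos (M := M) (fun y _ => by
          have := hM y
          rw [norm_mul, Real.norm_eq_abs, Real.abs_exp, Real.norm_eq_abs] at this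
          rw [neg_mul, Real.exp_neg, ← div_eq_mul_inv, le_div_iff₀ (Real.exp_pos _), mul_comm]
          exact this)
        (hc.is_zero_at_infty.mono_left atTop_le_cocompact)
      have h3 := w.isWeakDeriv φ hφ hc hs
      simp_rw [sub_mul]
      rw [integral_sub hi1 hi2, h2, h3, sub_self])
  refine ⟨c, ?_⟩
  filter_upwards [hc] with x hx
  linarith

namespace W1p

theorem integral_Ioc_abs_le (f : Lp ℝ p μ) {x : ℝ} (hx : 0 < x) :
    ∫ z in Ioc x (x + 1), |f z| ≤ ‖f‖ := by
  have h1p : 1 ≤ p := Fact.out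
  have hr : μ.restrict (Ioc x (x + 1)) = volume.restrict (Ioc x (x + 1)) := by
    have hsub : Ioc x (x + 1) ⊆ Ioi 0 := fun z hz => hx.trans hz.1
    rw [Measure.restrict_restrict measurableSet_Ioc, inter_eq_left.2 hsub]
  have : IsProbabilityMeasure (volume.restrict (Ioc x (x + 1))) := ⟨by simp⟩
  have hm : MemLp f p (volume.restrict (Ioc x (x + 1))) := by
    rw [← hr]; exact (Lp.memLp f).restrict _
  have h2 : eLpNorm f 1 (volume.restrict (Ioc x (x + 1))) ≤ eLpNorm f p μ :=
    (eLpNorm_le_eLpNorm_of_exponent_le h1p hm.1).trans (by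
      rw [← hr]; exact eLpNorm_restrict_le _ _ _ _)
  calc ∫ z in Ioc x (x + 1), |f z| = (eLpNorm f 1 (volume.restrict (Ioc x (x + 1)))).toReal := by
        rw [eLpNorm_one_eq_lintegral_enorm, ← integral_norm_eq_lintegral_enorm hm.1]; rfl
    _ ≤ ‖f‖ := ENNReal.toReal_mono (Lp.memLp f).2.ne h2

variable [Fact (p ≠ ⊤)]

/-- The continuous representative of an element of `W^{1,p}(0, ∞)`. -/
def val (w : W1p p) (x : ℝ) : ℝ :=
  (w.exists_ae_eq_const_add_primitive Fact.out).choose + primitive w.weakDeriv x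

theorem toLp_ae_eq_val (w : W1p p) : w.toLp =ᵐ[μ] w.val :=
  (w.exists_ae_eq_const_add_primitive Fact.out).choose_spec

theorem continuous_val (w : W1p p) : Continuous w.val :=
  continuous_const.add (continuous_primitive Fact.out (Lp.memLp _))

theorem val_eq_of_ae_eq {w : W1p p} {F : ℝ → ℝ} (hF : ContinuousOn F (Ioi 0))
    (h : w.toLp =ᵐ[μ] F) {x : ℝ} (hx : 0 < x) : w.val x = F x :=
  Measure.eqOn_open_of_ae_eq (w.toLp_ae_eq_val.symm.trans h) isOpen_Ioi
    w.continuous_val.continuousOn hF hx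

theorem val_sub (w : W1p p) (x y : ℝ) :
    w.val x - w.val y = ∫ z in y..x, (Ioi 0).indicator w.weakDeriv z := by
  simp only [val, primitive, add_sub_add_left_eq_sub]
  exact intervalIntegral.integral_interval_sub_left
    (intervalIntegrable_indicator Fact.out (Lp.memLp _) _ _)
    (intervalIntegrable_indicator Fact.out (Lp.memLp _) _ _)

/-- Two continuous representatives agree on `[0, ∞)`, including at `0`, so the constant of
integration is the boundary value. -/
theorem ae_eq_primitive_of_hasBoundaryValue_zero {w : W1p p} (h : w.HasBoundaryValue 0) :
    w.toLp =ᵐ[μ] primitive w.weakDeriv := by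
  obtain ⟨g, hg, hgw, hg0⟩ := h
  have h1 : EqOn w.val g (Ici 0) := by
    have h2 : w.val =ᵐ[volume.restrict (Ici 0)] g := by
      rw [← Measure.restrict_congr_set Ioi_ae_eq_Ici]
      exact w.toLp_ae_eq_val.symm.trans hgw.symm
    exact Measure.eqOn_of_ae_eq h2 w.continuous_val.continuousOn hg (by
      rw [interior_Ici, closure_Ioi])
  have h3 : w.val 0 = 0 := (h1 (mem_Ici.2 le_rfl)).trans hg0
  have h4 : w.val = primitive w.weakDeriv := by
    ext x
    simp only [val, primitive_zero, add_zero] at h3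
    simp only [val, h3, zero_add]
  rw [← h4]
  exact w.toLp_ae_eq_val

/-- Average `|w(x)| ≤ |w(y)| + ∫ |w'|` over `y` in `(x, x+1)`. On an interval of length one the `L¹`
norm is at most the `L^p` norm. -/
theorem abs_val_le (w : W1p p) {x : ℝ} (hx : 0 < x) : |w.val x| ≤ 2 * ‖w‖ := by
  have h1p : 1 ≤ p := Fact.out
  have hsub : Ioc x (x + 1) ⊆ Ioi 0 := fun z hz => hx.trans hz.1
  have hi : IntegrableOn (fun z => |w.weakDeriv z|) (Ioc x (x + 1)) := by
    have h := (integrableOn_of_memLp h1p (Lp.memLp w.weakDeriv) x (x + 1)).norm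
    rwa [Measure.restrict_restrict measurableSet_Ioc, inter_eq_left.2 hsub] at h
  have hpt : ∀ y ∈ Ioc x (x + 1), |w.val x| ≤ |w.val y| + ‖w‖ := by
    intro y hy
    have h1 : |w.val y - w.val x| ≤ ‖w.weakDeriv‖ := by
      rw [w.val_sub, intervalIntegral.integral_of_le hy.1.le]
      refine (norm_integral_le_integral_norm (μ := volume.restrict (Ioc x y))
        ((Ioi 0).indicator w.weakDeriv)).trans (le_trans ?_ (integral_Ioc_abs_le w.weakDeriv hx))
      refine le_trans (le_of_eq (setIntegral_congr_fun (g := fun z => |w.weakDeriv z|)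
        measurableSet_Ioc fun z hz => ?_)) (setIntegral_mono_set hi
          (Eventually.of_forall fun z => abs_nonneg _) (Ioc_subset_Ioc_right hy.2).eventuallyLE)
      beta_reduce
      rw [indicator_of_mem (show z ∈ Ioi (0 : ℝ) from hx.trans hz.1)]
      rfl
    have h2 := norm_weakDeriv_le w
    have h3 := abs_sub_abs_le_abs_sub (w.val x) (w.val y)
    rw [abs_sub_comm] at h3
    linarith
  have hvi : IntegrableOn (fun y => |w.val y|) (Ioc x (x + 1)) :=
    (w.continuous_val.abs.integrableOn_Icc).mono_set Ioc_subset_Icc_self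
  have hfin : ∫ _ in Ioc x (x + 1), |w.val x| = |w.val x| := by simp
  have hfin2 : ∫ _ in Ioc x (x + 1), ‖w‖ = ‖w‖ := by simp
  have hv : ∫ y in Ioc x (x + 1), |w.val y| ≤ ‖w‖ := by
    refine le_trans (le_of_eq ?_) ((integral_Ioc_abs_le w.toLp hx).trans (norm_toLp_le w))
    refine integral_congr_ae ?_
    filter_upwards [ae_restrict_of_ae_restrict_of_subset hsub w.toLp_ae_eq_val] with z hz
    rw [hz]
  calc |w.val x| = ∫ _ in Ioc x (x + 1), |w.val x| := hfin.symm
    _ ≤ ∫ y in Ioc x (x + 1), (|w.val y| + ‖w‖) := by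
        refine setIntegral_mono_on ?_ ?_ measurableSet_Ioc hpt
        · exact integrableOn_const (by simp)
        · exact hvi.add (integrableOn_const (by simp))
    _ = (∫ y in Ioc x (x + 1), |w.val y|) + ‖w‖ := by
        rw [integral_add hvi (integrableOn_const (by simp)), hfin2]
    _ ≤ 2 * ‖w‖ := by linarith

/-- Evaluation of the continuous representative at a point `x > 0`. -/
def evalL (x : ℝ) (hx : 0 < x) : W1p p →L[ℝ] ℝ :=
  LinearMap.mkContinuous
    { toFun := fun w => w.val x
      map_add' := fun w w' => by
        refine val_eq_of_ae_eq (F := fun x => w.val x + w'.val x)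
          (w.continuous_val.add w'.continuous_val).continuousOn ?_ hx
        have h : (w + w').toLp = w.toLp + w'.toLp := map_add toLpL w w'
        rw [h]
        filter_upwards [Lp.coeFn_add w.toLp w'.toLp, w.toLp_ae_eq_val, w'.toLp_ae_eq_val]
          with y h1 h2 h3
        rw [h1, Pi.add_apply, h2, h3]
      map_smul' := fun c w => by
        refine val_eq_of_ae_eq (F := fun x => c * w.val x)
          (continuous_const.mul w.continuous_val).continuousOn ?_ hx
        have h : (c • w).toLp = c • w.toLp := map_smul toLpL c w
        rw [h]
        filter_upwards [Lp.coeFn_smul c w.toLp, w.toLp_ae_eq_val] with y h1 h2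
        rw [h1, Pi.smul_apply, h2, smul_eq_mul] }
    2 fun w => w.abs_val_le hx

@[simp] theorem evalL_apply {x : ℝ} (hx : 0 < x) (w : W1p p) : evalL x hx w = w.val x := rfl

theorem toLp_ae_eq_of_val_eq {w : W1p p} {F : ℝ → ℝ} (h : ∀ x, 0 < x → w.val x = F x) :
    w.toLp =ᵐ[μ] F := by
  filter_upwards [w.toLp_ae_eq_val, ae_restrict_mem measurableSet_Ioi] with x h1 h2
  rw [h1, h x h2]

end W1p

end HalfLine

/-! ### Schur's test -/

section Schur

/-- Schur's test: a nonnegative kernel with row and column integrals at most `A` acts on `L^r` with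
norm at most `A`. -/
theorem lintegral_rpow_lintegral_mul_le {α : Type*} [MeasurableSpace α] {ν : Measure α} [SFinite ν]
    {k : α → α → ℝ≥0∞} (hk : Measurable (Function.uncurry k)) {f : α → ℝ≥0∞}
    (hf : AEMeasurable f ν) {A : ℝ≥0∞} (h₁ : ∀ x, ∫⁻ y, k x y ∂ν ≤ A)
    (h₂ : ∀ y, ∫⁻ x, k x y ∂ν ≤ A) {r : ℝ} (hr : 1 ≤ r) :
    ∫⁻ x, (∫⁻ y, k x y * f y ∂ν) ^ r ∂ν ≤ A ^ r * ∫⁻ y, f y ^ r ∂ν := by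
  have hr0 : 0 < r := one_pos.trans_le hr
  -- Hölder applied to `k = k^{(r-1)/r} k^{1/r}`; the case `r = 1` is separate because the conjugate
  -- exponent degenerates. Row integrals are used here, column integrals after Tonelli.
  have hpt : ∀ x, (∫⁻ y, k x y * f y ∂ν) ^ r ≤ A ^ (r - 1) * ∫⁻ y, k x y * f y ^ r ∂ν := by
    intro x
    have hkx : Measurable (k x) := hk.comp measurable_prodMk_left
    rcases hr.eq_or_lt with rfl | hr1
    · simp
    have hconj : (r / (r - 1)).HolderConjugate r := (Real.HolderConjugate.conjExponent hr1).symm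
    have e : ∀ y, k x y * f y = ((fun y => k x y ^ ((r - 1) / r)) *
        fun y => k x y ^ (1 / r) * f y) y := by
      intro y
      rw [Pi.mul_apply, ← mul_assoc, ← ENNReal.rpow_add_of_nonneg _ _
        (div_nonneg (by linarith) hr0.le) (by positivity), ← add_div, sub_add_cancel,
        div_self hr0.ne', ENNReal.rpow_one]
    have h := ENNReal.lintegral_mul_le_Lp_mul_Lq ν hconj
      (f := fun y => k x y ^ ((r - 1) / r)) (g := fun y => k x y ^ (1 / r) * f y)
      (hkx.pow_const _).aemeasurable ((hkx.pow_const _).aemeasurable.mul hf)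
    have e1 : ∀ y, (k x y ^ ((r - 1) / r)) ^ (r / (r - 1)) = k x y := by
      intro y
      rw [← ENNReal.rpow_mul, div_mul_div_cancel₀ hr0.ne', div_self (by linarith), ENNReal.rpow_one]
    have e2 : ∀ y, (k x y ^ (1 / r) * f y) ^ r = k x y * f y ^ r := by
      intro y
      rw [ENNReal.mul_rpow_of_nonneg _ _ hr0.le, ← ENNReal.rpow_mul, one_div_mul_cancel hr0.ne',
        ENNReal.rpow_one]
    simp only [e1, e2] at h
    calc (∫⁻ y, k x y * f y ∂ν) ^ r
        ≤ ((∫⁻ y, k x y ∂ν) ^ (1 / (r / (r - 1))) * (∫⁻ y, k x y * f y ^ r ∂ν) ^ (1 / r)) ^ r := by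
          refine ENNReal.rpow_le_rpow ?_ hr0.le
          rw [lintegral_congr e]; exact h
      _ = (∫⁻ y, k x y ∂ν) ^ (r - 1) * ∫⁻ y, k x y * f y ^ r ∂ν := by
          rw [ENNReal.mul_rpow_of_nonneg _ _ hr0.le, ← ENNReal.rpow_mul, ← ENNReal.rpow_mul,
            one_div_mul_cancel hr0.ne', ENNReal.rpow_one, one_div_div, div_mul_cancel₀ _ hr0.ne']
      _ ≤ _ := by gcongr; exact h₁ x
  have hfr : AEMeasurable (fun y => f y ^ r) ν := hf.pow_const r
  calc ∫⁻ x, (∫⁻ y, k x y * f y ∂ν) ^ r ∂ν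
      ≤ ∫⁻ x, A ^ (r - 1) * ∫⁻ y, k x y * f y ^ r ∂ν ∂ν := lintegral_mono hpt
    _ ≤ A ^ (r - 1) * ∫⁻ x, ∫⁻ y, k x y * f y ^ r ∂ν ∂ν := by
        rw [lintegral_const_mul'']
        exact (hk.aemeasurable.mul hfr.comp_snd).lintegral_prod_right'
    _ = A ^ (r - 1) * ∫⁻ y, (∫⁻ x, k x y ∂ν) * f y ^ r ∂ν := by
        rw [lintegral_lintegral_swap (hk.aemeasurable.mul hfr.comp_snd)]
        congr 1
        refine lintegral_congr fun y => ?_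
        exact lintegral_mul_const _ (hk.comp measurable_prodMk_right)
    _ ≤ A ^ (r - 1) * ∫⁻ y, A * f y ^ r ∂ν := by gcongr with y; exact h₂ y
    _ = A ^ r * ∫⁻ y, f y ^ r ∂ν := by
        rw [lintegral_const_mul'' _ hfr, ← mul_assoc]
        congr 1
        nth_rewrite 2 [← ENNReal.rpow_one A]
        rw [← ENNReal.rpow_add_of_nonneg _ _ (by linarith) zero_le_one, sub_add_cancel]

end Schur

/-! ### Exponential kernels acting on L^p and on products L² · L^p -/

namespace HalfLine

open Filter Topology

theorem lintegral_exp_neg_abs_le {c : ℝ} (hc : 0 < c) (x : ℝ) :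
    ∫⁻ y in Ioi 0, ENNReal.ofReal (Real.exp (-c * |x - y|)) ≤ ENNReal.ofReal (2 / c) := by
  have h1 : ∫⁻ y in Iic x, ENNReal.ofReal (Real.exp (-c * |x - y|)) = ENNReal.ofReal (1 / c) := by
    have e : ∀ y ∈ Iic x, ENNReal.ofReal (Real.exp (-c * |x - y|)) =
        ENNReal.ofReal (Real.exp (-c * x) * Real.exp (c * y)) := fun y hy => by
      rw [abs_of_nonneg (sub_nonneg.2 hy), ← Real.exp_add]; ring_nf
    rw [setLIntegral_congr_fun measurableSet_Iic e, ← ofReal_integral_eq_lintegral_ofReal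
      ((integrableOn_exp_mul_Iic hc x).const_mul _) (Eventually.of_forall fun y => by positivity),
      integral_const_mul, integral_exp_mul_Iic hc, ← mul_div_assoc, ← Real.exp_add]
    simp
  have h2 : ∫⁻ y in Ioi x, ENNReal.ofReal (Real.exp (-c * |x - y|)) = ENNReal.ofReal (1 / c) := by
    have e : ∀ y ∈ Ioi x, ENNReal.ofReal (Real.exp (-c * |x - y|)) =
        ENNReal.ofReal (Real.exp (c * x) * Real.exp (-c * y)) := fun y hy => by
      rw [abs_of_nonpos (sub_nonpos.2 (le_of_lt hy)), ← Real.exp_add]; ring_nf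
    rw [setLIntegral_congr_fun measurableSet_Ioi e, ← ofReal_integral_eq_lintegral_ofReal
      ((integrableOn_exp_mul_Ioi (neg_neg_of_pos hc) x).const_mul _)
      (Eventually.of_forall fun y => by positivity),
      integral_const_mul, integral_exp_mul_Ioi (neg_neg_of_pos hc), neg_div_neg_eq,
      ← mul_div_assoc, ← Real.exp_add]
    simp
  calc ∫⁻ y in Ioi 0, ENNReal.ofReal (Real.exp (-c * |x - y|))
      ≤ ∫⁻ y, ENNReal.ofReal (Real.exp (-c * |x - y|)) := setLIntegral_le_lintegral _ _
    _ = ENNReal.ofReal (1 / c) + ENNReal.ofReal (1 / c) := by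
        rw [← lintegral_add_compl _ measurableSet_Iic, compl_Iic, h1, h2]
    _ = ENNReal.ofReal (2 / c) := by
        rw [← ENNReal.ofReal_add (by positivity) (by positivity)]; ring_nf

/-- The function `x ↦ ∫_0^∞ e^{-c|x-y|} |h(y)| dy`. -/
def expConv (c : ℝ) (h : ℝ → ℝ) (x : ℝ) : ℝ≥0∞ :=
  ∫⁻ y in Ioi 0, ENNReal.ofReal (Real.exp (-c * |x - y|)) * ‖h y‖ₑ

variable {p : ℝ≥0∞}

/-- The functions whose convolution with all exponential kernels is in `L^p`. -/
structure IsSource (p : ℝ≥0∞) (h : ℝ → ℝ) : Prop where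
  meas : AEStronglyMeasurable h μ
  lt_top : ∀ c, 0 < c → eLpNorm (expConv c h) p μ < ⊤

theorem measurable_exp_kernel (c : ℝ) : Measurable
    (Function.uncurry fun x y : ℝ => ENNReal.ofReal (Real.exp (-c * |x - y|))) := by
  refine ENNReal.measurable_ofReal.comp (Continuous.measurable ?_)
  fun_prop

theorem eLpNorm_expConv_le (hp : 1 ≤ p) (hp' : p ≠ ⊤) {f : ℝ → ℝ} (hf : AEStronglyMeasurable f μ)
    {c : ℝ} (hc : 0 < c) :
    eLpNorm (expConv c f) p μ ≤ ENNReal.ofReal (2 / c) * eLpNorm f p μ := by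
  have hp1 : 1 ≤ p.toReal := by
    rw [← ENNReal.toReal_one]; exact ENNReal.toReal_mono hp' hp
  have hp0 : 0 < p.toReal := one_pos.trans_le hp1
  have hpz : p ≠ 0 := (one_pos.trans_le hp).ne'
  have h := lintegral_rpow_lintegral_mul_le (ν := μ) (measurable_exp_kernel c) hf.enorm
    (lintegral_exp_neg_abs_le hc) (fun y => by
      simpa only [abs_sub_comm y] using lintegral_exp_neg_abs_le hc y) hp1
  rw [eLpNorm_eq_lintegral_rpow_enorm_toReal hpz hp', eLpNorm_eq_lintegral_rpow_enorm_toReal hpz hp']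
  calc (∫⁻ x in Ioi 0, ‖expConv c f x‖ₑ ^ p.toReal) ^ (1 / p.toReal)
      ≤ (ENNReal.ofReal (2 / c) ^ p.toReal * ∫⁻ y in Ioi 0, ‖f y‖ₑ ^ p.toReal) ^ (1 / p.toReal) :=
        ENNReal.rpow_le_rpow h (by positivity)
    _ = _ := by
        rw [ENNReal.mul_rpow_of_nonneg _ _ (by positivity), ← ENNReal.rpow_mul,
          mul_one_div_cancel hp0.ne', ENNReal.rpow_one]

/-- Cauchy–Schwarz isolates `‖b‖₂` and leaves `(∫ e^{-2c|x-y|} |g|²)^{1/2}`. Schur's test at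
exponent `p/2 ≥ 1` applied to `|g|²` then yields `‖g‖_p` and the factor `c^{-1/2}`, which keeps the
drift term integrable in time. -/
theorem eLpNorm_expConv_mul_le (hp : 2 ≤ p) (hp' : p ≠ ⊤) {b g : ℝ → ℝ}
    (hb : AEStronglyMeasurable b μ) (hg : AEStronglyMeasurable g μ) {c : ℝ} (hc : 0 < c) :
    eLpNorm (expConv c fun y => b y * g y) p μ ≤
      ENNReal.ofReal (1 / c) ^ (1 / 2 : ℝ) * eLpNorm b 2 μ * eLpNorm g p μ := by
  have hp1 : 2 ≤ p.toReal := by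
    have := ENNReal.toReal_mono hp' hp
    simpa using this
  have hp0 : 0 < p.toReal := two_pos.trans_le hp1
  have hpz : p ≠ 0 := (two_pos.trans_le hp).ne'
  have hpt : ∀ x, expConv c (fun y => b y * g y) x ≤ eLpNorm b 2 μ *
      (∫⁻ y in Ioi 0, ENNReal.ofReal (Real.exp (-(2 * c) * |x - y|)) * ‖g y‖ₑ ^ (2 : ℝ))
        ^ (1 / 2 : ℝ) := by
    intro x
    have hkm : Measurable fun y => ENNReal.ofReal (Real.exp (-c * |x - y|)) :=
      (measurable_exp_kernel c).comp measurable_prodMk_left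
    have h := ENNReal.lintegral_mul_le_Lp_mul_Lq μ Real.HolderConjugate.two_two (f := fun y => ‖b y‖ₑ)
      (g := fun y => ENNReal.ofReal (Real.exp (-c * |x - y|)) * ‖g y‖ₑ) hb.enorm
      (hkm.aemeasurable.mul hg.enorm)
    rw [eLpNorm_eq_lintegral_rpow_enorm_toReal two_ne_zero ENNReal.ofNat_ne_top,
      ENNReal.toReal_ofNat]
    refine (le_of_eq ?_).trans (h.trans_eq ?_)
    · refine lintegral_congr fun y => ?_
      rw [Pi.mul_apply, enorm_mul]; ring
    · congr 2
      refine lintegral_congr fun y => ?_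
      rw [ENNReal.mul_rpow_of_nonneg _ _ zero_le_two, ENNReal.ofReal_rpow_of_pos (Real.exp_pos _),
        ← Real.exp_mul]
      ring_nf
  have h := lintegral_rpow_lintegral_mul_le (ν := μ) (measurable_exp_kernel (2 * c))
    (hg.enorm.pow_const (2 : ℝ)) (lintegral_exp_neg_abs_le (by positivity)) (fun y => by
      simpa only [abs_sub_comm y] using lintegral_exp_neg_abs_le (c := 2 * c) (by positivity) y)
    (r := p.toReal / 2) (by linarith)
  have e2c : 2 / (2 * c) = 1 / c := by field_simp
  rw [e2c] at h
  have e3 : ∀ y, (‖g y‖ₑ ^ (2 : ℝ)) ^ (p.toReal / 2) = ‖g y‖ₑ ^ p.toReal := fun y => by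
    rw [← ENNReal.rpow_mul]; congr 1; ring
  simp only [e3] at h
  rw [eLpNorm_eq_lintegral_rpow_enorm_toReal hpz hp',
    eLpNorm_eq_lintegral_rpow_enorm_toReal (f := g) hpz hp']
  set B := eLpNorm b 2 μ
  calc (∫⁻ x in Ioi 0, ‖expConv c (fun y => b y * g y) x‖ₑ ^ p.toReal) ^ (1 / p.toReal)
      ≤ (∫⁻ x in Ioi 0, B ^ p.toReal *
        (∫⁻ y in Ioi 0, ENNReal.ofReal (Real.exp (-(2 * c) * |x - y|)) * ‖g y‖ₑ ^ (2 : ℝ))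
          ^ (p.toReal / 2)) ^ (1 / p.toReal) := by
        refine ENNReal.rpow_le_rpow (lintegral_mono fun x => ?_) (by positivity)
        refine (ENNReal.rpow_le_rpow (hpt x) hp0.le).trans_eq ?_
        rw [ENNReal.mul_rpow_of_nonneg _ _ hp0.le, ← ENNReal.rpow_mul]
        congr 2; ring
    _ ≤ (B ^ p.toReal * (ENNReal.ofReal (1 / c) ^ (p.toReal / 2) *
          ∫⁻ y in Ioi 0, ‖g y‖ₑ ^ p.toReal)) ^ (1 / p.toReal) := by
        refine ENNReal.rpow_le_rpow ?_ (by positivity)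
        rw [lintegral_const_mul'']
        · gcongr
        · exact ((measurable_exp_kernel (2 * c)).aemeasurable.mul
            (hg.enorm.pow_const (2 : ℝ)).comp_snd).lintegral_prod_right'.pow_const _
    _ = _ := by
        rw [ENNReal.mul_rpow_of_nonneg _ _ (by positivity),
          ENNReal.mul_rpow_of_nonneg _ _ (by positivity), ← ENNReal.rpow_mul,
          mul_one_div_cancel hp0.ne', ENNReal.rpow_one, ← ENNReal.rpow_mul]
        have : p.toReal / 2 * (1 / p.toReal) = 1 / 2 := by field_simp
        rw [this]; ring

theorem isSource_of_memLp (hp : 1 ≤ p) (hp' : p ≠ ⊤) {f : ℝ → ℝ} (hf : MemLp f p μ) :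
    IsSource p f :=
  ⟨hf.1, fun _ hc => (eLpNorm_expConv_le hp hp' hf.1 hc).trans_lt
    (ENNReal.mul_lt_top ENNReal.ofReal_lt_top hf.2)⟩

theorem isSource_mul (hp : 2 ≤ p) (hp' : p ≠ ⊤) {b g : ℝ → ℝ} (hb : MemLp b 2 μ)
    (hg : MemLp g p μ) : IsSource p fun y => b y * g y :=
  ⟨hb.1.mul hg.1, fun _ hc => (eLpNorm_expConv_mul_le hp hp' hb.1 hg.1 hc).trans_lt
    (ENNReal.mul_lt_top (ENNReal.mul_lt_top (ENNReal.rpow_lt_top_of_nonneg (y := 1 / 2) (by norm_num)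
      ENNReal.ofReal_ne_top) hb.2) hg.2)⟩

theorem measurable_expConv {h : ℝ → ℝ} (hh : AEStronglyMeasurable h μ) (c : ℝ) :
    AEMeasurable (expConv c h) μ :=
  ((measurable_exp_kernel c).aemeasurable.mul hh.enorm.comp_snd).lintegral_prod_right'

theorem expConv_congr {h h' : ℝ → ℝ} (hh : h =ᵐ[μ] h') (c : ℝ) : expConv c h = expConv c h' := by
  ext x
  refine lintegral_congr_ae ?_
  filter_upwards [hh] with y hy
  rw [hy]

theorem expConv_add_le {h h' : ℝ → ℝ} (hh : AEStronglyMeasurable h μ) (c : ℝ) (x : ℝ) :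
    expConv c (fun y => h y + h' y) x ≤ expConv c h x + expConv c h' x := by
  rw [expConv, expConv, expConv, ← lintegral_add_left']
  · refine lintegral_mono fun y => ?_
    rw [← mul_add]
    gcongr
    exact enorm_add_le _ _
  · exact ((measurable_exp_kernel c).comp measurable_prodMk_left).aemeasurable.mul hh.enorm

theorem IsSource.congr {h h' : ℝ → ℝ} (hs : IsSource p h) (hh : h =ᵐ[μ] h') : IsSource p h' :=
  ⟨hs.1.congr hh, fun c hc => by rw [← expConv_congr hh]; exact hs.2 c hc⟩

theorem IsSource.add (hp : 1 ≤ p) {h h' : ℝ → ℝ} (hs : IsSource p h) (hs' : IsSource p h') :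
    IsSource p fun y => h y + h' y := by
  refine ⟨hs.1.add hs'.1, fun c hc => ?_⟩
  calc eLpNorm (expConv c fun y => h y + h' y) p μ
      ≤ eLpNorm (expConv c h + expConv c h') p μ :=
        eLpNorm_mono_enorm fun x => expConv_add_le hs.1 c x
    _ ≤ _ := eLpNorm_add_le (measurable_expConv hs.1 c).aestronglyMeasurable
        (measurable_expConv hs'.1 c).aestronglyMeasurable hp
    _ < ⊤ := ENNReal.add_lt_top.2 ⟨hs.2 c hc, hs'.2 c hc⟩

theorem IsSource.const_mul {h : ℝ → ℝ} (hs : IsSource p h) (a : ℝ) :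
    IsSource p fun y => a * h y := by
  refine ⟨hs.1.const_mul a, fun c hc => ?_⟩
  have e : expConv c (fun y => a * h y) = fun x => ‖a‖ₑ * expConv c h x := by
    ext x
    rw [expConv, expConv, ← lintegral_const_mul' _ _ enorm_ne_top]
    refine lintegral_congr fun y => ?_
    rw [enorm_mul]; ring
  have h2 : eLpNorm (fun x => ‖a‖ₑ * expConv c h x) p μ ≤ ‖a‖₊ • eLpNorm (expConv c h) p μ :=
    eLpNorm_le_nnreal_smul_eLpNorm_of_ae_le_mul' (Eventually.of_forall fun x => le_of_eq rfl) p
  rw [e]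
  exact h2.trans_lt (ENNReal.mul_lt_top ENNReal.coe_lt_top (hs.2 c hc))

/-- Being in `L^p`, the convolution is finite at some `x₀`; the triangle inequality compares the
values at `x` and `x₀` up to a factor `e^{c|x-x₀|}`. -/
theorem IsSource.expConv_lt_top (hp : p ≠ 0) (hp' : p ≠ ⊤) {h : ℝ → ℝ} (hs : IsSource p h)
    {c : ℝ} (hc : 0 < c) (x : ℝ) : expConv c h x < ⊤ := by
  obtain ⟨x₀, hx₀⟩ : ∃ x₀, expConv c h x₀ < ⊤ := by
    have h1 : ∀ᵐ x ∂μ, expConv c h x < ⊤ := by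
      have h2 := lintegral_rpow_enorm_lt_top_of_eLpNorm_lt_top hp hp' (hs.2 c hc)
      have hp0 : 0 < p.toReal := ENNReal.toReal_pos hp hp'
      filter_upwards [ae_lt_top' ((measurable_expConv hs.1 c).enorm.pow_const _) h2.ne] with x hx
      exact (ENNReal.rpow_lt_top_iff_of_pos hp0).1 hx
    have : (ae μ).NeBot := by
      rw [ae_neBot]
      intro h0
      have := congrArg (fun ν : Measure ℝ => ν univ) h0
      simp at this
    exact h1.exists
  calc expConv c h x ≤ ENNReal.ofReal (Real.exp (c * |x - x₀|)) * expConv c h x₀ := by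
        rw [expConv, expConv, ← lintegral_const_mul' _ _ ENNReal.ofReal_ne_top]
        refine lintegral_mono fun y => ?_
        rw [← mul_assoc, ← ENNReal.ofReal_mul (Real.exp_pos _).le, ← Real.exp_add]
        gcongr
        have := abs_sub_le x₀ x y
        rw [abs_sub_comm x₀ x] at this
        nlinarith
    _ < ⊤ := ENNReal.mul_lt_top ENNReal.ofReal_lt_top hx₀

theorem IsSource.integrable_exp_mul (hp : p ≠ 0) (hp' : p ≠ ⊤) {h : ℝ → ℝ} (hs : IsSource p h) {c : ℝ}
    (hc : 0 < c) (x : ℝ) : Integrable (fun y => Real.exp (-c * |x - y|) * |h y|) μ := by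
  refine ⟨(by fun_prop : Continuous fun y : ℝ => Real.exp (-c * |x - y|)).aestronglyMeasurable.mul
    hs.1.norm, ?_⟩
  refine lt_of_eq_of_lt (lintegral_congr (g := fun y =>
    ENNReal.ofReal (Real.exp (-c * |x - y|)) * ‖h y‖ₑ) fun y => ?_) (hs.expConv_lt_top hp hp' hc x)
  rw [enorm_mul, Real.enorm_abs, Real.enorm_of_nonneg (Real.exp_pos _).le]

end HalfLine

/-! ### Heat kernel bounds and the Dirichlet semigroup in W^{1,p} -/

namespace HalfLine

open Filter Topology

/-- The first spatial derivative of the heat kernel. -/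
def Gx (t x : ℝ) : ℝ := -x / (2 * t) * G t x

/-- The second spatial derivative of the heat kernel. -/
def Gxx (t x : ℝ) : ℝ := (x ^ 2 / (4 * t ^ 2) - 1 / (2 * t)) * G t x

theorem hasDerivAt_G {t : ℝ} (ht : 0 < t) (x : ℝ) : HasDerivAt (G t) (Gx t x) x := by
  have h1 : HasDerivAt (fun z : ℝ => -z ^ 2 / (4 * t)) (-(2 * x) / (4 * t)) x := by
    have := ((hasDerivAt_pow 2 x).neg).div_const (4 * t)
    simpa using this
  have h2 := (h1.exp).const_mul (1 / √(4 * Real.pi * t))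
  refine h2.congr_deriv ?_
  simp only [Gx, G]
  field_simp
  ring

theorem hasDerivAt_Gx {t : ℝ} (ht : 0 < t) (x : ℝ) : HasDerivAt (Gx t) (Gxx t x) x := by
  have h1 : HasDerivAt (fun z : ℝ => -z / (2 * t)) (-1 / (2 * t)) x :=
    (hasDerivAt_id x).neg.div_const (2 * t)
  refine (h1.mul (hasDerivAt_G ht x)).congr_deriv ?_
  simp only [Gxx, Gx]
  field_simp
  ring

theorem measurable_G : Measurable fun q : ℝ × ℝ => G q.1 q.2 := by
  unfold G; fun_prop

theorem measurable_Gx : Measurable fun q : ℝ × ℝ => Gx q.1 q.2 := by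
  unfold Gx G; fun_prop

theorem measurable_Gxx : Measurable fun q : ℝ × ℝ => Gxx q.1 q.2 := by
  unfold Gxx G; fun_prop

/-- The constant in the exponential bounds for the heat kernel. -/
def heatConst : ℝ := 2 * Real.exp 4

theorem heatConst_pos : 0 < heatConst := by unfold heatConst; positivity

/-- The decay rate of the heat kernel at time `t`. -/
def rate (t : ℝ) : ℝ := (√t)⁻¹

theorem rate_pos {t : ℝ} (ht : 0 < t) : 0 < rate t := inv_pos.2 (Real.sqrt_pos.2 ht)

theorem rate_sq {t : ℝ} (ht : 0 < t) : rate t ^ 2 = 1 / t := by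
  rw [rate, inv_pow, Real.sq_sqrt ht.le, one_div]

/-- Trades the Gaussian for an exponential in the similarity variable `z = |x|/√t`. The polynomial
is at most `2e^z`, and `z - z²/4 ≤ 4 - z` because `(z/2 - 2)² ≥ 0`, whence the value of `heatConst`.
-/
theorem poly_mul_exp_le {z : ℝ} (hz : 0 ≤ z) :
    (1 + z + z ^ 2) * Real.exp (-(z ^ 2 / 4)) ≤ heatConst * Real.exp (-z) := by
  have h1 : 1 + z + z ^ 2 / 2 ≤ Real.exp z := Real.quadratic_le_exp_of_nonneg hz
  have h2 : 1 + z + z ^ 2 ≤ 2 * Real.exp z := by nlinarith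
  calc (1 + z + z ^ 2) * Real.exp (-(z ^ 2 / 4)) ≤ 2 * Real.exp z * Real.exp (-(z ^ 2 / 4)) := by
        gcongr
    _ = 2 * Real.exp (z + -(z ^ 2 / 4)) := by rw [mul_assoc, ← Real.exp_add]
    _ ≤ 2 * Real.exp (4 + -z) := by
        refine mul_le_mul_of_nonneg_left (Real.exp_le_exp.2 ?_) zero_le_two
        nlinarith [sq_nonneg (z / 2 - 2)]
    _ = _ := by rw [Real.exp_add, heatConst, mul_assoc]

theorem abs_G_le {t : ℝ} (ht : 0 < t) (x : ℝ) :
    0 ≤ G t x ∧ G t x ≤ rate t * Real.exp (-((rate t * |x|) ^ 2 / 4)) := by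
  refine ⟨by unfold G; positivity, ?_⟩
  have h1 : 1 / √(4 * Real.pi * t) ≤ rate t := by
    rw [rate, ← one_div]
    have : √t ≤ √(4 * Real.pi * t) := Real.sqrt_le_sqrt (by nlinarith [Real.pi_gt_three])
    exact one_div_le_one_div_of_le (Real.sqrt_pos.2 ht) this
  have h2 : -((rate t * |x|) ^ 2 / 4) = -x ^ 2 / (4 * t) := by
    rw [mul_pow, rate_sq ht, sq_abs]; field_simp
  rw [h2, G]
  gcongr

theorem norm_G_le {t : ℝ} (ht : 0 < t) (x : ℝ) :
    |G t x| ≤ heatConst * rate t * Real.exp (-rate t * |x|) := by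
  have hc := rate_pos ht
  have hz : 0 ≤ rate t * |x| := by positivity
  obtain ⟨h0, h1⟩ := abs_G_le ht x
  have h2 := poly_mul_exp_le hz
  rw [abs_of_nonneg h0]
  calc G t x ≤ rate t * (1 * Real.exp (-((rate t * |x|) ^ 2 / 4))) := by rwa [one_mul]
    _ ≤ rate t * ((1 + rate t * |x| + (rate t * |x|) ^ 2) *
        Real.exp (-((rate t * |x|) ^ 2 / 4))) := by
        gcongr; nlinarith
    _ ≤ rate t * (heatConst * Real.exp (-(rate t * |x|))) := by gcongr
    _ = _ := by ring_nf

theorem norm_Gx_le {t : ℝ} (ht : 0 < t) (x : ℝ) :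
    |Gx t x| ≤ heatConst * rate t ^ 2 * Real.exp (-rate t * |x|) := by
  have hc := rate_pos ht
  have hz : 0 ≤ rate t * |x| := by positivity
  obtain ⟨h0, h1⟩ := abs_G_le ht x
  have h2 := poly_mul_exp_le hz
  have e : |Gx t x| = rate t ^ 2 * |x| / 2 * G t x := by
    rw [Gx, abs_mul, abs_of_nonneg h0, abs_div, abs_neg, abs_of_pos (by positivity : 0 < 2 * t),
      rate_sq ht]
    field_simp
  rw [e]
  calc rate t ^ 2 * |x| / 2 * G t x
      ≤ rate t ^ 2 * |x| / 2 * (rate t * Real.exp (-((rate t * |x|) ^ 2 / 4))) := by gcongr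
    _ = rate t ^ 2 * ((rate t * |x|) / 2 * Real.exp (-((rate t * |x|) ^ 2 / 4))) := by ring
    _ ≤ rate t ^ 2 * ((1 + rate t * |x| + (rate t * |x|) ^ 2) *
        Real.exp (-((rate t * |x|) ^ 2 / 4))) := by
        gcongr; nlinarith
    _ ≤ rate t ^ 2 * (heatConst * Real.exp (-(rate t * |x|))) := by gcongr
    _ = _ := by ring_nf

theorem norm_Gxx_le {t : ℝ} (ht : 0 < t) (x : ℝ) :
    |Gxx t x| ≤ heatConst * rate t ^ 3 * Real.exp (-rate t * |x|) := by
  have hc := rate_pos ht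
  have hz : 0 ≤ rate t * |x| := by positivity
  obtain ⟨h0, h1⟩ := abs_G_le ht x
  have h2 := poly_mul_exp_le hz
  have e : |Gxx t x| ≤ rate t ^ 2 * ((rate t * |x|) ^ 2 / 4 + 1 / 2) * G t x := by
    rw [Gxx, abs_mul, abs_of_nonneg h0]
    refine mul_le_mul_of_nonneg_right ?_ h0
    refine (abs_sub _ _).trans_eq ?_
    rw [abs_of_nonneg (by positivity), abs_of_nonneg (by positivity), mul_pow, rate_sq ht, sq_abs]
    field_simp
  calc |Gxx t x| ≤ rate t ^ 2 * ((rate t * |x|) ^ 2 / 4 + 1 / 2) *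
        (rate t * Real.exp (-((rate t * |x|) ^ 2 / 4))) := e.trans (by gcongr)
    _ = rate t ^ 3 * (((rate t * |x|) ^ 2 / 4 + 1 / 2) *
        Real.exp (-((rate t * |x|) ^ 2 / 4))) := by ring
    _ ≤ rate t ^ 3 * ((1 + rate t * |x| + (rate t * |x|) ^ 2) *
        Real.exp (-((rate t * |x|) ^ 2 / 4))) := by
        refine mul_le_mul_of_nonneg_left
          (mul_le_mul_of_nonneg_right ?_ (Real.exp_pos _).le) (by positivity)
        nlinarith
    _ ≤ rate t ^ 3 * (heatConst * Real.exp (-(rate t * |x|))) := by gcongr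
    _ = _ := by ring_nf

variable {p : ℝ≥0∞}

theorem enorm_integral_kernel_le {K : ℝ → ℝ → ℝ} {κ c : ℝ} (hκ : 0 ≤ κ)
    (hb : ∀ x y, 0 < x → 0 < y → |K x y| ≤ κ * Real.exp (-c * |x - y|)) (h : ℝ → ℝ) {x : ℝ}
    (hx : 0 < x) : ‖∫ y in Ioi 0, K x y * h y‖ₑ ≤ ENNReal.ofReal κ * expConv c h x := by
  refine (enorm_integral_le_lintegral_enorm _).trans ?_
  rw [expConv, ← lintegral_const_mul' _ _ ENNReal.ofReal_ne_top]
  refine setLIntegral_mono' measurableSet_Ioi fun y hy => ?_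
  rw [enorm_mul, ← mul_assoc, ← ENNReal.ofReal_mul hκ, ← ofReal_norm, Real.norm_eq_abs]
  gcongr
  exact hb x y hx hy

theorem eLpNorm_integral_kernel_le {K : ℝ → ℝ → ℝ} {κ c : ℝ} (hκ : 0 ≤ κ)
    (hb : ∀ x y, 0 < x → 0 < y → |K x y| ≤ κ * Real.exp (-c * |x - y|)) (h : ℝ → ℝ) :
    eLpNorm (fun x => ∫ y in Ioi 0, K x y * h y) p μ ≤
      ENNReal.ofReal κ * eLpNorm (expConv c h) p μ := by
  refine eLpNorm_le_nnreal_smul_eLpNorm_of_ae_le_mul' (c := κ.toNNReal) ?_ p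
  filter_upwards [ae_restrict_mem measurableSet_Ioi] with x hx
  exact enorm_integral_kernel_le hκ hb h hx

theorem memLp_integral_kernel {K : ℝ → ℝ → ℝ} (hK : Measurable (Function.uncurry K)) {κ c : ℝ}
    (hκ : 0 ≤ κ) (hc : 0 < c)
    (hb : ∀ x y, 0 < x → 0 < y → |K x y| ≤ κ * Real.exp (-c * |x - y|)) {h : ℝ → ℝ}
    (hs : IsSource p h) : MemLp (fun x => ∫ y in Ioi 0, K x y * h y) p μ :=
  ⟨(hK.aestronglyMeasurable.mul hs.1.comp_snd).integral_prod_right',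
    (eLpNorm_integral_kernel_le hκ hb h).trans_lt
      (ENNReal.mul_lt_top ENNReal.ofReal_lt_top (hs.2 c hc))⟩

theorem integrable_kernel_mul (hp : p ≠ 0) (hp' : p ≠ ⊤) {K : ℝ → ℝ → ℝ}
    (hK : Measurable (Function.uncurry K)) {κ c : ℝ} (hc : 0 < c)
    (hb : ∀ x y, 0 < x → 0 < y → |K x y| ≤ κ * Real.exp (-c * |x - y|)) {h : ℝ → ℝ}
    (hs : IsSource p h) {x : ℝ} (hx : 0 < x) : Integrable (fun y => K x y * h y) μ := by
  refine ((hs.integrable_exp_mul hp hp' hc x).const_mul κ).mono'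
    ((hK.comp measurable_prodMk_left).aestronglyMeasurable.mul hs.1) ?_
  filter_upwards [ae_restrict_mem measurableSet_Ioi] with y hy
  rw [norm_mul, ← mul_assoc]
  exact mul_le_mul_of_nonneg_right (hb x y hx hy) (abs_nonneg _)

theorem hasDerivAt_integral_kernel (hp : p ≠ 0) (hp' : p ≠ ⊤) {K K' : ℝ → ℝ → ℝ}
    (hK : Measurable (Function.uncurry K)) (hK' : Measurable (Function.uncurry K'))
    (hd : ∀ x y, HasDerivAt (fun x => K x y) (K' x y) x) {κ κ' c : ℝ} (hκ' : 0 ≤ κ') (hc : 0 < c)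
    (hb : ∀ x y, 0 < x → 0 < y → |K x y| ≤ κ * Real.exp (-c * |x - y|))
    (hb' : ∀ x y, 0 < x → 0 < y → |K' x y| ≤ κ' * Real.exp (-c * |x - y|)) {h : ℝ → ℝ}
    (hs : IsSource p h) {x : ℝ} (hx : 0 < x) :
    HasDerivAt (fun x => ∫ y in Ioi 0, K x y * h y) (∫ y in Ioi 0, K' x y * h y) x := by
  -- Domination on the ball of radius `x` about `x`: it stays in `(0, ∞)`, and moving the base point
  -- by less than `x` costs at most `e^{cx}`.
  have hbound := ((hs.integrable_exp_mul hp hp' hc x).const_mul (κ' * Real.exp (c * x)))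
  refine (hasDerivAt_integral_of_dominated_loc_of_deriv_le (F := fun x y => K x y * h y)
    (F' := fun x y => K' x y * h y) (Metric.ball_mem_nhds x hx)
    (Eventually.of_forall fun z =>
      (hK.comp measurable_prodMk_left).aestronglyMeasurable.mul hs.1)
    (integrable_kernel_mul hp hp' hK hc hb hs hx)
    ((hK'.comp measurable_prodMk_left).aestronglyMeasurable.mul hs.1) ?_ hbound
    (Eventually.of_forall fun y z _ => (hd z y).mul_const (h y))).2
  filter_upwards [ae_restrict_mem measurableSet_Ioi] with y hy z hz
  rw [Metric.mem_ball, Real.dist_eq] at hz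
  have hz0 : 0 < z := by linarith [(abs_lt.1 hz).1]
  rw [norm_mul, ← mul_assoc, mul_assoc κ', ← Real.exp_add, Real.norm_eq_abs, Real.norm_eq_abs]
  refine mul_le_mul_of_nonneg_right ((hb' z y hz0 hy).trans ?_) (abs_nonneg _)
  gcongr
  have h1 := abs_sub_le x z y
  rw [abs_sub_comm x z] at h1
  nlinarith

/-- The Dirichlet heat kernel on the half-line. -/
def kD (t x y : ℝ) : ℝ := G t (x - y) - G t (x + y)

/-- The spatial derivative of the Dirichlet heat kernel. -/
def kDx (t x y : ℝ) : ℝ := Gx t (x - y) - Gx t (x + y)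

/-- The Neumann heat kernel on the half-line. -/
def kN (t x y : ℝ) : ℝ := G t (x - y) + G t (x + y)

theorem measurable_kD : Measurable fun q : ℝ × ℝ × ℝ => kD q.1 q.2.1 q.2.2 :=
  (measurable_G.comp (by fun_prop : Measurable fun q : ℝ × ℝ × ℝ => (q.1, q.2.1 - q.2.2))).sub
    (measurable_G.comp (by fun_prop : Measurable fun q : ℝ × ℝ × ℝ => (q.1, q.2.1 + q.2.2)))

theorem measurable_kDx : Measurable fun q : ℝ × ℝ × ℝ => kDx q.1 q.2.1 q.2.2 :=
  (measurable_Gx.comp (by fun_prop : Measurable fun q : ℝ × ℝ × ℝ => (q.1, q.2.1 - q.2.2))).sub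
    (measurable_Gx.comp (by fun_prop : Measurable fun q : ℝ × ℝ × ℝ => (q.1, q.2.1 + q.2.2)))

theorem measurable_uncurry_kD (t : ℝ) : Measurable (Function.uncurry (kD t)) :=
  measurable_kD.comp measurable_prodMk_left

theorem measurable_uncurry_kDx (t : ℝ) : Measurable (Function.uncurry (kDx t)) :=
  measurable_kDx.comp measurable_prodMk_left

/-- The reflected part of the kernel is no larger than the direct one on the half-line, so it only
doubles constants. -/
theorem exp_reflected_le {c x y : ℝ} (hc : 0 < c) (hx : 0 < x) (hy : 0 < y) :
    Real.exp (-c * |x + y|) ≤ Real.exp (-c * |x - y|) := by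
  refine Real.exp_le_exp.2 ?_
  have h : |x - y| ≤ |x + y| := by
    rw [abs_of_pos (add_pos hx hy)]
    exact abs_le.2 ⟨by linarith, by linarith⟩
  nlinarith

theorem abs_kD_le {t : ℝ} (ht : 0 < t) (x y : ℝ) (hx : 0 < x) (hy : 0 < y) :
    |kD t x y| ≤ 2 * heatConst * rate t * Real.exp (-rate t * |x - y|) := by
  have h1 := norm_G_le ht (x - y)
  have h2 := norm_G_le ht (x + y)
  have h3 := mul_le_mul_of_nonneg_left (exp_reflected_le (rate_pos ht) hx hy)
    (mul_nonneg heatConst_pos.le (rate_pos ht).le)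
  have h4 := abs_sub (G t (x - y)) (G t (x + y))
  rw [kD]; linarith

theorem abs_kN_le {t : ℝ} (ht : 0 < t) (x y : ℝ) (hx : 0 < x) (hy : 0 < y) :
    |kN t x y| ≤ 2 * heatConst * rate t * Real.exp (-rate t * |x - y|) := by
  have h1 := norm_G_le ht (x - y)
  have h2 := norm_G_le ht (x + y)
  have h3 := mul_le_mul_of_nonneg_left (exp_reflected_le (rate_pos ht) hx hy)
    (mul_nonneg heatConst_pos.le (rate_pos ht).le)
  have h4 := abs_add_le (G t (x - y)) (G t (x + y))
  rw [kN]; linarith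

theorem abs_kDx_le {t : ℝ} (ht : 0 < t) (x y : ℝ) (hx : 0 < x) (hy : 0 < y) :
    |kDx t x y| ≤ 2 * heatConst * rate t ^ 2 * Real.exp (-rate t * |x - y|) := by
  have h1 := norm_Gx_le ht (x - y)
  have h2 := norm_Gx_le ht (x + y)
  have h3 := mul_le_mul_of_nonneg_left (exp_reflected_le (rate_pos ht) hx hy)
    (mul_nonneg heatConst_pos.le (sq_nonneg (rate t)))
  have h4 := abs_sub (Gx t (x - y)) (Gx t (x + y))
  rw [kDx]; linarith

theorem hasDerivAt_kD {t : ℝ} (ht : 0 < t) (x y : ℝ) :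
    HasDerivAt (fun x => kD t x y) (kDx t x y) x :=
  ((hasDerivAt_G ht (x - y)).comp_sub_const x y).sub ((hasDerivAt_G ht (x + y)).comp_add_const x y)

theorem memLp_kD {t : ℝ} {h : ℝ → ℝ} (ht : 0 < t) (hs : IsSource p h) :
    MemLp (fun x => ∫ y in Ioi 0, kD t x y * h y) p μ :=
  memLp_integral_kernel (measurable_uncurry_kD t)
    (mul_nonneg (mul_nonneg zero_le_two heatConst_pos.le) (rate_pos ht).le) (rate_pos ht)
    (abs_kD_le ht) hs

theorem memLp_kDx {t : ℝ} {h : ℝ → ℝ} (ht : 0 < t) (hs : IsSource p h) :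
    MemLp (fun x => ∫ y in Ioi 0, kDx t x y * h y) p μ :=
  memLp_integral_kernel (measurable_uncurry_kDx t)
    (mul_nonneg (mul_nonneg zero_le_two heatConst_pos.le) (sq_nonneg _)) (rate_pos ht)
    (abs_kDx_le ht) hs

variable [Fact (1 ≤ p)]

theorem ne_zero_of_fact_one_le : p ≠ 0 := (one_pos.trans_le (Fact.out : 1 ≤ p)).ne'

variable [Fact (p ≠ ⊤)]

section heatW

variable {t : ℝ} {h h' : ℝ → ℝ}

theorem integrable_kD (ht : 0 < t) (hs : IsSource p h) {x : ℝ} (hx : 0 < x) :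
    Integrable (fun y => kD t x y * h y) μ :=
  integrable_kernel_mul ne_zero_of_fact_one_le Fact.out
    (measurable_uncurry_kD t) (rate_pos ht) (abs_kD_le ht) hs hx

theorem hasDerivAt_integral_kD (ht : 0 < t) (hs : IsSource p h) {x : ℝ} (hx : 0 < x) :
    HasDerivAt (fun x => ∫ y in Ioi 0, kD t x y * h y) (∫ y in Ioi 0, kDx t x y * h y) x :=
  hasDerivAt_integral_kernel ne_zero_of_fact_one_le Fact.out
    (measurable_uncurry_kD t) (measurable_uncurry_kDx t)
    (hasDerivAt_kD ht) (mul_nonneg (mul_nonneg zero_le_two heatConst_pos.le) (sq_nonneg _))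
    (rate_pos ht) (abs_kD_le ht) (abs_kDx_le ht) hs hx

open scoped Classical in
variable (p) in
/-- The Dirichlet heat semigroup at time `t > 0` applied to a source, in `W^{1,p}(0, ∞)`; by
convention it is `0` for `t ≤ 0` and for functions that are not sources. -/
def heatW (t : ℝ) (h : ℝ → ℝ) : W1p p :=
  if H : 0 < t ∧ IsSource p h then
    W1p.mk (memLp_kD H.1 H.2) (memLp_kDx H.1 H.2)
      (isWeakDeriv_of_hasDerivAt (fun _ hx => hasDerivAt_integral_kD H.1 H.2 hx)
        ((memLp_kDx H.1 H.2).locallyIntegrable Fact.out))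
  else 0

theorem heatW_of_nonpos (ht : t ≤ 0) (h : ℝ → ℝ) : heatW p t h = 0 :=
  dif_neg fun H => ht.not_gt H.1

theorem toLp_heatW (ht : 0 < t) (hs : IsSource p h) :
    (heatW p t h).toLp = (memLp_kD ht hs).toLp _ := by
  rw [heatW, dif_pos ⟨ht, hs⟩, W1p.toLp_mk]

theorem weakDeriv_heatW (ht : 0 < t) (hs : IsSource p h) :
    (heatW p t h).weakDeriv = (memLp_kDx ht hs).toLp _ := by
  rw [heatW, dif_pos ⟨ht, hs⟩, W1p.weakDeriv_mk]

theorem val_heatW_eq_integral (ht : 0 < t) (hs : IsSource p h) {x : ℝ} (hx : 0 < x) :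
    (heatW p t h).val x = ∫ y in Ioi 0, kD t x y * h y := by
  refine W1p.val_eq_of_ae_eq (F := fun x => ∫ y in Ioi 0, kD t x y * h y)
    (fun x hx => (hasDerivAt_integral_kD ht hs hx).continuousAt.continuousWithinAt) ?_ hx
  rw [toLp_heatW ht hs]
  exact (memLp_kD ht hs).coeFn_toLp

theorem val_heatW (ht : 0 < t) (hs : IsSource p h) {x : ℝ} (hx : 0 < x) :
    (heatW p t h).val x = dirichletHeat t h x := by
  rw [val_heatW_eq_integral ht hs hx, dirichletHeat, if_neg ht.ne']
  rfl

theorem W1p.ext_val {w w' : W1p p} (h : ∀ x, 0 < x → w.val x = w'.val x) : w = w' := by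
  refine toLp_injective (Lp.ext ?_)
  exact (toLp_ae_eq_of_val_eq h).trans w'.toLp_ae_eq_val.symm

theorem heatW_add (hs : IsSource p h) (hs' : IsSource p h') :
    heatW p t (fun y => h y + h' y) = heatW p t h + heatW p t h' := by
  rcases le_or_gt t 0 with ht | ht
  · simp [heatW_of_nonpos ht]
  refine W1p.ext_val fun x hx => ?_
  rw [← W1p.evalL_apply hx, ← W1p.evalL_apply hx, map_add, W1p.evalL_apply, W1p.evalL_apply,
    W1p.evalL_apply, val_heatW_eq_integral ht hs hx, val_heatW_eq_integral ht hs' hx,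
    val_heatW_eq_integral ht (hs.add Fact.out hs') hx,
    ← integral_add (integrable_kD ht hs hx) (integrable_kD ht hs' hx)]
  simp only [mul_add]

theorem heatW_const_mul (hs : IsSource p h) (a : ℝ) :
    heatW p t (fun y => a * h y) = a • heatW p t h := by
  rcases le_or_gt t 0 with ht | ht
  · simp [heatW_of_nonpos ht]
  refine W1p.ext_val fun x hx => ?_
  rw [← W1p.evalL_apply hx, ← W1p.evalL_apply hx, map_smul, W1p.evalL_apply, W1p.evalL_apply,
    val_heatW_eq_integral ht hs hx, val_heatW_eq_integral ht (hs.const_mul a) hx, smul_eq_mul,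
    ← integral_const_mul]
  refine integral_congr_ae (Eventually.of_forall fun y => ?_)
  ring

theorem heatW_congr (hs : IsSource p h) (hh : h =ᵐ[μ] h') : heatW p t h = heatW p t h' := by
  rcases le_or_gt t 0 with ht | ht
  · simp [heatW_of_nonpos ht]
  refine W1p.ext_val fun x hx => ?_
  rw [val_heatW_eq_integral ht hs hx, val_heatW_eq_integral ht (hs.congr hh) hx]
  refine integral_congr_ae ?_
  filter_upwards [hh] with y hy
  rw [hy]

theorem norm_toLp_heatW_le (ht : 0 < t) (hs : IsSource p h) :
    ‖(heatW p t h).toLp‖ ≤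
      2 * heatConst * rate t * (eLpNorm (expConv (rate t) h) p μ).toReal := by
  have hκ : 0 ≤ 2 * heatConst * rate t :=
    mul_nonneg (mul_nonneg zero_le_two heatConst_pos.le) (rate_pos ht).le
  rw [toLp_heatW ht hs, Lp.norm_toLp]
  refine (ENNReal.toReal_mono (ENNReal.mul_lt_top ENNReal.ofReal_lt_top
    (hs.2 _ (rate_pos ht))).ne (eLpNorm_integral_kernel_le hκ (abs_kD_le ht) h)).trans_eq ?_
  rw [ENNReal.toReal_mul, ENNReal.toReal_ofReal hκ]

theorem norm_weakDeriv_heatW_le (ht : 0 < t) (hs : IsSource p h) :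
    ‖(heatW p t h).weakDeriv‖ ≤
      2 * heatConst * rate t ^ 2 * (eLpNorm (expConv (rate t) h) p μ).toReal := by
  have hκ : 0 ≤ 2 * heatConst * rate t ^ 2 :=
    mul_nonneg (mul_nonneg zero_le_two heatConst_pos.le) (sq_nonneg _)
  rw [weakDeriv_heatW ht hs, Lp.norm_toLp]
  refine (ENNReal.toReal_mono (ENNReal.mul_lt_top ENNReal.ofReal_lt_top
    (hs.2 _ (rate_pos ht))).ne (eLpNorm_integral_kernel_le hκ (abs_kDx_le ht) h)).trans_eq ?_
  rw [ENNReal.toReal_mul, ENNReal.toReal_ofReal hκ]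

theorem norm_heatW_le (ht : 0 < t) (hs : IsSource p h) :
    ‖heatW p t h‖ ≤ 2 * heatConst * (rate t + rate t ^ 2) *
      (eLpNorm (expConv (rate t) h) p μ).toReal := by
  refine (W1p.norm_le_add _).trans
    ((add_le_add (norm_toLp_heatW_le ht hs) (norm_weakDeriv_heatW_le ht hs)).trans_eq ?_)
  ring

end heatW

end HalfLine

/-! ### Measurability of paths, and the semigroup as bounded operators -/

theorem stronglyMeasurable_of_measurable_dist {α X : Type*} [MeasurableSpace α] [MetricSpace X]
    [SecondCountableTopology X] {f : α → X} (hf : ∀ x, Measurable fun a => dist (f a) x) :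
    StronglyMeasurable f := by
  borelize X
  refine Measurable.stronglyMeasurable (measurable_of_isOpen fun s hs => ?_)
  choose! r hr hrs using fun x (hx : x ∈ s) => Metric.isOpen_iff.1 hs x hx
  -- Lindelöf: an open set is a countable union of balls, and preimages of balls are governed by
  -- distances.
  obtain ⟨T, hTs, hT, hU⟩ := TopologicalSpace.isOpen_biUnion_countable s
    (fun x => Metric.ball x (r x)) fun _ _ => Metric.isOpen_ball
  have h1 : s = ⋃ x ∈ T, Metric.ball x (r x) := by
    rw [hU]
    exact Subset.antisymm (fun x hx => mem_biUnion hx (Metric.mem_ball_self (hr x hx)))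
      (iUnion₂_subset hrs)
  rw [h1, preimage_iUnion₂]
  exact MeasurableSet.biUnion hT fun x _ => measurableSet_lt (hf x) measurable_const

/-- A strongly measurable version is set to `0` where it exceeds an essential bound. Coefficients
altered in this way define operators bounded at every time. -/
theorem MeasureTheory.MemLp.exists_stronglyMeasurable_bounded {α F : Type*} [MeasurableSpace α]
    [NormedAddCommGroup F] {ν : Measure α} {f : α → F} (hf : MemLp f ∞ ν) :
    ∃ (g : α → F) (M : ℝ), StronglyMeasurable g ∧ g =ᵐ[ν] f ∧ 0 ≤ M ∧ ∀ x, ‖g x‖ ≤ M := by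
  obtain ⟨M, hM⟩ := hf.exists_ae_norm_le
  have hm := hf.1.stronglyMeasurable_mk
  refine ⟨{x | ‖hf.1.mk f x‖ ≤ |M|}.indicator (hf.1.mk f), |M|,
    hm.indicator (measurableSet_le hm.norm.measurable measurable_const), ?_, abs_nonneg M, ?_⟩
  · filter_upwards [hM, hf.1.ae_eq_mk] with x h1 h2
    rw [indicator_of_mem, h2]
    rw [mem_ofPred_eq, ← h2]
    exact h1.trans (le_abs_self M)
  · intro x
    by_cases h : x ∈ {x | ‖hf.1.mk f x‖ ≤ |M|}
    · rw [indicator_of_mem h]; exact h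
    · rw [indicator_of_notMem h, norm_zero]; exact abs_nonneg M

namespace HalfLine

open Filter Topology

variable {p : ℝ≥0∞} [Fact (1 ≤ p)] {α : Type*} [MeasurableSpace α]

theorem W1p.isEmbedding_toLp_weakDeriv :
    IsEmbedding fun w : W1p p => (w.toLp, w.weakDeriv) :=
  (WithLp.homeomorphProd p (Lp ℝ p μ) (Lp ℝ p μ)).isEmbedding.comp .subtypeVal

theorem memLp_mul_of_bounded {c : ℝ → ℝ} (hc : StronglyMeasurable c) {M : ℝ}
    (hM : ∀ y, ‖c y‖ ≤ M) (f : Lp ℝ p μ) : MemLp (c * ⇑f) p μ :=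
  (Lp.memLp f).of_le_mul (c := M) (hc.aestronglyMeasurable.mul (Lp.memLp f).1)
    (Eventually.of_forall fun y => by
      rw [Pi.mul_apply, norm_mul]
      exact mul_le_mul_of_nonneg_right (hM y) (norm_nonneg _))

/-- Multiplication by a bounded function on `L^p`. -/
def mulL {c : ℝ → ℝ} (hc : StronglyMeasurable c) {M : ℝ} (hM : ∀ y, ‖c y‖ ≤ M) :
    Lp ℝ p μ →L[ℝ] Lp ℝ p μ :=
  LinearMap.mkContinuous
    { toFun := fun f => (memLp_mul_of_bounded hc hM f).toLp (c * ⇑f)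
      map_add' := fun f g => by
        rw [← MemLp.toLp_add]
        refine MemLp.toLp_congr _ _ ?_
        filter_upwards [Lp.coeFn_add f g] with y hy
        simp only [Pi.mul_apply, Pi.add_apply, hy, mul_add]
      map_smul' := fun a f => by
        rw [RingHom.id_apply, ← MemLp.toLp_const_smul]
        refine MemLp.toLp_congr _ _ ?_
        filter_upwards [Lp.coeFn_smul a f] with y hy
        simp only [Pi.mul_apply, Pi.smul_apply, hy, smul_eq_mul, mul_left_comm] }
    M fun f => by
      refine Lp.norm_le_mul_norm_of_ae_le_mul ?_
      filter_upwards [(memLp_mul_of_bounded hc hM f).coeFn_toLp] with y hy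
      change ‖((memLp_mul_of_bounded hc hM f).toLp (c * ⇑f)) y‖ ≤ _
      rw [hy, Pi.mul_apply, norm_mul]
      exact mul_le_mul_of_nonneg_right (hM y) (norm_nonneg _)

theorem mulL_apply_ae {c : ℝ → ℝ} (hc : StronglyMeasurable c) {M : ℝ} (hM : ∀ y, ‖c y‖ ≤ M)
    (f : Lp ℝ p μ) : mulL hc hM f =ᵐ[μ] fun y => c y * f y :=
  (memLp_mul_of_bounded hc hM f).coeFn_toLp

theorem norm_mulL_apply_le {c : ℝ → ℝ} (hc : StronglyMeasurable c) {M : ℝ} (hM : ∀ y, ‖c y‖ ≤ M)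
    (f : Lp ℝ p μ) : ‖mulL hc hM f‖ ≤ M * ‖f‖ :=
  LinearMap.mkContinuous_norm_le _ ((norm_nonneg (c 0)).trans (hM 0)) _ |> fun h =>
    (mulL hc hM).le_of_opNorm_le h f

variable [Fact (p ≠ ⊤)]

/-- A family in `L^p` with a jointly measurable representative is strongly measurable. -/
theorem stronglyMeasurable_toLp {F : α → ℝ → ℝ} (hF : Measurable (Function.uncurry F))
    {f : α → Lp ℝ p μ} (h : ∀ a, f a =ᵐ[μ] F a) : StronglyMeasurable f := by
  refine stronglyMeasurable_of_measurable_dist fun g => ?_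
  have hp : p ≠ 0 := ne_zero_of_fact_one_le
  have hp' : p ≠ ⊤ := Fact.out
  -- The distance to a fixed `g` is an integral of a jointly measurable function, so Tonelli makes
  -- it measurable in the parameter.
  have e : ∀ a, dist (f a) g =
      ((∫⁻ x in Ioi 0, ‖F a x - g x‖ₑ ^ p.toReal) ^ (1 / p.toReal)).toReal := by
    intro a
    rw [Lp.dist_def, eLpNorm_eq_lintegral_rpow_enorm_toReal hp hp']
    congr 2
    refine lintegral_congr_ae ?_
    filter_upwards [h a] with x hx
    rw [Pi.sub_apply, hx]
  simp_rw [e]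
  have hg : Measurable fun q : α × ℝ => g q.2 :=
    (Lp.stronglyMeasurable g).measurable.comp measurable_snd
  have hm : Measurable fun q : α × ℝ => ‖F q.1 q.2 - g q.2‖ₑ ^ p.toReal :=
    (hF.sub hg).enorm.pow_const _
  exact (hm.lintegral_prod_right'.pow_const _).ennreal_toReal

namespace W1p

theorem stronglyMeasurable_of_toLp_weakDeriv {f : α → W1p p}
    (h₁ : StronglyMeasurable fun a => (f a).toLp)
    (h₂ : StronglyMeasurable fun a => (f a).weakDeriv) : StronglyMeasurable f :=
  (Embedding.comp_stronglyMeasurable_iff isEmbedding_toLp_weakDeriv).1 (h₁.prodMk h₂)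

end W1p

theorem stronglyMeasurable_heatW {h : ℝ → ℝ} (hs : IsSource p h) :
    StronglyMeasurable fun t => heatW p t h := by
  have hs' : IsSource p (hs.1.mk h) := hs.congr hs.1.ae_eq_mk
  have hm : Measurable fun q : (ℝ × ℝ) × ℝ => hs.1.mk h q.2 :=
    hs.1.stronglyMeasurable_mk.measurable.comp measurable_snd
  have key : ∀ K : ℝ → ℝ → ℝ → ℝ, (Measurable fun q : ℝ × ℝ × ℝ => K q.1 q.2.1 q.2.2) →
      Measurable (Function.uncurry fun t x : ℝ =>
        if 0 < t then ∫ y in Ioi 0, K t x y * hs.1.mk h y else 0) := by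
    intro K hK
    refine Measurable.ite (measurableSet_lt measurable_const measurable_fst) ?_ measurable_const
    have h1 : Measurable fun q : (ℝ × ℝ) × ℝ => K q.1.1 q.1.2 q.2 * hs.1.mk h q.2 :=
      (hK.comp (by fun_prop : Measurable fun q : (ℝ × ℝ) × ℝ => (q.1.1, q.1.2, q.2))).mul hm
    exact (h1.stronglyMeasurable.integral_prod_right' (ν := μ)).measurable
  simp_rw [heatW_congr hs hs.1.ae_eq_mk]
  refine W1p.stronglyMeasurable_of_toLp_weakDeriv
    (stronglyMeasurable_toLp (key _ measurable_kD) fun t => ?_)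
    (stronglyMeasurable_toLp (key _ measurable_kDx) fun t => ?_)
  · rcases le_or_gt t 0 with ht | ht
    · simp_rw [heatW_of_nonpos ht, ht.not_gt, if_false]
      exact Lp.coeFn_zero ℝ p μ
    · simp_rw [toLp_heatW ht hs', ht, if_true]
      exact (memLp_kD ht hs').coeFn_toLp
  · rcases le_or_gt t 0 with ht | ht
    · simp_rw [heatW_of_nonpos ht, ht.not_gt, if_false]
      exact Lp.coeFn_zero ℝ p μ
    · simp_rw [weakDeriv_heatW ht hs', ht, if_true]
      exact (memLp_kDx ht hs').coeFn_toLp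

theorem rate_eq_rpow {t : ℝ} (ht : 0 < t) : rate t = t ^ (-(1 / 2) : ℝ) := by
  rw [rate, Real.sqrt_eq_rpow, Real.rpow_neg ht.le]

theorem rate_nonneg (t : ℝ) : 0 ≤ rate t := inv_nonneg.2 (Real.sqrt_nonneg t)

theorem isSource_coe (f : Lp ℝ p μ) : IsSource p f :=
  isSource_of_memLp Fact.out Fact.out (Lp.memLp f)

/-- The norm bound for the heat semigroup on `L^p`. -/
def boundP (t : ℝ) : ℝ := 2 * heatConst * (rate t + rate t ^ 2) * (2 / rate t)

/-- The norm bound for the heat semigroup on products of `L²` and `L^p` functions. -/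
def boundQ (t : ℝ) : ℝ := 2 * heatConst * (rate t + rate t ^ 2) * (1 / rate t) ^ (1 / 2 : ℝ)

theorem boundP_nonneg (t : ℝ) : 0 ≤ boundP t := by
  have := rate_nonneg t
  have := heatConst_pos
  unfold boundP; positivity

theorem boundQ_nonneg (t : ℝ) : 0 ≤ boundQ t := by
  have := rate_nonneg t
  have := heatConst_pos
  unfold boundQ; positivity

theorem norm_heatW_coe_le (t : ℝ) (f : Lp ℝ p μ) : ‖heatW p t f‖ ≤ boundP t * ‖f‖ := by
  rcases le_or_gt t 0 with ht | ht
  · rw [heatW_of_nonpos ht, norm_zero]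
    exact mul_nonneg (boundP_nonneg t) (norm_nonneg f)
  refine (norm_heatW_le ht (isSource_coe f)).trans ?_
  have hr := rate_pos ht
  have h1 : (eLpNorm (expConv (rate t) f) p μ).toReal ≤ 2 / rate t * ‖f‖ := by
    refine (ENNReal.toReal_mono (ENNReal.mul_lt_top ENNReal.ofReal_lt_top (Lp.memLp f).2).ne
      (eLpNorm_expConv_le Fact.out Fact.out (Lp.memLp f).1 hr)).trans_eq ?_
    rw [ENNReal.toReal_mul, ENNReal.toReal_ofReal (by positivity), Lp.norm_def]
  rw [boundP, mul_assoc _ (2 / rate t)]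
  have := heatConst_pos
  gcongr

theorem norm_heatW_mul_le (hp : 2 ≤ p) (t : ℝ) (b : Lp ℝ 2 μ) (g : Lp ℝ p μ) :
    ‖heatW p t fun y => b y * g y‖ ≤ boundQ t * ‖b‖ * ‖g‖ := by
  rcases le_or_gt t 0 with ht | ht
  · rw [heatW_of_nonpos ht, norm_zero]
    exact mul_nonneg (mul_nonneg (boundQ_nonneg t) (norm_nonneg b)) (norm_nonneg g)
  refine (norm_heatW_le ht (isSource_mul hp Fact.out (Lp.memLp b) (Lp.memLp g))).trans ?_
  have hr := rate_pos ht
  have h1 : (eLpNorm (expConv (rate t) fun y => b y * g y) p μ).toReal ≤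
      (1 / rate t) ^ (1 / 2 : ℝ) * ‖b‖ * ‖g‖ := by
    refine (ENNReal.toReal_mono (ENNReal.mul_lt_top (ENNReal.mul_lt_top
      (ENNReal.rpow_lt_top_of_nonneg (y := 1 / 2) (by norm_num) ENNReal.ofReal_ne_top)
        (Lp.memLp b).2) (Lp.memLp g).2).ne (eLpNorm_expConv_mul_le hp Fact.out (Lp.memLp b).1
          (Lp.memLp g).1 hr)).trans_eq ?_
    rw [ENNReal.toReal_mul, ENNReal.toReal_mul, ← ENNReal.toReal_rpow,
      ENNReal.toReal_ofReal (by positivity), Lp.norm_def, Lp.norm_def]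
  have := heatConst_pos
  calc _ ≤ 2 * heatConst * (rate t + rate t ^ 2) * ((1 / rate t) ^ (1 / 2 : ℝ) * ‖b‖ * ‖g‖) := by
        gcongr
    _ = _ := by rw [boundQ]; ring

variable (p) in
/-- The heat semigroup as an operator from `L^p` to `W^{1,p}`. -/
def opP (t : ℝ) : Lp ℝ p μ →L[ℝ] W1p p :=
  LinearMap.mkContinuous
    { toFun := fun f => heatW p t f
      map_add' := fun f g => by
        rw [← heatW_add (isSource_coe f) (isSource_coe g)]
        exact heatW_congr (isSource_coe _) (Lp.coeFn_add f g)
      map_smul' := fun a f => by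
        rw [RingHom.id_apply, ← heatW_const_mul (isSource_coe f)]
        exact heatW_congr (isSource_coe _) (Lp.coeFn_smul a f) }
    (boundP t) (norm_heatW_coe_le t)

theorem opP_apply (t : ℝ) (f : Lp ℝ p μ) : opP p t f = heatW p t f := rfl

theorem isSource_coe_mul (hp : 2 ≤ p) (b : Lp ℝ 2 μ) (g : Lp ℝ p μ) :
    IsSource p fun y => b y * g y :=
  isSource_mul hp Fact.out (Lp.memLp b) (Lp.memLp g)

/-- The heat semigroup applied to products, as a bilinear operator `L² × L^p → W^{1,p}`. -/
def opQ (hp : 2 ≤ p) (t : ℝ) : Lp ℝ 2 μ →L[ℝ] Lp ℝ p μ →L[ℝ] W1p p :=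
  LinearMap.mkContinuous₂
    (LinearMap.mk₂ ℝ (fun (b : Lp ℝ 2 μ) (g : Lp ℝ p μ) => heatW p t fun y => b y * g y)
      (fun b b' g => by
        rw [← heatW_add (isSource_coe_mul hp b g) (isSource_coe_mul hp b' g)]
        refine heatW_congr (isSource_coe_mul hp _ _) ?_
        filter_upwards [Lp.coeFn_add b b'] with y hy
        rw [hy, Pi.add_apply, add_mul])
      (fun a b g => by
        rw [← heatW_const_mul (isSource_coe_mul hp b g)]
        refine heatW_congr (isSource_coe_mul hp _ _) ?_
        filter_upwards [Lp.coeFn_smul a b] with y hy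
        rw [hy, Pi.smul_apply, smul_eq_mul, mul_assoc])
      (fun b g g' => by
        rw [← heatW_add (isSource_coe_mul hp b g) (isSource_coe_mul hp b g')]
        refine heatW_congr (isSource_coe_mul hp _ _) ?_
        filter_upwards [Lp.coeFn_add g g'] with y hy
        rw [hy, Pi.add_apply, mul_add])
      (fun a b g => by
        rw [← heatW_const_mul (isSource_coe_mul hp b g)]
        refine heatW_congr (isSource_coe_mul hp _ _) ?_
        filter_upwards [Lp.coeFn_smul a g] with y hy
        rw [hy, Pi.smul_apply, smul_eq_mul, mul_left_comm]))
    (boundQ t) (norm_heatW_mul_le hp t)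

theorem opQ_apply (hp : 2 ≤ p) (t : ℝ) (b : Lp ℝ 2 μ) (g : Lp ℝ p μ) :
    opQ hp t b g = heatW p t fun y => b y * g y := rfl

end HalfLine

/-! ### The Volterra kernel of the lower order terms -/

namespace HalfLine

open Filter Topology

/-- Composition of a Carathéodory function with strongly measurable functions. -/
theorem stronglyMeasurable_caratheodory_comp {α β X Y : Type*} [MeasurableSpace α]
    [MeasurableSpace β] [MetricSpace X] [SecondCountableTopology X] [TopologicalSpace Y]
    [TopologicalSpace.PseudoMetrizableSpace Y] {u : X → β → Y} (hc : ∀ b, Continuous fun x => u x b)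
    (hm : ∀ x, StronglyMeasurable (u x)) {f : α → X} (hf : StronglyMeasurable f) {s : α → β}
    (hs : Measurable s) : StronglyMeasurable fun a => u (f a) (s a) := by
  borelize X
  exact (stronglyMeasurable_uncurry_of_continuous_of_stronglyMeasurable hc hm).comp_measurable
    (hf.measurable.prodMk hs)

variable {p : ℝ≥0∞} [Fact (1 ≤ p)] [Fact (p ≠ ⊤)] {α : Type*} [MeasurableSpace α]

instance fact_two_ne_top : Fact ((2 : ℝ≥0∞) ≠ ⊤) := ⟨ENNReal.ofNat_ne_top⟩

theorem stronglyMeasurable_opP_comp {f : α → Lp ℝ p μ} (hf : StronglyMeasurable f) {s : α → ℝ}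
    (hs : Measurable s) : StronglyMeasurable fun a => opP p (s a) (f a) :=
  stronglyMeasurable_caratheodory_comp (u := fun (f : Lp ℝ p μ) (t : ℝ) => opP p t f)
    (fun t => (opP p t).continuous) (fun f => stronglyMeasurable_heatW (isSource_coe f)) hf hs

theorem stronglyMeasurable_opQ_comp (hp : 2 ≤ p) {b : α → Lp ℝ 2 μ} {g : α → Lp ℝ p μ}
    (hb : StronglyMeasurable b) (hg : StronglyMeasurable g) {s : α → ℝ}
    (hs : Measurable s) : StronglyMeasurable fun a => opQ hp (s a) (b a) (g a) :=
  stronglyMeasurable_caratheodory_comp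
    (u := fun (w : Lp ℝ 2 μ × Lp ℝ p μ) (t : ℝ) => opQ hp t w.1 w.2)
    (fun t => ((opQ hp t).continuous.comp continuous_fst).clm_apply continuous_snd)
    (fun w => stronglyMeasurable_heatW (isSource_coe_mul hp w.1 w.2)) (hb.prodMk hg) hs

/-- The coefficients of the equation, bounded and measurable everywhere. -/
structure Coeffs where
  /-- the drift -/
  b : ℝ → Lp ℝ 2 μ
  /-- the potential -/
  γ : ℝ → ℝ → ℝ
  /-- a common bound -/
  M : ℝ
  measurable_b : StronglyMeasurable b
  measurable_γ : StronglyMeasurable (Function.uncurry γ)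
  norm_b_le : ∀ t, ‖b t‖ ≤ M
  norm_γ_le : ∀ t y, ‖γ t y‖ ≤ M

namespace Coeffs

variable (c : Coeffs)

/-- Multiplication by the potential at time `τ`. -/
def mulγ (τ : ℝ) : Lp ℝ p μ →L[ℝ] Lp ℝ p μ :=
  mulL (c.measurable_γ.comp_measurable measurable_prodMk_left : StronglyMeasurable (c.γ τ))
    (c.norm_γ_le τ)

theorem mulγ_apply_ae (τ : ℝ) (f : Lp ℝ p μ) : c.mulγ τ f =ᵐ[μ] fun y => c.γ τ y * f y :=
  mulL_apply_ae _ _ f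

theorem norm_mulγ_apply_le (τ : ℝ) (f : Lp ℝ p μ) : ‖c.mulγ τ f‖ ≤ c.M * ‖f‖ :=
  norm_mulL_apply_le _ _ f

theorem stronglyMeasurable_mulγ_comp {f : α → Lp ℝ p μ} (hf : StronglyMeasurable f) {s : α → ℝ}
    (hs : Measurable s) : StronglyMeasurable fun a => c.mulγ (s a) (f a) :=
  stronglyMeasurable_caratheodory_comp (u := fun (f : Lp ℝ p μ) (t : ℝ) => c.mulγ t f)
    (fun t => (c.mulγ t).continuous)
    (fun f => stronglyMeasurable_toLp (F := fun t y => c.γ t y * f y)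
      (c.measurable_γ.measurable.mul
        ((Lp.stronglyMeasurable f).measurable.comp measurable_snd)) fun t => c.mulγ_apply_ae t f)
    hf hs

/-- The operator `w ↦ Ḡ(t - τ) *_D (b(τ) ∂ₓw + γ(τ) w)` on `W^{1,p}(0, ∞)`. -/
def kernelV (hp : 2 ≤ p) (t τ : ℝ) : W1p p →L[ℝ] W1p p :=
  (opQ hp (t - τ) (c.b τ)).comp W1p.weakDerivL +
    (opP p (t - τ)).comp ((c.mulγ τ).comp W1p.toLpL)

theorem kernelV_apply (hp : 2 ≤ p) (t τ : ℝ) (w : W1p p) : c.kernelV hp t τ w =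
    opQ hp (t - τ) (c.b τ) w.weakDeriv + opP p (t - τ) (c.mulγ τ w.toLp) := rfl

theorem M_nonneg : 0 ≤ c.M := (norm_nonneg _).trans (c.norm_b_le 0)

theorem norm_kernelV_le (hp : 2 ≤ p) (t τ : ℝ) :
    ‖c.kernelV hp t τ‖ ≤ c.M * (boundQ (t - τ) + boundP (t - τ)) := by
  have hQ := boundQ_nonneg (t - τ)
  have hP := boundP_nonneg (t - τ)
  have hM := c.M_nonneg
  refine ContinuousLinearMap.opNorm_le_bound _ (by positivity) fun w => ?_
  rw [kernelV_apply]
  have h1 : ‖opQ hp (t - τ) (c.b τ) w.weakDeriv‖ ≤ boundQ (t - τ) * c.M * ‖w‖ :=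
    (norm_heatW_mul_le hp _ _ _).trans (by
      gcongr
      exacts [c.norm_b_le τ, w.norm_weakDeriv_le])
  have h2 : ‖opP p (t - τ) (c.mulγ τ w.toLp)‖ ≤ boundP (t - τ) * (c.M * ‖w‖) :=
    (norm_heatW_coe_le _ _).trans (by
      gcongr
      exact (c.norm_mulγ_apply_le τ _).trans (by gcongr; exact w.norm_toLp_le))
  refine (norm_add_le _ _).trans ((add_le_add h1 h2).trans_eq ?_)
  ring

theorem boundP_eq {t : ℝ} (ht : 0 < t) :
    boundP t = 4 * heatConst * (1 + t ^ (-(1 / 2) : ℝ)) := by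
  have := rate_pos ht
  rw [boundP, ← rate_eq_rpow ht]
  field_simp
  ring

/-- The kernel and its derivative contribute `t^{-1/2}` and `t^{-1}`; the product estimate gains
`t^{1/4}`. The worst exponent `-3/4` exceeds `-1`. -/
theorem boundQ_eq {t : ℝ} (ht : 0 < t) :
    boundQ t = 2 * heatConst * (t ^ (-(1 / 4) : ℝ) + t ^ (-(3 / 4) : ℝ)) := by
  rw [boundQ, rate_eq_rpow ht, one_div (t ^ (-(1 / 2) : ℝ)), ← Real.rpow_neg ht.le,
    ← Real.rpow_mul ht.le, ← Real.rpow_natCast, ← Real.rpow_mul ht.le, mul_assoc, add_mul,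
    ← Real.rpow_add ht, ← Real.rpow_add ht]
  norm_num

theorem integrableOn_bound (T M : ℝ) :
    IntegrableOn (fun s => M * (boundQ s + boundP s)) (Ioc 0 T) := by
  rcases le_or_gt T 0 with hT | hT
  · rw [Ioc_eq_empty (not_lt.2 hT)]; exact integrableOn_empty
  have h : ∀ r : ℝ, -1 < r → IntegrableOn (fun s : ℝ => s ^ r) (Ioc 0 T) := fun r hr =>
    (intervalIntegrable_iff_integrableOn_Ioc_of_le hT.le).1
      (intervalIntegral.intervalIntegrable_rpow' hr)
  have h0 : IntegrableOn (fun _ : ℝ => (1 : ℝ)) (Ioc 0 T) := integrableOn_const (by simp)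
  refine IntegrableOn.congr_fun (f := fun s => M * (2 * heatConst * (s ^ (-(1 / 4) : ℝ) +
    s ^ (-(3 / 4) : ℝ)) + 4 * heatConst * (1 + s ^ (-(1 / 2) : ℝ)))) ?_ (fun s hs => ?_)
    measurableSet_Ioc
  · exact ((((h _ (by norm_num)).add (h _ (by norm_num))).const_mul _).add
      ((h0.add (h _ (by norm_num))).const_mul _)).const_mul M
  · beta_reduce
    rw [boundQ_eq hs.1, boundP_eq hs.1]

theorem isVolterraKernel (hp : 2 ≤ p) (T : ℝ) :
    IsVolterraKernel T (fun s => c.M * (boundQ s + boundP s)) (c.kernelV hp (p := p)) where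
  meas w hw := by
    have h2 : StronglyMeasurable fun q : ℝ × ℝ => w q.2 := hw.comp_measurable measurable_snd
    have hs : Measurable fun q : ℝ × ℝ => q.1 - q.2 := by fun_prop
    exact (stronglyMeasurable_opQ_comp hp (c.measurable_b.comp_measurable measurable_snd)
      (W1p.weakDerivL.continuous.comp_stronglyMeasurable h2) hs).add
      (stronglyMeasurable_opP_comp (c.stronglyMeasurable_mulγ_comp
        (W1p.toLpL.continuous.comp_stronglyMeasurable h2) measurable_snd) hs)
  bound t τ _ _ _ := c.norm_kernelV_le hp t τ
  integrable := integrableOn_bound T c.M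

theorem val_kernelV (hp : 2 ≤ p) {t τ : ℝ} (ht : τ < t) (w : W1p p) {h : ℝ → ℝ}
    (hh : (fun y => c.b τ y * w.weakDeriv y + c.γ τ y * w.toLp y) =ᵐ[μ] h) {x : ℝ} (hx : 0 < x) :
    (c.kernelV hp t τ w).val x = dirichletHeat (t - τ) h x := by
  have hs1 := isSource_coe_mul hp (c.b τ) w.weakDeriv
  have hs2 := isSource_coe (c.mulγ τ w.toLp)
  have hae : (fun y => c.b τ y * w.weakDeriv y + c.mulγ τ w.toLp y) =ᵐ[μ] h := by
    filter_upwards [hh, c.mulγ_apply_ae τ w.toLp] with y h1 h2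
    rw [h2, h1]
  have hs := hs1.add Fact.out hs2
  rw [kernelV_apply, opQ_apply, opP_apply, ← heatW_add hs1 hs2, heatW_congr hs hae,
    val_heatW (sub_pos.2 ht) (hs.congr hae) hx]

/-- Evaluation at `x > 0` is a continuous functional and passes through the Bochner integral.
Changing the coefficients on null sets is invisible: by Fubini, for almost every `τ` they agree
almost everywhere in space. -/
theorem val_volterra (hp : 2 ≤ p) {T : ℝ} {b : ℝ → Lp ℝ 2 μ} {γ : ℝ × ℝ → ℝ}
    (hb : c.b =ᵐ[timeμ T] b) (hγ : Function.uncurry c.γ =ᵐ[(timeμ T).prod μ] γ) {w : ℝ → W1p p}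
    (hw : MemLp w ∞ (timeμ T)) {t : ℝ} (ht : t ∈ Icc 0 T) {x : ℝ} (hx : 0 < x) :
    (volterra (c.kernelV hp) w t).val x = duhamel (lowerOrder b γ w) t x := by
  have hint := (c.isVolterraKernel hp T).intervalIntegrable hw ht
  rw [← W1p.evalL_apply hx, volterra, ← ContinuousLinearMap.intervalIntegral_comp_comm _ hint,
    duhamel, intervalIntegral.integral_of_le ht.1, intervalIntegral.integral_of_le ht.1]
  refine integral_congr_ae ?_
  have hsub : Ioc 0 t ⊆ Icc 0 T := fun τ hτ => ⟨hτ.1.le, hτ.2.trans ht.2⟩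
  filter_upwards [IsVolterraKernel.ae_mem_Ioo t, ae_restrict_of_ae_restrict_of_subset hsub hb,
    ae_restrict_of_ae_restrict_of_subset hsub (Measure.ae_ae_of_ae_prod hγ)] with τ h1 h2 h3
  rw [W1p.evalL_apply]
  refine c.val_kernelV hp h1.2 (w τ) ?_ hx
  filter_upwards [h3] with y hy
  rw [lowerOrder, ← hy, h2]
  rfl

end Coeffs

theorem exists_coeffs {T : ℝ} {b : ℝ → Lp ℝ 2 μ} (hb : MemLp b ∞ (timeμ T)) {γ : ℝ × ℝ → ℝ}
    (hγ : MemLp γ ∞ ((timeμ T).prod μ)) : ∃ c : Coeffs, c.b =ᵐ[timeμ T] b ∧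
      Function.uncurry c.γ =ᵐ[(timeμ T).prod μ] γ := by
  obtain ⟨b', M, h1, h2, h3, h4⟩ := hb.exists_stronglyMeasurable_bounded
  obtain ⟨γ', N, g1, g2, g3, g4⟩ := hγ.exists_stronglyMeasurable_bounded
  exact ⟨⟨b', fun t y => γ' (t, y), M + N, h1, g1, fun t => (h4 t).trans (by linarith),
    fun t y => (g4 _).trans (by linarith)⟩, h2, g2⟩

end HalfLine

/-! ### Heat flow of the initial datum -/

namespace HalfLine

open Filter Topology

variable {p : ℝ≥0∞} [Fact (1 ≤ p)] [Fact (p ≠ ⊤)]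

theorem hasDerivAt_kN {t : ℝ} (ht : 0 < t) (x y : ℝ) :
    HasDerivAt (fun y => kN t x y) (-kDx t x y) y := by
  have h := ((hasDerivAt_G ht (x - y)).comp_const_sub x y).add
    ((hasDerivAt_G ht (x + y)).comp_const_add x y)
  refine h.congr_deriv ?_
  rw [kDx]; ring

theorem continuous_Gx {t : ℝ} (ht : 0 < t) : Continuous (Gx t) :=
  continuous_iff_continuousAt.2 fun x => (hasDerivAt_Gx ht x).continuousAt

theorem exp_neg_mul_abs_sub_le {c : ℝ} (hc : 0 < c) (x y : ℝ) :
    Real.exp (-c * |x - y|) ≤ Real.exp (c * x) * Real.exp (-c * y) := by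
  rw [← Real.exp_add]
  refine Real.exp_le_exp.2 ?_
  have := neg_abs_le (x - y)
  nlinarith

/-- Integration by parts, since `∂ₓ` of the Dirichlet kernel is `-∂_y` of the Neumann kernel. No
boundary term appears because the primitive vanishes at `0`. -/
theorem integral_kDx_mul_primitive {t : ℝ} (ht : 0 < t) {g : ℝ → ℝ} (hg : MemLp g p μ) {x : ℝ}
    (hx : 0 < x) :
    ∫ y in Ioi 0, kDx t x y * primitive g y = ∫ y in Ioi 0, kN t x y * g y := by
  have hr := rate_pos ht
  have hC := heatConst_pos
  have hlim : Tendsto (fun y => kN t x y) atTop (𝓝 0) := by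
    have h1 : Tendsto (fun y : ℝ => 2 * heatConst * rate t * Real.exp (rate t * x) *
        Real.exp (-rate t * y)) atTop (𝓝 0) := by
      rw [← mul_zero (2 * heatConst * rate t * Real.exp (rate t * x))]
      refine Tendsto.const_mul _ (Real.tendsto_exp_atBot.comp ?_)
      exact tendsto_id.const_mul_atTop_of_neg (neg_neg_of_pos hr)
    refine squeeze_zero_norm' ?_ h1
    filter_upwards [eventually_gt_atTop 0] with y hy
    refine (abs_kN_le ht x y hx hy).trans ?_
    rw [mul_assoc _ (Real.exp (rate t * x))]
    gcongr
    exact exp_neg_mul_abs_sub_le hr x y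
  have h := integral_primitive_mul (Fact.out : 1 ≤ p) (Fact.out : p ≠ ⊤) hg
    (θ := fun y => kN t x y) (θ' := fun y => -kDx t x y) (fun y => hasDerivAt_kN ht x y)
    (((continuous_Gx ht).comp (by fun_prop : Continuous fun y : ℝ => x - y)).sub
      ((continuous_Gx ht).comp (by fun_prop : Continuous fun y : ℝ => x + y))).neg hr
    (M := 2 * heatConst * rate t ^ 2 * Real.exp (rate t * x)) (fun y hy => by
      rw [abs_neg, mul_assoc _ (Real.exp (rate t * x))]
      refine (abs_kDx_le ht x y hx hy).trans ?_
      gcongr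
      exact exp_neg_mul_abs_sub_le hr x y) hlim
  simp only [mul_neg, integral_neg, neg_inj] at h
  simpa only [mul_comm] using h

/-- The derivative falls on the datum instead of the kernel, which removes the factor `t^{-1/2}`.
The bound is therefore uniform as `t → 0`. -/
theorem norm_heatW_le_of_primitive {t : ℝ} (ht : 0 < t) {w : W1p p}
    (hw : w.toLp =ᵐ[μ] primitive w.weakDeriv) :
    ‖heatW p t w.toLp‖ ≤ 8 * heatConst * ‖w‖ := by
  have hr := rate_pos ht
  have hC := heatConst_pos
  have hκ : 0 ≤ 2 * heatConst * rate t := by positivity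
  have hexp : ∀ f : Lp ℝ p μ, 2 * heatConst * rate t *
      (eLpNorm (expConv (rate t) f) p μ).toReal ≤ 4 * heatConst * ‖f‖ := by
    intro f
    have h1 : (eLpNorm (expConv (rate t) f) p μ).toReal ≤ 2 / rate t * ‖f‖ := by
      refine (ENNReal.toReal_mono (ENNReal.mul_lt_top ENNReal.ofReal_lt_top (Lp.memLp f).2).ne
        (eLpNorm_expConv_le Fact.out Fact.out (Lp.memLp f).1 hr)).trans_eq ?_
      rw [ENNReal.toReal_mul, ENNReal.toReal_ofReal (by positivity), Lp.norm_def]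
    calc _ ≤ 2 * heatConst * rate t * (2 / rate t * ‖f‖) := by gcongr
      _ = _ := by field_simp; ring
  have h1 : ‖(heatW p t w.toLp).toLp‖ ≤ 4 * heatConst * ‖w.toLp‖ :=
    (norm_toLp_heatW_le ht (isSource_coe w.toLp)).trans (hexp _)
  have h2 : ‖(heatW p t w.toLp).weakDeriv‖ ≤ 4 * heatConst * ‖w.weakDeriv‖ := by
    refine le_trans ?_ (hexp w.weakDeriv)
    rw [weakDeriv_heatW ht (isSource_coe w.toLp), Lp.norm_toLp]
    have e : eLpNorm (fun x => ∫ y in Ioi 0, kDx t x y * w.toLp y) p μ =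
        eLpNorm (fun x => ∫ y in Ioi 0, kN t x y * w.weakDeriv y) p μ := by
      refine eLpNorm_congr_ae ?_
      filter_upwards [ae_restrict_mem measurableSet_Ioi] with x hx
      rw [← integral_kDx_mul_primitive ht (Lp.memLp w.weakDeriv) hx]
      refine integral_congr_ae ?_
      filter_upwards [hw] with y hy
      rw [hy]
    rw [e]
    refine (ENNReal.toReal_mono (ENNReal.mul_lt_top ENNReal.ofReal_lt_top
      ((isSource_coe w.weakDeriv).2 _ hr)).ne
        (eLpNorm_integral_kernel_le hκ (abs_kN_le ht) w.weakDeriv)).trans_eq ?_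
    rw [ENNReal.toReal_mul, ENNReal.toReal_ofReal hκ]
  have h3 := w.norm_toLp_le
  have h4 := w.norm_weakDeriv_le
  refine (W1p.norm_le_add _).trans ((add_le_add h1 h2).trans ?_)
  nlinarith

/-- The Dirichlet heat flow of an element of `W^{1,p}(0, ∞)`. -/
def heatFlow (w : W1p p) (t : ℝ) : W1p p := if t = 0 then w else heatW p t w.toLp

theorem stronglyMeasurable_heatFlow (w : W1p p) : StronglyMeasurable (heatFlow w) :=
  StronglyMeasurable.ite (measurableSet_eq_fun measurable_id measurable_const)
    stronglyMeasurable_const (stronglyMeasurable_heatW (isSource_coe w.toLp))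

theorem toLp_heatFlow_ae {w : W1p p} {t : ℝ} (ht : 0 ≤ t) :
    (heatFlow w t).toLp =ᵐ[μ] dirichletHeat t w.toLp := by
  rcases ht.eq_or_lt with rfl | ht
  · refine Eventually.of_forall fun x => ?_
    rw [heatFlow, if_pos rfl, dirichletHeat, if_pos rfl]
  · rw [heatFlow, if_neg ht.ne']
    exact W1p.toLp_ae_eq_of_val_eq fun x hx => val_heatW ht (isSource_coe w.toLp) hx

theorem exists_norm_heatFlow_le {w : W1p p} (hw : w.HasBoundaryValue 0) :
    ∃ N : ℝ, ∀ t, 0 ≤ t → ‖heatFlow w t‖ ≤ N := by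
  refine ⟨max ‖w‖ (8 * heatConst * ‖w‖), fun t ht => ?_⟩
  rcases ht.eq_or_lt with rfl | ht
  · rw [heatFlow, if_pos rfl]; exact le_max_left _ _
  · rw [heatFlow, if_neg ht.ne']
    exact (norm_heatW_le_of_primitive ht (W1p.ae_eq_primitive_of_hasBoundaryValue_zero hw)).trans
      (le_max_right _ _)

end HalfLine

/-! ### The boundary potential in W^{1,p} -/

namespace HalfLine

open Filter Topology

theorem eLpNorm_le_of_exp_bound {p : ℝ≥0∞} (hp : 1 ≤ p) (hp' : p ≠ ⊤) {F : ℝ → ℝ} {κ c : ℝ}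
    (hκ : 0 ≤ κ) (hc : 0 < c) (hF : ∀ x, 0 < x → |F x| ≤ κ * Real.exp (-c * x)) :
    eLpNorm F p μ ≤ ENNReal.ofReal (κ * (1 / c) ^ (1 / p.toReal)) := by
  have hp1 : 1 ≤ p.toReal := by
    rw [← ENNReal.toReal_one]; exact ENNReal.toReal_mono hp' hp
  have hp0 : 0 < p.toReal := one_pos.trans_le hp1
  have hcp : -(c * p.toReal) < 0 := neg_neg_of_pos (mul_pos hc hp0)
  have h1 : ∫⁻ x in Ioi 0, ‖F x‖ₑ ^ p.toReal ≤ ENNReal.ofReal (κ ^ p.toReal * (1 / c)) := by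
    calc ∫⁻ x in Ioi 0, ‖F x‖ₑ ^ p.toReal
        ≤ ∫⁻ x in Ioi 0, ENNReal.ofReal (κ ^ p.toReal * Real.exp (-(c * p.toReal) * x)) := by
          refine setLIntegral_mono' measurableSet_Ioi fun x hx => ?_
          rw [← ofReal_norm, ENNReal.ofReal_rpow_of_nonneg (norm_nonneg _) hp0.le]
          refine ENNReal.ofReal_le_ofReal ?_
          refine (Real.rpow_le_rpow (norm_nonneg _) (hF x hx) hp0.le).trans_eq ?_
          rw [Real.mul_rpow hκ (Real.exp_pos _).le, ← Real.exp_mul]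
          ring_nf
      _ = ENNReal.ofReal (κ ^ p.toReal * (1 / (c * p.toReal))) := by
          rw [← ofReal_integral_eq_lintegral_ofReal ((integrableOn_exp_mul_Ioi hcp 0).const_mul _)
            (Eventually.of_forall fun x => by positivity), integral_const_mul,
            integral_exp_mul_Ioi hcp]
          simp only [mul_zero, Real.exp_zero, neg_div_neg_eq]
      _ ≤ _ := by
          refine ENNReal.ofReal_le_ofReal (mul_le_mul_of_nonneg_left ?_ (by positivity))
          exact one_div_le_one_div_of_le hc (le_mul_of_one_le_right hc.le hp1)
  rw [eLpNorm_eq_lintegral_rpow_enorm_toReal (one_pos.trans_le hp).ne' hp']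
  refine (ENNReal.rpow_le_rpow h1 (by positivity)).trans_eq ?_
  rw [ENNReal.ofReal_rpow_of_nonneg (by positivity) (by positivity),
    Real.mul_rpow (by positivity) (by positivity), ← Real.rpow_mul hκ, mul_one_div_cancel hp0.ne',
    Real.rpow_one]

theorem norm_toLp_le_of_exp_bound {p : ℝ≥0∞} [Fact (1 ≤ p)] (hp' : p ≠ ⊤) {F : ℝ → ℝ}
    (hm : MemLp F p μ) {κ c : ℝ} (hκ : 0 ≤ κ) (hc : 0 < c)
    (hF : ∀ x, 0 < x → |F x| ≤ κ * Real.exp (-c * x)) :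
    ‖hm.toLp F‖ ≤ κ * (1 / c) ^ (1 / p.toReal) := by
  rw [Lp.norm_toLp]
  exact ENNReal.toReal_le_of_le_ofReal (by positivity)
    (eLpNorm_le_of_exp_bound Fact.out hp' hκ hc hF)

theorem G_eq_rate_mul {t : ℝ} (ht : 0 < t) (x : ℝ) : G t x = rate t * G 1 (rate t * x) := by
  have h1 : √(4 * Real.pi * t) = √(4 * Real.pi * 1) * √t := by
    rw [← Real.sqrt_mul (by positivity), mul_one]
  have h2 : -(rate t * x) ^ 2 / (4 * 1) = -x ^ 2 / (4 * t) := by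
    rw [mul_pow, rate_sq ht]; field_simp
  rw [G, G, h1, h2, rate]
  have := Real.sqrt_pos.2 ht
  field_simp

theorem continuous_G {t : ℝ} (ht : 0 < t) : Continuous (G t) :=
  continuous_iff_continuousAt.2 fun x => (hasDerivAt_G ht x).continuousAt

theorem rate_one : rate 1 = 1 := by simp [rate]

theorem abs_G_one_le {y : ℝ} (hy : 0 ≤ y) : |G 1 y| ≤ heatConst * Real.exp (-1 * y) := by
  have := norm_G_le one_pos y
  rwa [rate_one, abs_of_nonneg hy, mul_one] at this

theorem integrableOn_G_one {z : ℝ} (hz : 0 ≤ z) : IntegrableOn (G 1) (Ioi z) := by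
  refine ((exp_neg_integrableOn_Ioi z one_pos).const_mul heatConst).mono'
    (continuous_G one_pos).aestronglyMeasurable ?_
  filter_upwards [ae_restrict_mem measurableSet_Ioi] with y hy
  exact abs_G_one_le (hz.trans (le_of_lt hy))

/-- The function `z ↦ -∫_z^∞ G(1, y) dy`, i.e. minus one half of the complementary error function
of `z / 2`. -/
def negTail (z : ℝ) : ℝ := (∫ y in (0 : ℝ)..z, G 1 y) - ∫ y in Ioi 0, G 1 y

theorem hasDerivAt_negTail (z : ℝ) : HasDerivAt negTail (G 1 z) z :=
  (intervalIntegral.integral_hasDerivAt_right ((continuous_G one_pos).intervalIntegrable _ _)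
    ((continuous_G one_pos).stronglyMeasurableAtFilter _ _)
    (continuous_G one_pos).continuousAt).sub_const _

theorem abs_negTail_le {z : ℝ} (hz : 0 ≤ z) : |negTail z| ≤ heatConst * Real.exp (-1 * z) := by
  have h1 : negTail z = -∫ y in Ioi z, G 1 y := by
    rw [negTail, ← intervalIntegral.integral_interval_add_Ioi (integrableOn_G_one le_rfl)
      (integrableOn_G_one hz)]
    ring
  rw [h1, abs_neg]
  refine (norm_integral_le_integral_norm (μ := volume.restrict (Ioi z)) (G 1)).trans ?_
  have h2 : ∫ y in Ioi z, heatConst * Real.exp (-1 * y) = heatConst * Real.exp (-1 * z) := by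
    rw [integral_const_mul, integral_exp_mul_Ioi (by norm_num)]; simp
  rw [← h2]
  exact setIntegral_mono_on (integrableOn_G_one hz).norm
    ((exp_neg_integrableOn_Ioi z one_pos).const_mul heatConst) measurableSet_Ioi
    fun y hy => abs_G_one_le (hz.trans (le_of_lt hy))

/-- From `z²/2 ≤ e^z` at `z = x/√s`. At fixed `x > 0` it makes `∂ₓG(s, x)` bounded in `s`, hence
integrable in time. -/
theorem rate_sq_mul_exp_le {s x : ℝ} (hs : 0 < s) (hx : 0 < x) :
    rate s ^ 2 * Real.exp (-rate s * x) ≤ 2 / x ^ 2 := by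
  have hr := rate_pos hs
  have h1 := Real.quadratic_le_exp_of_nonneg (mul_pos hr hx).le
  rw [neg_mul, Real.exp_neg, ← div_eq_mul_inv, div_le_div_iff₀ (Real.exp_pos _) (by positivity)]
  have := mul_pos hr hx
  nlinarith

theorem intervalIntegrable_Gx {t x : ℝ} (ht : 0 ≤ t) (hx : 0 < x) :
    IntervalIntegrable (fun s => Gx s x) volume 0 t := by
  rw [intervalIntegrable_iff_integrableOn_Ioc_of_le ht]
  refine Measure.integrableOn_of_bounded (M := heatConst * (2 / x ^ 2)) (by simp)
    (measurable_Gx.comp measurable_prodMk_right).aestronglyMeasurable ?_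
  filter_upwards [ae_restrict_mem measurableSet_Ioc] with s hs
  have h := norm_Gx_le hs.1 x
  rw [abs_of_pos hx, mul_assoc] at h
  exact h.trans (mul_le_mul_of_nonneg_left (rate_sq_mul_exp_le hs.1 hx) heatConst_pos.le)

theorem tendsto_rate_zero : Tendsto rate (𝓝[>] 0) atTop := by
  have h : Tendsto (fun s : ℝ => √s) (𝓝[>] 0) (𝓝[>] 0) := by
    refine tendsto_nhdsWithin_iff.2 ⟨?_, ?_⟩
    · have := (Real.continuous_sqrt.tendsto 0).mono_left (nhdsWithin_le_nhds (s := Ioi 0))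
      rwa [Real.sqrt_zero] at this
    · filter_upwards [self_mem_nhdsWithin] with s hs using Real.sqrt_pos.2 hs
  exact tendsto_inv_nhdsGT_zero.comp h

theorem hasDerivAt_rate {s : ℝ} (hs : 0 < s) : HasDerivAt rate (-(rate s) / (2 * s)) s := by
  have h := (Real.hasDerivAt_sqrt hs.ne').inv (Real.sqrt_pos.2 hs).ne'
  refine h.congr_deriv ?_
  have h0 := Real.sqrt_pos.2 hs
  rw [rate, Real.sq_sqrt hs.le]
  field_simp

/-- By self-similarity of `G`, the function `s ↦ negTail (x/√s)` is an antiderivative of `∂ₓG(s, x)`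
in time, and it tends to `0` as `s → 0`. -/
theorem integral_Gx_eq {t x : ℝ} (ht : 0 < t) (hx : 0 < x) :
    ∫ s in (0 : ℝ)..t, Gx s x = negTail (rate t * x) := by
  have hd : ∀ s, 0 < s → HasDerivAt (fun s => negTail (rate s * x)) (Gx s x) s := by
    intro s hs
    refine ((hasDerivAt_negTail (rate s * x)).comp s
      ((hasDerivAt_rate hs).mul_const x)).congr_deriv ?_
    rw [Gx, G_eq_rate_mul hs]
    ring
  rw [intervalIntegral.integral_eq_sub_of_hasDerivAt_of_tendsto ht (fun s hs => hd s hs.1)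
    (intervalIntegrable_Gx ht.le hx) (fa := 0) (fb := negTail (rate t * x)) ?_
    ((hd t ht).continuousAt.tendsto.mono_left nhdsWithin_le_nhds), sub_zero]
  have h1 : Tendsto (fun s => heatConst * Real.exp (-1 * (rate s * x))) (𝓝[>] 0) (𝓝 0) := by
    rw [← mul_zero heatConst]
    refine Tendsto.const_mul _ (Real.tendsto_exp_atBot.comp ?_)
    rw [mul_zero]
    exact (tendsto_rate_zero.atTop_mul_const hx).const_mul_atTop_of_neg (by norm_num)
  refine squeeze_zero_norm' ?_ h1
  filter_upwards [self_mem_nhdsWithin] with s hs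
  exact abs_negTail_le (mul_pos (rate_pos hs) hx).le

variable {p : ℝ≥0∞} [Fact (1 ≤ p)]

theorem exists_of_exp_decay (hp' : p ≠ ⊤) {F F' : ℝ → ℝ} (hd : ∀ x, HasDerivAt F (F' x) x)
    (hF' : Continuous F') {κ κ' c : ℝ} (hκ : 0 ≤ κ) (hκ' : 0 ≤ κ') (hc : 0 < c)
    (hb : ∀ x, 0 < x → |F x| ≤ κ * Real.exp (-c * x))
    (hb' : ∀ x, 0 < x → |F' x| ≤ κ' * Real.exp (-c * x)) :
    ∃ w : W1p p, ‖w‖ ≤ (κ + κ') * (1 / c) ^ (1 / p.toReal) ∧ w.toLp =ᵐ[μ] F ∧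
      w.weakDeriv =ᵐ[μ] F' := by
  have hF : Continuous F := continuous_iff_continuousAt.2 fun x => (hd x).continuousAt
  have hm : MemLp F p μ := ⟨hF.aestronglyMeasurable,
    (eLpNorm_le_of_exp_bound Fact.out hp' hκ hc hb).trans_lt ENNReal.ofReal_lt_top⟩
  have hm' : MemLp F' p μ := ⟨hF'.aestronglyMeasurable,
    (eLpNorm_le_of_exp_bound Fact.out hp' hκ' hc hb').trans_lt ENNReal.ofReal_lt_top⟩
  refine ⟨W1p.mk hm hm' (isWeakDeriv_of_hasDerivAt (fun x _ => hd x)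
    (hm'.locallyIntegrable Fact.out)), (W1p.norm_le_add _).trans ?_, hm.coeFn_toLp,
    hm'.coeFn_toLp⟩
  rw [W1p.toLp_mk, W1p.weakDeriv_mk, add_mul]
  exact add_le_add (norm_toLp_le_of_exp_bound hp' _ hκ hc hb)
    (norm_toLp_le_of_exp_bound hp' _ hκ' hc hb')

variable [Fact (p ≠ ⊤)]

/-- A strongly measurable path in `W^{1,p}(0, ∞)` built from functions that, for `t > 0`, decay
exponentially with their derivatives. -/
theorem exists_path_of_exp_decay {F F' : ℝ → ℝ → ℝ} (hF : Measurable (Function.uncurry F))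
    (hF' : Measurable (Function.uncurry F')) (hd : ∀ t, 0 < t → ∀ x, HasDerivAt (F t) (F' t x) x)
    (hc' : ∀ t, 0 < t → Continuous (F' t)) {κ κ' c : ℝ → ℝ} (hκ : ∀ t, 0 < t → 0 ≤ κ t)
    (hκ' : ∀ t, 0 < t → 0 ≤ κ' t) (hc : ∀ t, 0 < t → 0 < c t)
    (hb : ∀ t, 0 < t → ∀ x, 0 < x → |F t x| ≤ κ t * Real.exp (-c t * x))
    (hb' : ∀ t, 0 < t → ∀ x, 0 < x → |F' t x| ≤ κ' t * Real.exp (-c t * x)) :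
    ∃ w : ℝ → W1p p, StronglyMeasurable w ∧ w 0 = 0 ∧
      (∀ t, 0 < t → ‖w t‖ ≤ (κ t + κ' t) * (1 / c t) ^ (1 / p.toReal)) ∧
      ∀ t, 0 < t → ∀ x, 0 < x → (w t).val x = F t x := by
  have hp' : p ≠ ⊤ := Fact.out
  choose w₀ hn hv hv' using fun t (ht : 0 < t) => exists_of_exp_decay (p := p) hp' (hd t ht)
    (hc' t ht) (hκ t ht) (hκ' t ht) (hc t ht) (hb t ht) (hb' t ht)
  let w : ℝ → W1p p := fun t => if ht : 0 < t then w₀ t ht else 0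
  have hw : ∀ t (ht : 0 < t), w t = w₀ t ht := fun t ht => dif_pos ht
  have hw0 : ∀ t, ¬ 0 < t → w t = 0 := fun t ht => dif_neg ht
  have hae : ∀ t, 0 < t → (w t).toLp =ᵐ[μ] F t ∧ (w t).weakDeriv =ᵐ[μ] F' t := fun t ht => by
    rw [hw t ht]; exact ⟨hv t ht, hv' t ht⟩
  have hite : ∀ H : ℝ → ℝ → ℝ, Measurable (Function.uncurry H) →
      Measurable (Function.uncurry fun t x => if 0 < t then H t x else 0) := fun H hH =>
    Measurable.ite (measurableSet_lt measurable_const measurable_fst) hH measurable_const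
  refine ⟨w, ?_, hw0 0 (lt_irrefl 0), fun t ht => ?_, fun t ht x hx => ?_⟩
  · refine W1p.stronglyMeasurable_of_toLp_weakDeriv (stronglyMeasurable_toLp (hite F hF) fun t => ?_)
      (stronglyMeasurable_toLp (hite F' hF') fun t => ?_)
    · by_cases ht : 0 < t
      · simp only [ht, if_true]; exact (hae t ht).1
      · simp only [ht, if_false, hw0 t ht]; exact Lp.coeFn_zero ℝ p μ
    · by_cases ht : 0 < t
      · simp only [ht, if_true]; exact (hae t ht).2
      · simp only [ht, if_false, hw0 t ht]; exact Lp.coeFn_zero ℝ p μ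
  · rw [hw t ht]; exact hn t ht
  · exact W1p.val_eq_of_ae_eq (fun x _ => (hd t ht x).continuousAt.continuousWithinAt)
      (hae t ht).1 hx

theorem boundaryPotential_eq (ψ : ℝ → ℝ) {t : ℝ} (ht : 0 ≤ t) (x : ℝ) :
    boundaryPotential ψ t x = -2 * ∫ τ in (0 : ℝ)..t, Gx (t - τ) x * ψ τ := by
  rw [boundaryPotential, intervalIntegral.integral_of_le ht, intervalIntegral.integral_of_le ht]
  congr 1
  refine integral_congr_ae ?_
  filter_upwards [IsVolterraKernel.ae_mem_Ioo t] with τ hτ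
  rw [(hasDerivAt_G (sub_pos.2 hτ.2) x).deriv]

theorem rate_pow {t : ℝ} (ht : 0 < t) (n : ℕ) : rate t ^ n = t ^ (-(n / 2) : ℝ) := by
  rw [rate_eq_rpow ht, ← Real.rpow_natCast, ← Real.rpow_mul ht.le]
  ring_nf

theorem one_div_rate_rpow {t : ℝ} (ht : 0 < t) (a : ℝ) : (1 / rate t) ^ a = t ^ (a / 2) := by
  rw [rate_eq_rpow ht, one_div, ← Real.rpow_neg ht.le, ← Real.rpow_mul ht.le]
  ring_nf

variable (p) in
-- Each space derivative costs `s^{-1/2}`, and the `L^p` norm of `e^{-x/√s}` gains `s^{1/(2p)}`.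
theorem exists_Gx_path : ∃ g : ℝ → W1p p, StronglyMeasurable g ∧
    (∀ s, 0 < s → ‖g s‖ ≤ heatConst *
      (s ^ (-1 + 1 / (2 * p.toReal)) + s ^ (-(3 / 2) + 1 / (2 * p.toReal)))) ∧
    ∀ s, 0 < s → ∀ x, 0 < x → (g s).val x = Gx s x := by
  have hC := heatConst_pos
  obtain ⟨g, h1, -, h2, h3⟩ := exists_path_of_exp_decay (p := p) (F := Gx) (F' := Gxx)
    measurable_Gx measurable_Gxx (fun t ht x => hasDerivAt_Gx ht x)
    (fun t ht => by unfold Gxx; have := continuous_G ht; fun_prop)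
    (κ := fun t => heatConst * rate t ^ 2) (κ' := fun t => heatConst * rate t ^ 3) (c := rate)
    (fun t ht => by positivity) (fun t ht => mul_nonneg hC.le (pow_nonneg (rate_nonneg t) 3))
    (fun t ht => rate_pos ht)
    (fun t ht x hx => by have := norm_Gx_le ht x; rwa [abs_of_pos hx] at this)
    (fun t ht x hx => by have := norm_Gxx_le ht x; rwa [abs_of_pos hx] at this)
  refine ⟨g, h1, fun s hs => (h2 s hs).trans_eq ?_, h3⟩
  rw [rate_pow hs, rate_pow hs, one_div_rate_rpow hs, ← mul_add, mul_assoc, add_mul,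
    ← Real.rpow_add hs, ← Real.rpow_add hs]
  push_cast
  ring_nf

variable (p) in
theorem exists_negTail_path : ∃ e : ℝ → W1p p, StronglyMeasurable e ∧ e 0 = 0 ∧
    (∀ t, 0 < t → ‖e t‖ ≤ heatConst *
      (t ^ (1 / (2 * p.toReal)) + t ^ (-(1 / 2) + 1 / (2 * p.toReal)))) ∧
    ∀ t, 0 < t → ∀ x, 0 < x → (e t).val x = negTail (rate t * x) := by
  have hC := heatConst_pos
  have hcont : Continuous negTail :=
    continuous_iff_continuousAt.2 fun x => (hasDerivAt_negTail x).continuousAt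
  have hrate : Measurable rate := by unfold rate; fun_prop
  obtain ⟨e, h1, h0, h2, h3⟩ := exists_path_of_exp_decay (p := p)
    (F := fun t x => negTail (rate t * x)) (F' := G)
    (hcont.measurable.comp ((hrate.comp measurable_fst).mul measurable_snd)) measurable_G
    (fun t ht x => by
      refine ((hasDerivAt_negTail (rate t * x)).comp x
        ((hasDerivAt_id x).const_mul (rate t))).congr_deriv ?_
      rw [G_eq_rate_mul ht]; ring)
    (fun t ht => continuous_G ht)
    (κ := fun _ => heatConst) (κ' := fun t => heatConst * rate t) (c := rate)
    (fun t ht => hC.le) (fun t ht => mul_nonneg hC.le (rate_nonneg t))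
    (fun t ht => rate_pos ht)
    (fun t ht x hx => by
      have := abs_negTail_le (mul_pos (rate_pos ht) hx).le
      rwa [neg_one_mul, ← neg_mul] at this)
    (fun t ht x hx => by have := norm_G_le ht x; rwa [abs_of_pos hx] at this)
  refine ⟨e, h1, h0, fun t ht => (h2 t ht).trans_eq ?_, h3⟩
  rw [rate_eq_rpow ht, ← rate_eq_rpow ht, one_div_rate_rpow ht, rate_eq_rpow ht, add_mul, mul_assoc,
    ← Real.rpow_add ht]
  ring_nf

theorem stronglyMeasurable_setIntegral_Ioc {E : Type*} [NormedAddCommGroup E] [NormedSpace ℝ E]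
    {f : ℝ × ℝ → E} (hf : StronglyMeasurable f) :
    StronglyMeasurable fun t => ∫ τ in Ioc 0 t, f (t, τ) := by
  have hm : MeasurableSet {q : ℝ × ℝ | 0 < q.2 ∧ q.2 ≤ q.1} :=
    (measurableSet_lt measurable_const measurable_snd).inter
      (measurableSet_le measurable_snd measurable_fst)
  have h1 := (hf.indicator hm).integral_prod_right' (ν := volume)
  have e : (fun t => ∫ τ in Ioc 0 t, f (t, τ)) =
      fun t => ∫ τ, {q : ℝ × ℝ | 0 < q.2 ∧ q.2 ≤ q.1}.indicator f (t, τ) := by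
    funext t
    rw [← integral_indicator measurableSet_Ioc]
    rfl
  rw [e]
  exact h1

/-- Writing `ψ(τ) = (ψ(τ) - ψ(t)) + ψ(t)` splits the potential into a Bochner integral, convergent
by Hölder continuity, and the explicit term `-2 ψ(t) negTail(x/√t)`, controlled because `ψ(0) = 0`.
-/
theorem exists_boundary_path {T : ℝ} {β : ℝ} {ψ : ℝ → ℝ} (hψm : Continuous ψ) {C : ℝ}
    (hC : 0 ≤ C) (hψ : ∀ s ∈ Icc 0 T, ∀ t ∈ Icc 0 T, |ψ s - ψ t| ≤ C * |s - t| ^ β)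
    (hψ0 : ψ 0 = 0) (hδ : 0 < β - 1 / 2 + 1 / (2 * p.toReal)) :
    ∃ (u : ℝ → W1p p) (N : ℝ), StronglyMeasurable u ∧ (∀ t ∈ Icc 0 T, ‖u t‖ ≤ N) ∧
      ∀ t ∈ Icc 0 T, ∀ x, 0 < x → (u t).val x = boundaryPotential ψ t x := by
  have hH := heatConst_pos
  obtain ⟨g, hgm, hgn, hgv⟩ := exists_Gx_path p
  obtain ⟨e, hem, he0, hen, hev⟩ := exists_negTail_path p
  set δ := β - 1 / 2 + 1 / (2 * p.toReal) with hδdef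
  -- The norm bound for `∂ₓG(s, ·)` multiplied by the Hölder bound `C s^β`; it is integrable at `0`
  -- precisely because `δ > 0`.
  let ρ : ℝ → ℝ := fun s => C * (heatConst * (s ^ (δ - 1 / 2) + s ^ (δ - 1)))
  have hρ0 : ∀ s, 0 ≤ s → 0 ≤ ρ s := fun s hs => by
    have := Real.rpow_nonneg hs (δ - 1 / 2)
    have := Real.rpow_nonneg hs (δ - 1)
    positivity
  have hρi : ∀ t, 0 ≤ t → IntervalIntegrable ρ volume 0 t := fun t ht =>
    (((intervalIntegral.intervalIntegrable_rpow' (by linarith)).add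
      (intervalIntegral.intervalIntegrable_rpow' (by linarith))).const_mul _).const_mul _
  have hρi' : ∀ t, 0 ≤ t → IntegrableOn (fun τ => ρ (t - τ)) (Ioc 0 t) := fun t ht => by
    have h2 := ((hρi t ht).comp_sub_left t).symm
    simp only [sub_self, sub_zero] at h2
    exact (intervalIntegrable_iff_integrableOn_Ioc_of_le ht).1 h2
  have hf : StronglyMeasurable fun q : ℝ × ℝ => (ψ q.2 - ψ q.1) • g (q.1 - q.2) := by
    have h1 : StronglyMeasurable fun q : ℝ × ℝ => ψ q.2 - ψ q.1 :=
      ((hψm.comp continuous_snd).sub (hψm.comp continuous_fst)).stronglyMeasurable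
    have h2 : Measurable fun q : ℝ × ℝ => q.1 - q.2 := measurable_fst.sub measurable_snd
    exact h1.smul (hgm.comp_measurable h2)
  have hfb : ∀ t ∈ Icc 0 T, ∀ τ ∈ Ioo 0 t, ‖(ψ τ - ψ t) • g (t - τ)‖ ≤ ρ (t - τ) := by
    intro t ht τ hτ
    have hs : 0 < t - τ := sub_pos.2 hτ.2
    rw [norm_smul, Real.norm_eq_abs]
    have h1 := hψ τ ⟨hτ.1.le, hτ.2.le.trans ht.2⟩ t ht
    rw [abs_sub_comm τ t, abs_of_pos hs] at h1
    have h3 := Real.rpow_pos_of_pos hs β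
    refine (mul_le_mul h1 (hgn _ hs) (norm_nonneg _) (by positivity)).trans_eq ?_
    have e1 : (t - τ) ^ (δ - 1 / 2) = (t - τ) ^ β * (t - τ) ^ (-1 + 1 / (2 * p.toReal)) := by
      rw [← Real.rpow_add hs, hδdef]; ring_nf
    have e2 : (t - τ) ^ (δ - 1) = (t - τ) ^ β * (t - τ) ^ (-(3 / 2) + 1 / (2 * p.toReal)) := by
      rw [← Real.rpow_add hs, hδdef]; ring_nf
    simp only [ρ, e1, e2]
    ring
  have hfi : ∀ t ∈ Icc 0 T, IntegrableOn (fun τ => (ψ τ - ψ t) • g (t - τ)) (Ioc 0 t) := by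
    intro t ht
    refine (hρi' t ht.1).mono' (hf.comp_measurable measurable_prodMk_left).aestronglyMeasurable ?_
    filter_upwards [IsVolterraKernel.ae_mem_Ioo t] with τ hτ using hfb t ht τ hτ
  refine ⟨fun t => (-2 : ℝ) • (∫ τ in Ioc 0 t, (ψ τ - ψ t) • g (t - τ)) - (2 * ψ t) • e t,
    2 * (∫ s in (0 : ℝ)..T, ρ s) + 2 * (C * (heatConst * (T ^ (δ + 1 / 2) + T ^ δ))), ?_, ?_, ?_⟩
  · have h1 := (stronglyMeasurable_setIntegral_Ioc hf).const_smul (-2 : ℝ)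
    have h2 := (hψm.stronglyMeasurable.const_mul 2).smul hem
    exact h1.sub h2
  · intro t ht
    have h1 : ‖∫ τ in Ioc 0 t, (ψ τ - ψ t) • g (t - τ)‖ ≤ ∫ s in (0 : ℝ)..T, ρ s := by
      calc _ ≤ ∫ τ in Ioc 0 t, ρ (t - τ) := by
            refine norm_integral_le_of_norm_le (hρi' t ht.1) ?_
            filter_upwards [IsVolterraKernel.ae_mem_Ioo t] with τ hτ using hfb t ht τ hτ
        _ = ∫ s in (0 : ℝ)..t, ρ s := by
            rw [← intervalIntegral.integral_of_le ht.1,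
              intervalIntegral.integral_comp_sub_left ρ t, sub_self, sub_zero]
        _ ≤ ∫ s in (0 : ℝ)..T, ρ s := by
            refine intervalIntegral.integral_mono_interval le_rfl ht.1 ht.2 ?_
              (hρi T (ht.1.trans ht.2))
            filter_upwards [ae_restrict_mem measurableSet_Ioc] with s hs using hρ0 s hs.1.le
    have h2 : ‖ψ t • e t‖ ≤ C * (heatConst * (T ^ (δ + 1 / 2) + T ^ δ)) := by
      rcases ht.1.eq_or_lt with rfl | ht0
      · rw [he0, smul_zero, norm_zero]
        have := Real.rpow_nonneg ht.2 (δ + 1 / 2)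
        have := Real.rpow_nonneg ht.2 δ
        positivity
      · rw [norm_smul, Real.norm_eq_abs]
        have h3 := hψ t ht 0 ⟨le_rfl, ht.1.trans ht.2⟩
        rw [hψ0, sub_zero, sub_zero, abs_of_pos ht0] at h3
        have h4 := Real.rpow_pos_of_pos ht0 β
        refine (mul_le_mul h3 (hen _ ht0) (norm_nonneg _) (by positivity)).trans ?_
        have e1 : t ^ (δ + 1 / 2) = t ^ β * t ^ (1 / (2 * p.toReal)) := by
          rw [← Real.rpow_add ht0, hδdef]; ring_nf
        have e2 : t ^ δ = t ^ β * t ^ (-(1 / 2) + 1 / (2 * p.toReal)) := by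
          rw [← Real.rpow_add ht0, hδdef]; ring_nf
        calc _ = C * (heatConst * (t ^ (δ + 1 / 2) + t ^ δ)) := by rw [e1, e2]; ring
          _ ≤ _ := by
            have h5 := ht.2
            have h6 := ht.1
            gcongr
    refine (norm_sub_le _ _).trans ?_
    rw [norm_smul, mul_smul, norm_smul]
    have e3 : ‖(-2 : ℝ)‖ = 2 := by norm_num
    have e4 : ‖(2 : ℝ)‖ = 2 := by norm_num
    rw [e3, e4]
    linarith
  · intro t ht x hx
    beta_reduce
    rw [boundaryPotential_eq ψ ht.1, ← W1p.evalL_apply hx, map_sub, map_smul, map_smul,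
      ← ContinuousLinearMap.integral_comp_comm _ (hfi t ht), W1p.evalL_apply, smul_eq_mul,
      smul_eq_mul, intervalIntegral.integral_of_le ht.1]
    rcases ht.1.eq_or_lt with rfl | ht0
    · simp [hψ0]
    have hi1 := (W1p.evalL x hx).integrable_comp (hfi t ht)
    have hae : (fun τ => W1p.evalL x hx ((ψ τ - ψ t) • g (t - τ)))
        =ᵐ[volume.restrict (Ioc 0 t)] fun τ => (ψ τ - ψ t) * Gx (t - τ) x := by
      filter_upwards [IsVolterraKernel.ae_mem_Ioo t] with τ hτ
      rw [map_smul, W1p.evalL_apply, hgv _ (sub_pos.2 hτ.2) x hx, smul_eq_mul]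
    have hi2 : IntegrableOn (fun τ => Gx (t - τ) x) (Ioc 0 t) := by
      have h2 := ((intervalIntegrable_Gx ht.1 hx).comp_sub_left t).symm
      simp only [sub_self, sub_zero] at h2
      exact (intervalIntegrable_iff_integrableOn_Ioc_of_le ht.1).1 h2
    have h3 : ∫ τ in Ioc 0 t, Gx (t - τ) x = negTail (rate t * x) := by
      rw [← intervalIntegral.integral_of_le ht.1,
        intervalIntegral.integral_comp_sub_left (fun s => Gx s x) t, sub_self, sub_zero,
        integral_Gx_eq ht0 hx]
    have h4 : ∫ τ in Ioc 0 t, Gx (t - τ) x * ψ τ =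
        (∫ τ in Ioc 0 t, (ψ τ - ψ t) * Gx (t - τ) x) + ψ t * ∫ τ in Ioc 0 t, Gx (t - τ) x := by
      rw [← integral_const_mul, ← integral_add ((integrable_congr hae).1 hi1) (hi2.const_mul _)]
      refine integral_congr_ae (Eventually.of_forall fun τ => ?_)
      ring
    rw [integral_congr_ae hae, h4, h3, hev t ht0 x hx]
    ring

end HalfLine

/-! ### From Volterra equations to mild solutions -/

namespace HalfLine

open Filter Topology

variable {p : ℝ≥0∞} [Fact (1 ≤ p)]

namespace W1p

theorem toLp_add_ae (w w' : W1p p) : (w + w').toLp =ᵐ[μ] fun x => w.toLp x + w'.toLp x := by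
  have h : (w + w').toLp = w.toLp + w'.toLp := map_add toLpL w w'
  rw [h]
  exact Lp.coeFn_add _ _

theorem eq_of_toLp_ae_eq {w w' : W1p p} {F : ℝ → ℝ} (h : w.toLp =ᵐ[μ] F)
    (h' : w'.toLp =ᵐ[μ] F) : w = w' :=
  toLp_injective (Lp.ext (h.trans h'.symm))

end W1p

variable [Fact (p ≠ ⊤)]

theorem Coeffs.toLp_volterra_ae (c : Coeffs) (hp : 2 ≤ p) {T : ℝ} {b : ℝ → Lp ℝ 2 μ}
    {γ : ℝ × ℝ → ℝ} (hb : c.b =ᵐ[timeμ T] b)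
    (hγ : Function.uncurry c.γ =ᵐ[(timeμ T).prod μ] γ) {w : ℝ → W1p p}
    (hw : MemLp w ∞ (timeμ T)) {t : ℝ} (ht : t ∈ Icc 0 T) :
    (volterra (c.kernelV hp) w t).toLp =ᵐ[μ] duhamel (lowerOrder b γ w) t :=
  W1p.toLp_ae_eq_of_val_eq fun _ hx => c.val_volterra hp hb hγ hw ht hx

theorem memLp_top_timeμ {T : ℝ} {w : ℝ → W1p p} (hw : StronglyMeasurable w) {N : ℝ}
    (hN : ∀ t ∈ Icc 0 T, ‖w t‖ ≤ N) : MemLp w ∞ (timeμ T) :=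
  memLp_top_of_bound hw.aestronglyMeasurable N
    ((ae_restrict_mem measurableSet_Icc).mono fun t ht => hN t ht)

theorem exists_boundary_path_of_holderOnWith {T : ℝ} (hT : 0 < T) {β : ℝ≥0} (hβ : 0 < β)
    {ψ : ℝ → ℝ} {C : ℝ≥0} (hψ : HolderOnWith C β ψ (Icc 0 T)) (hψ0 : ψ 0 = 0)
    (hδ : 0 < (β : ℝ) - 1 / 2 + 1 / (2 * p.toReal)) :
    ∃ (u : ℝ → W1p p) (N : ℝ), StronglyMeasurable u ∧ (∀ t ∈ Icc 0 T, ‖u t‖ ≤ N) ∧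
      ∀ t ∈ Icc 0 T, (u t).toLp =ᵐ[μ] boundaryPotential ψ t := by
  -- Only `ψ` on `[0, T]` is controlled; a continuous extension supplies global measurability and
  -- leaves the potential on `[0, T]` unchanged.
  let φ : ℝ → ℝ := IccExtend hT.le ((Icc 0 T).domRestrict ψ)
  have hφ : ∀ t ∈ Icc 0 T, φ t = ψ t := fun t ht => IccExtend_of_mem hT.le _ ht
  have hφc : Continuous φ := (hψ.continuousOn hβ).domRestrict.Icc_extend'
  obtain ⟨u, N, h1, h2, h3⟩ := exists_boundary_path (p := p) (T := T) hφc C.coe_nonneg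
    (fun s hs t ht => by
      rw [hφ s hs, hφ t ht, ← Real.dist_eq, ← Real.dist_eq]
      exact hψ.dist_le hs ht)
    ((hφ 0 ⟨le_rfl, hT.le⟩).trans hψ0) hδ
  refine ⟨u, N, h1, h2, fun t ht => W1p.toLp_ae_eq_of_val_eq fun x hx => ?_⟩
  rw [h3 t ht x hx, boundaryPotential, boundaryPotential]
  congr 1
  refine intervalIntegral.integral_congr fun τ hτ => ?_
  rw [uIcc_of_le ht.1] at hτ
  rw [hφ τ ⟨hτ.1, hτ.2.trans ht.2⟩]

/-- The upper bound on `p` says `1 - 2β < 1/p`; halving gives the positive exponent that the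
boundary potential needs. -/
theorem toReal_exponent_pos {β : ℝ≥0} (hβ' : β < 1 / 2) {p : ℝ≥0∞} (hp : 2 ≤ p)
    (hp' : p < ENNReal.ofReal (1 / (1 - 2 * (β : ℝ)))) :
    0 < (β : ℝ) - 1 / 2 + 1 / (2 * p.toReal) := by
  have hβ1 : (β : ℝ) < 1 / 2 := by exact_mod_cast hβ'
  have hd : 0 < 1 - 2 * (β : ℝ) := by linarith
  have h2 : 2 ≤ p.toReal := by
    simpa using ENNReal.toReal_mono (ne_top_of_lt hp') hp
  have h1 : p.toReal < 1 / (1 - 2 * (β : ℝ)) := by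
    rw [← ENNReal.toReal_ofReal (one_div_pos.2 hd).le]
    exact ENNReal.toReal_strict_mono ENNReal.ofReal_ne_top hp'
  rw [lt_div_iff₀ hd] at h1
  have h3 : 1 / (2 * p.toReal) = 1 / p.toReal / 2 := by field_simp
  have h4 : 1 - 2 * (β : ℝ) < 1 / p.toReal := by
    rw [lt_div_iff₀ (by linarith)]
    linarith
  rw [h3]
  linarith

end HalfLine

end

theorem mainTheorem6 (T : ℝ) (hT : 0 < T)
    -- `ψ ∈ C^β([0,T])` with `ψ(0) = 0` and `1/4 < β < 1/2`
    (β : ℝ≥0) (hβ : 1 / 4 < β) (hβ' : β < 1 / 2)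
    (ψ : ℝ → ℝ) (hψ : ∃ C : ℝ≥0, HolderOnWith C β ψ (Icc 0 T)) (hψ0 : ψ 0 = 0)
    -- `2 ≤ p < 1 / (1 - 2β)`
    (p : ℝ≥0∞) [Fact (1 ≤ p)] (hp : 2 ≤ p) (hp' : p < ENNReal.ofReal (1 / (1 - 2 * (β : ℝ))))
    -- `b ∈ L^∞([0,T], L²(ℝ₊))` and `γ ∈ L^∞([0,T] × ℝ₊)`
    (b : ℝ → Lp ℝ 2 HalfLine.μ) (hb : MemLp b ∞ (HalfLine.timeμ T))
    (γ : ℝ × ℝ → ℝ) (hγ : MemLp γ ∞ ((HalfLine.timeμ T).prod HalfLine.μ))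
    -- `s₀ ∈ W^{1,p}(ℝ₊)` with `s₀(0) = 0`
    (s₀ : HalfLine.W1p p) (hs₀ : s₀.HasBoundaryValue 0) :
    ∃ s u v : ℝ → HalfLine.W1p p,
      (HalfLine.IsMildSolution T ψ b γ s₀ s ∧
        ∀ s', HalfLine.IsMildSolution T ψ b γ s₀ s' → EqOn s' s (Icc 0 T)) ∧
      (HalfLine.IsMildSolutionHeat T ψ u ∧
        ∀ u', HalfLine.IsMildSolutionHeat T ψ u' → EqOn u' u (Icc 0 T)) ∧
      (HalfLine.IsMildSolutionZeroBdry T b γ s₀ u v ∧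
        ∀ v', HalfLine.IsMildSolutionZeroBdry T b γ s₀ u v' → EqOn v' v (Icc 0 T)) ∧
      ∀ t ∈ Icc 0 T, s t = u t + v t := by
  have : Fact (p ≠ ⊤) := ⟨ne_top_of_lt hp'⟩
  obtain ⟨C, hC⟩ := hψ
  obtain ⟨c, hcb, hcγ⟩ := HalfLine.exists_coeffs hb hγ
  obtain ⟨u, N, hum, huN, hu⟩ := HalfLine.exists_boundary_path_of_holderOnWith (p := p) hT
    (lt_of_le_of_lt zero_le hβ) hC hψ0 (HalfLine.toReal_exponent_pos hβ' hp hp')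
  obtain ⟨M, hM⟩ := HalfLine.exists_norm_heatFlow_le hs₀
  have hV := c.isVolterraKernel hp T
  have huL := HalfLine.memLp_top_timeμ hum huN
  have hD := fun {w : ℝ → HalfLine.W1p p} (hw : MemLp w ∞ (HalfLine.timeμ T)) (t : ℝ)
    (ht : t ∈ Icc 0 T) => c.toLp_volterra_ae hp hcb hcγ hw ht
  have hH := fun (t : ℝ) (ht : t ∈ Icc 0 T) => HalfLine.toLp_heatFlow_ae (w := s₀) ht.1
  -- For any bounded path `w`, the right-hand side of the mild equation is represented by an element
  -- of `W^{1,p}`. Solving the mild equation thus means solving a Volterra equation.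
  have key : ∀ {w : ℝ → HalfLine.W1p p}, MemLp w ∞ (HalfLine.timeμ T) → ∀ t ∈ Icc 0 T,
      (u t + HalfLine.heatFlow s₀ t + volterra (c.kernelV hp) w t).toLp =ᵐ[HalfLine.μ] fun x =>
        HalfLine.boundaryPotential ψ t x + HalfLine.dirichletHeat t s₀.toLp x +
          HalfLine.duhamel (HalfLine.lowerOrder b γ w) t x := by
    intro w hw t ht
    filter_upwards [HalfLine.W1p.toLp_add_ae (u t + HalfLine.heatFlow s₀ t)
      (volterra (c.kernelV hp) w t), HalfLine.W1p.toLp_add_ae (u t) (HalfLine.heatFlow s₀ t),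
      hu t ht, hH t ht, hD hw t ht] with x h1 h2 h3 h4 h5
    rw [h1, h2, h3, h4, h5]
  have key' : ∀ {w : ℝ → HalfLine.W1p p}, MemLp w ∞ (HalfLine.timeμ T) → ∀ t ∈ Icc 0 T,
      (HalfLine.heatFlow s₀ t + volterra (c.kernelV hp) u t +
        volterra (c.kernelV hp) w t).toLp =ᵐ[HalfLine.μ] fun x =>
        HalfLine.dirichletHeat t s₀.toLp x + HalfLine.duhamel (HalfLine.lowerOrder b γ w) t x +
          HalfLine.duhamel (HalfLine.lowerOrder b γ u) t x := by
    intro w hw t ht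
    filter_upwards [HalfLine.W1p.toLp_add_ae
      (HalfLine.heatFlow s₀ t + volterra (c.kernelV hp) u t) (volterra (c.kernelV hp) w t),
      HalfLine.W1p.toLp_add_ae (HalfLine.heatFlow s₀ t) (volterra (c.kernelV hp) u t),
      hD huL t ht, hH t ht, hD hw t ht] with x h1 h2 h3 h4 h5
    rw [h1, h2, h3, h4, h5, add_right_comm]
  obtain ⟨s, hsL, hs⟩ := hV.exists_solution (r := fun t => u t + HalfLine.heatFlow s₀ t)
    (N := N + M) (hum.add (HalfLine.stronglyMeasurable_heatFlow s₀)).aestronglyMeasurable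
    fun t ht => (norm_add_le _ _).trans (add_le_add (huN t ht) (hM t ht.1))
  have hvL : MemLp (fun t => s t - u t) ∞ (HalfLine.timeμ T) := hsL.sub huL
  -- Linearity, `V s = V u + V (s - u)`: existence of `v` needs no second fixed-point argument.
  have hv : ∀ t ∈ Icc 0 T, s t - u t = HalfLine.heatFlow s₀ t + volterra (c.kernelV hp) u t +
      volterra (c.kernelV hp) (fun t => s t - u t) t := by
    intro t ht
    rw [hV.volterra_sub hsL huL ht, hs t ht]
    abel
  refine ⟨s, u, fun t => s t - u t, ⟨⟨hsL, fun t ht => ?_⟩, fun s' h' => ?_⟩,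
    ⟨⟨huL, hu⟩, fun u' h' t ht => HalfLine.W1p.eq_of_toLp_ae_eq (h'.eqn t ht) (hu t ht)⟩,
    ⟨⟨hvL, fun t ht => ?_⟩, fun v' h' => ?_⟩, fun t _ => (add_sub_cancel _ _).symm⟩
  · rw [hs t ht]
    exact key hsL t ht
  · exact hV.eqOn_of_eq_add_volterra h'.memLp hsL
      (fun t ht => HalfLine.W1p.eq_of_toLp_ae_eq (h'.eqn t ht) (key h'.memLp t ht)) hs
  · rw [hv t ht]
    exact key' hvL t ht
  · exact hV.eqOn_of_eq_add_volterra h'.memLp hvL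
      (fun t ht => HalfLine.W1p.eq_of_toLp_ae_eq (h'.eqn t ht) (key' h'.memLp t ht)) hv
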